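/- **Ballot tilings.** A ballot path is a word $\lambda$ of length $N$ in $U=(1,1)$, $D=(1,-1)$, read as a lattice path from the origin, that never goes below $y=0$. For a path $\mu$ of length $N$ weakly above $\lambda$, the shifted skew shape $\lambda/\mu$ consists of the boxes (squares rotated by $45^\circ$, with vertices $(x\pm1,y),(x,y\pm1)$) whose centre $(x,y)$ lies strictly between the two paths, with $1\le x\le N$ and $x+y$ odd. Boxes with $x=N$ are anchor boxes. A ballot tile of length $(2n,n')$ is a ribbon of boxes whose centres form, up to translation, a ballot path from $(0,0)$ to $(2n+n',n')$. Let $\mathcal B^I(\lambda/\mu)$ be the set of tilings of $\lambda/\mu$ by ballot tiles such that: (i) every tile, moved down by one box, is either strictly below $\lambda$ or contained in another tile; (ii) the rightmost box of each tile with $n'\ge1$ is an anchor box; (iii) for all $n$ and all $n'\ge 1$, the number of tiles of length $(2n,n')$ is even if $n'$ is odd and zero if $n'$ is even. Put $\mathrm{art}=n+1$ for a tile of length $(2n,0)$ and $\mathrm{art}=(2n+1+n')/2$ for a tile of length $(2n,n')$ with $n'\ge1$; $\mathrm{art}(B)$ is the sum over the tiles of $B$. Define $$P^I_{\lambda,\ast}=\sum_{\mu}\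 \sum_{B\in\mathcal B^I(\lambda/\mu)}q^{\mathrm{art}(B)} .$$ **The tree.** Write $\lambda=z_mUz_{m-1}U\cdots Uz_1Uz_0$ with (possibly empty) Dyck words $z_i$, and call the displayed up steps $U_m,\dots,U_1$ from left to right. The plane tree $A(\lambda)$ is built from right to left. For a Dyck word, $A(\emptyset)$ is the one-point tree, $A(UzD)$ is $A(z)$ with a new edge put above its root, and concatenation of Dyck words corresponds to gluing trees at their roots from left to right. Similarly, prepending a Dyck word $z$ to a suffix of $\lambda$ glues $A(z)$ at the root on the left. Prepending $U_i$ puts a new edge, marked with a dot $\bullet$, above the whole tree if $i$ is odd, and does not change the tree if $i$ is even. If $z_k=x_s\cdots x_1$ with $k$ odd and $x_j$ nonempty indecomposable Dyck words, there are arrows from the root edge just created by $U_k$ to the root edge of $A(x_1)$ and from the root edge of $A(x_j)$ to that of $A(x_{j+1})$ for $1\le j<s$. There are no other arrows. **Words.** Let $E$ be the number of edges of $A(\lambda)$. A natural labelling puts each of $1,\dots,E$ on one edge, increasing from the root to the leaves. The modified post-order $\mathrm{post}(L)$ reads the labels so that an undotted edge is visited after all edges below it, a dotted edge before all edges below it,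 and each edge and its subtree after its left siblings and their subtrees; the labels of dotted edges are barred. **Signed permutations.** A signed permutation of degree $E$ is written in one-line notation $\sigma(1)\cdots\sigma(E)$, barred letters being negative. Products are composed from left to right, $(\sigma\tau)(i)=\tau(\sigma(i))$; the generators are the transpositions $s_i=(i,i+1)$ for $i<E$, and $s_E=(E,-E)$. Thus $s_i\sigma$ exchanges the letters in positions $i,i+1$ of $\sigma$, and $s_E\sigma$ changes the sign of the last letter. One has $v\ge_L u$ if some final subword of some reduced word for $v$ is a reduced word for $u$. Let $$\mathrm{Inv}(\sigma)=\#\{i<j:|\sigma(i)|>|\sigma(j)|\}+2\,\#\{i<j:0<-\sigma(i)<|\sigma(j)|\}+\#\{i:\sigma(i)<0\}.$$ **Theorem.** Let $\lambda$ be a ballot path such that $A(\lambda)$ has no arrows. Let $L_0$ be the natural labelling of $A(\lambda)$ whose labels, read in pre-order from left to right, are $1,2,\dots,E$, and let $\sigma_0=\mathrm{post}(L_0)$, a signed permutation of degree $E$. Then $\mathrm{Inv}(\sigma)\ge\mathrm{Inv}(\sigma_0)$ for all $\sigma\ge_L\sigma_0$, and $$P^I_{\lambda,\ast}=\sum_{\sigma\ge_L\sigma_0}q^{\mathrm{Inv}(\sigma)-\mathrm{Inv}(\sigma_0)}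 .$$ -/

import Mathlib

namespace BallotTiling

open Polynomial

/-! ### Lattice paths -/

instance instFintypeDyckStep : Fintype DyckStep :=
  ⟨{DyckStep.U, DyckStep.D}, fun s => by cases s <;> simp⟩

/-- The height of the path `l` (a word in `U = (1,1)` and `D = (1,-1)`, starting at the origin)
after `i` steps, i.e. the ordinate of its point with abscissa `i`. -/
def height (l : List DyckStep) (i : ℕ) : ℤ :=
  ((l.take i).count DyckStep.U : ℤ) - ((l.take i).count DyckStep.D : ℤ)

/-- A ballot path: the path never goes below the line `y = 0`. -/
def IsBallotPath (l : List DyckStep) : Prop :=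
  ∀ i ≤ l.length, 0 ≤ height l i

instance (l : List DyckStep) : Decidable (IsBallotPath l) := by
  unfold IsBallotPath; infer_instance

/-- All words of length `n` in the letters `U`, `D`. -/
def words (n : ℕ) : Finset (List DyckStep) :=
  (Finset.univ : Finset (Fin n → DyckStep)).image List.ofFn

/-- `mu` is weakly above `lam` (two paths of the same length). -/
def IsAbove (mu lam : List DyckStep) : Prop :=
  mu.length = lam.length ∧ ∀ i ≤ lam.length, height lam i ≤ height mu i

instance (mu lam : List DyckStep) : Decidable (IsAbove mu lam) := by
  unfold IsAbove; infer_instance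

/-! ### Shifted skew shapes and ballot tilings of type BI

A box is a square rotated by 45 degrees, with vertices `(x ± 1, y)`, `(x, y ± 1)`; it is
recorded by its centre `(x, y)`. For paths of length `N` the boxes with `x = N` are the anchor
boxes. -/

/-- The boxes of the shifted skew shape between the lower path `lam` and the upper path `mu`,
both of length `N`: in each column `1 ≤ x ≤ N`, the centres strictly between the two paths
(a box centre `(x, y)` has `x + y` odd). -/
noncomputable def skewShape (lam mu : List DyckStep) : Finset (ℕ × ℤ) :=
  (Finset.Icc 1 lam.length).biUnion fun x =>
    ((Finset.Ioo (height lam x) (height mu x)).filter fun y => Odd ((x : ℤ) + y)).image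
      fun y => (x, y)

/-- A ribbon whose box centres follow a lattice path: `start` is the leftmost box, and
`path` is the path formed by the centres of the boxes, seen from the leftmost one. -/
structure Tile where
  start : ℕ × ℤ
  path : List DyckStep
deriving DecidableEq

namespace Tile

/-- The boxes of a tile. -/
def boxes (t : Tile) : Finset (ℕ × ℤ) :=
  (Finset.range (t.path.length + 1)).image fun i => (t.start.1 + i, t.start.2 + height t.path i)

/-- For a tile of length `(2n, n')` (path from `(0,0)` to `(2n + n', n')`), the number `n`. -/
def n (t : Tile) : ℕ := t.path.count DyckStep.D

/-- For a tile of length `(2n, n')`, the number `n'`. -/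
def n' (t : Tile) : ℕ := t.path.count DyckStep.U - t.path.count DyckStep.D

/-- `2n + 1` for a Dyck tile (`n' = 0`) and `2n + 1 + n'` otherwise. -/
def area (t : Tile) : ℕ := 2 * t.n + 1 + t.n'

/-- `1` for a Dyck tile, `0` for a ballot tile with `n' ≥ 1`. -/
def tiles (t : Tile) : ℕ := if t.n' = 0 then 1 else 0

/-- The statistic `art` of type BI. (The division is exact when `n'` is zero or odd.) -/
def art (t : Tile) : ℕ := (t.area + t.tiles) / 2

end Tile

/-- All tiles with leftmost box in the skew shape and fewer than `N` steps, `N` being the length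
of `lam`. Every ribbon contained in the skew shape is among them. -/
noncomputable def candidateTiles (lam mu : List DyckStep) : Finset Tile :=
  (skewShape lam mu ×ˢ (Finset.range lam.length).biUnion words).image fun p => ⟨p.1, p.2⟩

/-- `T` is a tiling of the skew shape between `lam` and `mu` by ballot tiles. -/
def IsBallotTiling (lam mu : List DyckStep) (T : Finset Tile) : Prop :=
  (∀ t ∈ T, IsBallotPath t.path) ∧
  (∀ s ∈ T, ∀ t ∈ T, s ≠ t → Disjoint s.boxes t.boxes) ∧
  T.biUnion Tile.boxes = skewShape lam mu

/-- Cover-inclusiveness: each tile, translated down by one box, is strictly below the lower path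
or contained in another tile. -/
def IsCoverInclusive (lam : List DyckStep) (T : Finset Tile) : Prop :=
  ∀ t ∈ T,
    (∀ b ∈ t.boxes, b.2 - 2 < height lam b.1) ∨
    (∃ s ∈ T, s ≠ t ∧ ∀ b ∈ t.boxes, (b.1, b.2 - 2) ∈ s.boxes)

/-- The rightmost box of every tile of length `(2n, n')` with `n' ≥ 1` is an anchor box. -/
def IsAnchored (lam : List DyckStep) (T : Finset Tile) : Prop :=
  ∀ t ∈ T, 1 ≤ t.n' → t.start.1 + t.path.length = lam.length

/-- The constraint of type BI: for each `n` and each `n' ≥ 1`, the number of tiles of length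
`(2n, n')` is even if `n'` is odd, and zero if `n'` is even. (It is enough to say so for the
lengths which occur in `T`.) -/
def IsTypeBI (T : Finset Tile) : Prop :=
  ∀ t ∈ T, 1 ≤ t.n' →
    Odd t.n' ∧ Even (T.filter fun s => s.n = t.n ∧ s.n' = t.n').card

noncomputable instance (lam mu : List DyckStep) (T : Finset Tile) : Decidable (IsBallotTiling lam mu T) := by
  unfold IsBallotTiling; infer_instance

instance (lam : List DyckStep) (T : Finset Tile) : Decidable (IsCoverInclusive lam T) := by
  unfold IsCoverInclusive; infer_instance

instance (lam : List DyckStep) (T : Finset Tile) : Decidable (IsAnchored lam T) := by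
  unfold IsAnchored; infer_instance

instance (T : Finset Tile) : Decidable (IsTypeBI T) := by
  unfold IsTypeBI; infer_instance

/-- The cover-inclusive ballot tilings of type BI of the skew shape between `lam` and `mu`. -/
noncomputable def tilingsBI (lam mu : List DyckStep) : Finset (Finset Tile) :=
  (candidateTiles lam mu).powerset.filter fun T =>
    IsBallotTiling lam mu T ∧ IsCoverInclusive lam T ∧ IsAnchored lam T ∧ IsTypeBI T

/-- The generating function of the tilings with lower path `lam` and upper path `mu`. -/
noncomputable def genFunBI (lam mu : List DyckStep) : ℤ[X] :=
  ∑ T ∈ tilingsBI lam mu, X ^ (∑ t ∈ T, t.art)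

/-- The generating function with fixed lower path `lam`, summed over all upper paths. -/
noncomputable def genFunBILower (lam : List DyckStep) : ℤ[X] :=
  ∑ mu ∈ (words lam.length).filter (fun mu => IsAbove mu lam), genFunBI lam mu

/-! ### Plane trees -/

/-- A planted plane tree whose edges carry data in `α`, given by the list of edges at its root
from left to right: `cons a below right` has leftmost root edge with data `a`, the tree `below`
hanging from the lower end of that edge, and the remaining part `right` of the tree to the right
of that edge (with the same root). -/
inductive PlaneTree (α : Type) : Type
  | nil : PlaneTree α
  | cons (a : α) (below right : PlaneTree α) : PlaneTree α

namespace PlaneTree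

/-- The number of edges. -/
def numEdges {α : Type} : PlaneTree α → ℕ
  | nil => 0
  | cons _ below right => below.numEdges + 1 + right.numEdges

/-- Apply a function to the data on all edges. -/
def map {α β : Type} (f : α → β) : PlaneTree α → PlaneTree β
  | nil => nil
  | cons a below right => cons (f a) (below.map f) (right.map f)

/-- The data on the edges, read in pre-order from left to right. -/
def preOrder {α : Type} : PlaneTree α → List α
  | nil => []
  | cons a below right => a :: (below.preOrder ++ right.preOrder)

end PlaneTree

/-- The marks of an edge: `dot` says that it carries a `•`; `arrow` says that it has an incoming
dashed arrow, which always comes from the next edge to the right at the same vertex. -/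
structure EdgeMark where
  dot : Bool
  arrow : Bool
deriving DecidableEq

/-- The state reached after reading a suffix of a path from right to left.
* `unmatched` : the number of `U`'s in the suffix that are not paired with a `D` to their right;
* `current` : the tree of the innermost level which is still open on the left;
* `pending` : the trees of the outer levels, one for each `D` in the suffix whose `U` has not yet
  been met; the last one is the outermost level. -/
structure ParseState where
  unmatched : ℕ
  current : PlaneTree EdgeMark
  pending : List (PlaneTree EdgeMark)

/-- Read a suffix of a path from right to left. Write a ballot path as
`z_m U z_{m-1} U ⋯ U z_1 U z_0` with Dyck words `z_i`; call the displayed `U`'s `U_m, …, U_1`.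
* A `U` paired with a `D`, as in `U z D`, gives an undotted edge with the tree of `z` below it, and
  the tree of the remaining part of the same level to its right. It has an incoming arrow exactly
  if it is a maximal edge of some `z_k` with `k` odd.
* `U_1` (the terminal `U`), and `U_{2r+1}` with `r ≥ 1` (the left member of the `UU`-pair
  `U_{2r+1}, U_{2r}`), give a dotted edge put above the whole tree built so far.
* `U_{2r}` (the right member of a `UU`-pair, or an extra `U` if `2r = m`) does not change
  the tree. -/
def parse : List DyckStep → ParseState
  | [] => ⟨0, .nil, []⟩
  | DyckStep.D :: l =>
      let s := parse l
      ⟨s.unmatched, .nil, s.current :: s.pending⟩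
  | DyckStep.U :: l =>
      let s := parse l
      match s.pending with
      | right :: outer =>
          ⟨s.unmatched,
            .cons ⟨false, decide (outer = [] ∧ Odd s.unmatched)⟩ s.current right, outer⟩
      | [] =>
          if Even s.unmatched then ⟨s.unmatched + 1, .cons ⟨true, false⟩ s.current .nil, []⟩
          else ⟨s.unmatched + 1, s.current, []⟩

/-- The plane tree `A(lam)` of a ballot path, with its dots and arrows. -/
def ballotTree (lam : List DyckStep) : PlaneTree EdgeMark := (parse lam).current

/-- The tree has no arrows. -/
def NoArrows (T : PlaneTree EdgeMark) : Prop := ∀ e ∈ T.preOrder, e.arrow = false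

/-! ### Natural labellings -/

/-- The labels strictly increase from the root to the leaves, and are all larger than `m`. -/
def LabelsIncrease : ℕ → PlaneTree (EdgeMark × ℕ) → Prop
  | _, .nil => True
  | m, .cons a below right => m < a.2 ∧ LabelsIncrease a.2 below ∧ LabelsIncrease m right

/-- `pre'(L)`: the labels in pre-order. -/
def preWord (L : PlaneTree (EdgeMark × ℕ)) : List ℕ := L.preOrder.map Prod.snd

/-- `L` is a natural labelling of `T`: each of `1, …, E` (`E` the number of edges) is used exactly
once, and labels increase from the root to the leaves. -/
def IsNaturalLabelling (T : PlaneTree EdgeMark) (L : PlaneTree (EdgeMark × ℕ)) : Prop :=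
  L.map Prod.fst = T ∧ (preWord L).Perm (List.range' 1 T.numEdges) ∧ LabelsIncrease 0 L

/-- `post(L)`: the labels in modified post-order; an undotted edge is visited after the edges
below it, a dotted edge before the edges below it, and in any case after all edges to its left.
The labels on dotted edges are barred, which is written as a minus sign. -/
def postWord : PlaneTree (EdgeMark × ℕ) → List ℤ
  | .nil => []
  | .cons a below right =>
      (if a.1.dot then (-(a.2 : ℤ)) :: postWord below else postWord below ++ [(a.2 : ℤ)]) ++
        postWord right

/-- Number the edges in pre-order, starting with `k`. -/
def numberFrom : ℕ → PlaneTree EdgeMark → PlaneTree (EdgeMark × ℕ)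
  | _, .nil => .nil
  | k, .cons a below right =>
      .cons (a, k) (numberFrom (k + 1) below) (numberFrom (k + 1 + below.numEdges) right)

theorem map_fst_numberFrom (T : PlaneTree EdgeMark) :
    ∀ k, (numberFrom k T).map Prod.fst = T := by
  induction T with
  | nil => intro k; rfl
  | cons a below right ih1 ih2 => intro k; simp [numberFrom, PlaneTree.map, ih1, ih2]

theorem preWord_numberFrom (T : PlaneTree EdgeMark) :
    ∀ k, preWord (numberFrom k T) = List.range' k T.numEdges := by
  induction T with
  | nil => intro k; rfl
  | cons a below right ih1 ih2 =>
    intro k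
    have h1 := ih1 (k + 1)
    have h2 := ih2 (k + 1 + below.numEdges)
    simp only [preWord] at h1 h2
    simp only [preWord, numberFrom, PlaneTree.preOrder, List.map_cons, List.map_append, h1, h2,
      PlaneTree.numEdges]
    rw [show below.numEdges + 1 + right.numEdges = (below.numEdges + right.numEdges) + 1 by ring,
      List.range'_succ, ← List.range'_append_1]

theorem labelsIncrease_numberFrom (T : PlaneTree EdgeMark) :
    ∀ m k, m < k → LabelsIncrease m (numberFrom k T) := by
  induction T with
  | nil => intro m k _; trivial
  | cons a below right ih1 ih2 =>
    intro m k h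
    exact ⟨h, ih1 _ _ (Nat.lt_succ_self k), ih2 _ _ (by omega)⟩

/-- Every tree has a natural labelling whose pre-order word is the identity (the reference
labelling). -/
theorem exists_reference_labelling (T : PlaneTree EdgeMark) :
    ∃ L, IsNaturalLabelling T L ∧ preWord L = List.range' 1 T.numEdges := by
  refine ⟨numberFrom 1 T, ⟨map_fst_numberFrom T 1, ?_, labelsIncrease_numberFrom T 0 1 one_pos⟩,
    preWord_numberFrom T 1⟩
  rw [preWord_numberFrom]

/-! ### Signed permutations -/

/-- A signed permutation of `{±1, …, ±N}`: the `i`-th letter of its one-line notation has absolute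
value `perm i` (shifted by one), and is barred, i.e. negative, if `neg i` is true. -/
structure SignedPerm (N : ℕ) where
  perm : Equiv.Perm (Fin N)
  neg : Fin N → Bool
deriving DecidableEq, Fintype

namespace SignedPerm

variable {N : ℕ}

/-- The `i`-th letter `σ(i)` of the one-line notation. -/
def val (σ : SignedPerm N) (i : Fin N) : ℤ :=
  if σ.neg i then -(((σ.perm i : ℕ) : ℤ) + 1) else ((σ.perm i : ℕ) : ℤ) + 1

/-- The one-line notation. -/
def oneLine (σ : SignedPerm N) : List ℤ := List.ofFn σ.val

/-- The inversion statistic. -/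
def inv (σ : SignedPerm N) : ℕ :=
  (Finset.univ.filter fun p : Fin N × Fin N => p.1 < p.2 ∧ |σ.val p.1| > |σ.val p.2|).card
  + 2 * (Finset.univ.filter fun p : Fin N × Fin N =>
      p.1 < p.2 ∧ 0 < -σ.val p.1 ∧ -σ.val p.1 < |σ.val p.2|).card
  + (Finset.univ.filter fun i : Fin N => σ.val i < 0).card

/-- The identity. -/
def one : SignedPerm N := ⟨Equiv.refl _, fun _ => false⟩

/-- The product `σ τ`, composed from left to right: `(σ τ)(i) = τ(σ(i))`, where
`τ(-j) = -τ(j)`. -/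
def mul (σ τ : SignedPerm N) : SignedPerm N :=
  ⟨σ.perm.trans τ.perm, fun i => xor (σ.neg i) (τ.neg (σ.perm i))⟩

/-- The simple reflections `s_1, …, s_N` (here indexed from `0`): `s_i` is the transposition
`(i, i+1)` for `i < N`, and `s_N` exchanges `N` and `-N`. The product of `s_i` with `σ` exchanges
the `i`-th and `(i+1)`-st letters of `σ`, and that of `s_N` with `σ` bars or unbars the last
letter. -/
def simple (i : Fin N) : SignedPerm N :=
  if h : (i : ℕ) + 1 < N then ⟨Equiv.swap i ⟨i + 1, h⟩, fun _ => false⟩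
  else ⟨Equiv.refl _, fun j => decide (j = i)⟩

/-- The product `s_{i_1} s_{i_2} ⋯ s_{i_p}` of a word. -/
def wordProd (w : List (Fin N)) : SignedPerm N :=
  w.foldr (fun i σ => mul (simple i) σ) one

/-- `w` is a reduced word for `σ`. -/
def IsReducedWord (w : List (Fin N)) (σ : SignedPerm N) : Prop :=
  wordProd w = σ ∧ ∀ w' : List (Fin N), wordProd w' = σ → w.length ≤ w'.length

/-- The weak left order `v ≥_L u`: some final subword of some reduced word for `v` is a reduced
word for `u`. -/
def WeakLeftGE (v u : SignedPerm N) : Prop :=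
  ∃ w₁ w₂ : List (Fin N), IsReducedWord (w₁ ++ w₂) v ∧ IsReducedWord w₂ u

end SignedPerm

end BallotTiling

/-! Write [k] for the q-integer and E for the number of edges of the tree. Let `hookProd` be the
product of [h] over the edges, where h counts the edges weakly below, with [2h] in place of [h] at a
dotted edge. Both generating functions of the theorem, multiplied by `hookProd`, equal [2][4]⋯[2E].
As `hookProd` is a nonzero polynomial, they coincide.

Tilings. Cover-inclusiveness forces every tile to run parallel to `lam` inside one layer, and in
each column the layers in which it is joined to the previous column form an initial segment. A
tiling is therefore a pair of functions: c, the number of boxes in a column, and L, the number of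
joins. Without arrows the path consists of chords (a matched U and D) and of adjacent pairs UU of
unmatched steps, preceded by at most one further U. The conditions on the tiles become local: L
agrees at the two ends of a chord, returns to its base value at the first step of a pair, and
exceeds it by an even number at the second (`HasBallotRuns.isValuation`,
`IsValuation.hasBallotRuns`). The statistic is a sum over steps (`sum_art_tilingOf`), so the
generating function obeys a transfer recursion along the word. A Dyck word with n chords acts, up to
its hook product, as the n-th power of the single operator `peakOp`, whatever its shape. This rests
on `chordOp_iterate_peakOp` and, for pairs UU, on `doubleUpOp_iterate_peakOp`, both proved with
explicit generating functions. Evaluation at 0 gives the product.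

Permutations. The weak left order is inclusion of inversion sets, and `inv` is their cardinality
(`weakLeftGE_iff`, `inv_eq_card_invSet`). Replace a signed permutation by the list giving, for each
letter, its distance from the end of the word with the sign of the letter. Then σ lies above the
reference permutation exactly when this list is `Compatible` with the tree (`dominated_refArr_iff`).
Compatible lists are counted by a hook formula, `hookProd_mul_arrSum`, obtained by relaxing the
condition at one edge at a time. -/

namespace BallotTiling

/-! ### A `q`-analogue of a Laguerre-type operator -/

section QOperators

open PowerSeries
open Finset hiding mk

variable {A : Type*} [CommRing A]

/-- The `q`-integer `1 + q + ⋯ + q ^ (n - 1)`. -/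
def qInt (q : A) (n : ℕ) : A := ∑ i ∈ range n, q ^ i

theorem sub_one_mul_qInt (q : A) (n : ℕ) : (q - 1) * qInt q n = q ^ n - 1 :=
  mul_geom_sum q n

theorem qInt_succ (q : A) (n : ℕ) : qInt q (n + 1) = qInt q n + q ^ n := by
  simp [qInt, sum_range_succ]

/-- The `q`-factorial. -/
def qFact (q : A) (n : ℕ) : A := ∏ i ∈ range n, qInt q (i + 1)

theorem qFact_succ (q : A) (n : ℕ) : qFact q (n + 1) = qInt q (n + 1) * qFact q n := by
  rw [qFact, prod_range_succ, mul_comm, qFact]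

/-- The tridiagonal operator describing the tilings above a single `UD`. -/
def peakOp (q : A) (f : ℕ → A) (a : ℕ) : A :=
  q ^ (a + 1) * qInt q (a + 1) * f (a + 1) + q ^ a * (qInt q (a + 1) + qInt q a) * f a
    + q ^ (a - 1) * qInt q a * f (a - 1)

/-- The contribution of the path `U z D` with fixed height of the shape after the `U`; `z` has
`n` chords and contributes by `L`. -/
def chordCore (q : A) (n : ℕ) (L : (ℕ → A) → ℕ → A) (f : ℕ → A) (a : ℕ) : A :=
  ∑ l ∈ range (a + 1), q ^ (a - l + l * n) *
    L (fun b => q ^ (b + l) * f (b + l) + q ^ (b + l + 1) * f (b + l + 1)) (a - l)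

/-- The operator of `U z D` when `z` has `n` chords and operator `L`. -/
def chordOp (q : A) (n : ℕ) (L : (ℕ → A) → ℕ → A) (f : ℕ → A) (a : ℕ) : A :=
  chordCore q n L f a + if a = 0 then 0 else chordCore q n L f (a - 1)

/-- Since (q - 1)[n] = q^n - 1, each q-integer in `peakOp` becomes a difference of powers of q, and
these powers act on the generating function as rescalings of X by q^2 and by q. -/
theorem X_mul_mk_peakOp (q : A) (f : ℕ → A) :
    X * C (q - 1) * mk (peakOp q f) =
      (1 + X) * ((1 + C q * X) * rescale (q ^ 2) (mk f) - (1 + X) * rescale q (mk f)) := by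
  have key : (1 + X) * ((1 + C q * X) * rescale (q ^ 2) (mk f) - (1 + X) * rescale q (mk f)) =
      rescale (q ^ 2) (mk f) - rescale q (mk f)
        + X * (C (q + 1) * rescale (q ^ 2) (mk f) - C 2 * rescale q (mk f))
        + X * (X * (C q * rescale (q ^ 2) (mk f) - rescale q (mk f))) := by
    simp only [map_add, map_one, map_ofNat]; ring
  rw [key, mul_assoc]
  ext n
  rcases n with _ | _ | n
  · simp [-coeff_zero_eq_constantCoeff, coeff_zero_X_mul, coeff_rescale]
  · have h1 := sub_one_mul_qInt q 1
    simp only [LinearMap.map_add, LinearMap.map_sub, coeff_succ_X_mul, coeff_zero_X_mul,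
      coeff_C_mul, coeff_mk, coeff_rescale]
    simp [-coeff_zero_eq_constantCoeff, qInt, peakOp]
    ring
  · have h1 := sub_one_mul_qInt q (n + 1)
    have h2 := sub_one_mul_qInt q (n + 2)
    simp only [LinearMap.map_add, LinearMap.map_sub, coeff_succ_X_mul, coeff_C_mul, coeff_mk,
      coeff_rescale, peakOp, Nat.add_sub_cancel]
    linear_combination (q ^ (n + 1) * f (n + 1) + q ^ n * f n) * h1
      + (q ^ (n + 2) * f (n + 2) + q ^ (n + 1) * f (n + 1)) * h2

/-- The denominator of the generating function of `peakOp ^ n`. -/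
noncomputable def denom (q y : A) (n : ℕ) : A⟦X⟧ :=
  ∏ i ∈ range (n + 1), (1 - C (q ^ (n + i) * y) * X)

/-- The numerator of the generating function of `peakOp ^ n`. -/
noncomputable def numer (q y : A) (n : ℕ) : A⟦X⟧ :=
  (∏ i ∈ range n, (1 + C (q ^ i) * X)) * ∏ i ∈ range n, C (1 + q ^ (i + 1) * y)

theorem rescale_linear (c a : A) : rescale c (C a * X : A⟦X⟧) = C (a * c) * X := by
  ext n
  rw [coeff_rescale, coeff_C_mul, coeff_C_mul, coeff_X]
  split_ifs with h
  · subst h; ring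
  · ring

theorem rescale_denom (q y c : A) (n : ℕ) :
    rescale c (denom q y n) = ∏ i ∈ range (n + 1), (1 - C (q ^ (n + i) * y * c) * X) := by
  rw [denom, map_prod]
  exact prod_congr rfl fun i _ => by rw [map_sub, map_one, rescale_linear]

/-- The factors of the denominator for n + 1 carry q^(n+1), …, q^(2n+2). Without the first they are
the rescaling by q^2 of the denominator for n; without the last (`denom_succ_right`) they are its
rescaling by q. -/
theorem denom_succ_left (q y : A) (n : ℕ) :
    denom q y (n + 1) = (1 - C (q ^ (n + 1) * y) * X) * rescale (q ^ 2) (denom q y n) := by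
  rw [rescale_denom, denom, prod_range_succ', mul_comm, add_zero]
  congr 1
  refine prod_congr rfl fun i _ => ?_
  congr 3; ring

theorem denom_succ_right (q y : A) (n : ℕ) :
    denom q y (n + 1) = rescale q (denom q y n) * (1 - C (q ^ (2 * n + 2) * y) * X) := by
  rw [rescale_denom, denom, prod_range_succ]
  congr 1
  · refine prod_congr rfl fun i _ => ?_
    congr 3; ring
  · congr 3; ring

theorem rescale_C' (c a : A) : rescale c (C a : A⟦X⟧) = C a := by
  ext n
  rw [coeff_rescale, coeff_C]
  split_ifs with h
  · subst h; ring
  · ring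

theorem rescale_numer (q y c : A) (n : ℕ) :
    rescale c (numer q y n) =
      (∏ i ∈ range n, (1 + C (q ^ i * c) * X)) * ∏ i ∈ range n, C (1 + q ^ (i + 1) * y) := by
  rw [numer, map_mul, map_prod, map_prod]
  congr 1
  · exact prod_congr rfl fun i _ => by rw [map_add, map_one, rescale_linear]
  · exact prod_congr rfl fun i _ => rescale_C' _ _

theorem constantCoeff_denom (q y : A) (n : ℕ) : constantCoeff (denom q y n) = 1 := by
  simp [denom, map_prod]

theorem denom_ne_zero [Nontrivial A] (q y : A) (n : ℕ) : denom q y n ≠ 0 := fun h => by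
  have := constantCoeff_denom q y n
  rw [h, map_zero] at this
  exact zero_ne_one this

/-- A closed form for the iterates on geometric sequences. In the induction the two rescalings of
`X_mul_mk_peakOp` are each one factor short of the new denominator. With Q = q^(n+1), what remains
is (1 - QyX)(1 + QX) - (1 + X)(1 - Q²yX) = X(Q - 1)(1 + Qy), which supplies the new numerator factor
and the new q-integer. -/
theorem denom_mul_iterate_peakOp [IsDomain A] (q : A) (hq : q ≠ 1) (y : A) (n : ℕ) :
    denom q y n * mk ((peakOp q)^[n] (fun b => y ^ b)) = C (qFact q n) * numer q y n := by
  induction n with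
  | zero =>
    have : mk (fun b => y ^ b) * (1 - C y * X) = 1 := by
      ext n
      rw [mul_sub, mul_one, mul_left_comm, map_sub, coeff_C_mul, coeff_mk]
      rcases n with _ | n
      · simp
      · simp [coeff_succ_mul_X, coeff_one, pow_succ']
    simpa [denom, numer, qFact, mul_comm] using this
  | succ n ih =>
    rw [Function.iterate_succ_apply']
    set G := (peakOp q)^[n] (fun b => y ^ b) with hG
    -- `X_mul_mk_peakOp` gives the next series only up to the factor X(q - 1), which has to be
    -- cancelled.
    have hX : (X * C (q - 1) : A⟦X⟧) ≠ 0 := by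
      refine mul_ne_zero X_ne_zero ?_
      rw [Ne, ← map_zero (C (R := A)), C_injective.eq_iff]
      exact sub_ne_zero.2 hq
    apply mul_left_cancel₀ hX
    have e := X_mul_mk_peakOp q G
    have i1 := congrArg (rescale q) ih
    have i2 := congrArg (rescale (q ^ 2)) ih
    rw [map_mul, map_mul, rescale_C', rescale_numer] at i1 i2
    have d1 := denom_succ_left q y n
    have d2 := denom_succ_right q y n
    have p1 : ∏ i ∈ range n, (1 + C (q ^ i * q) * X : A⟦X⟧) = ∏ i ∈ range n, (1 + C (q ^ (i + 1)) * X) := by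
      simp only [pow_succ]
    have p2 : (1 + C q * X) * ∏ i ∈ range n, (1 + C (q ^ i * q ^ 2) * X : A⟦X⟧) =
        (∏ i ∈ range n, (1 + C (q ^ (i + 1)) * X)) * (1 + C (q ^ (n + 1)) * X) := by
      rw [← prod_range_succ, prod_range_succ', mul_comm]
      congr 1
      · refine prod_congr rfl fun i _ => ?_
        congr 3; ring
      · simp
    have p3 : ∏ i ∈ range (n + 1), (1 + C (q ^ i) * X : A⟦X⟧) =
        (1 + X) * ∏ i ∈ range n, (1 + C (q ^ (i + 1)) * X) := by
      rw [prod_range_succ', mul_comm]; simp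
    have p4 : ∏ i ∈ range (n + 1), (C (1 + q ^ (i + 1) * y) : A⟦X⟧) =
        (∏ i ∈ range n, C (1 + q ^ (i + 1) * y)) * C (1 + q ^ (n + 1) * y) := prod_range_succ _ _
    rw [p1] at i1
    rw [qFact_succ, numer, p3, p4]
    have hint : (C (q - 1) * C (qInt q (n + 1)) : A⟦X⟧) = C (q ^ (n + 1)) - 1 := by
      rw [← map_mul, sub_one_mul_qInt, map_sub, map_one]
    set S := ∏ i ∈ range n, (1 + C (q ^ (i + 1)) * X : A⟦X⟧)
    set S2 := ∏ i ∈ range n, (1 + C (q ^ i * q ^ 2) * X : A⟦X⟧)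
    set Y := ∏ i ∈ range n, (C (1 + q ^ (i + 1) * y) : A⟦X⟧)
    set u : A⟦X⟧ := C (qFact q n)
    calc X * C (q - 1) * (denom q y (n + 1) * mk (peakOp q G))
        = denom q y (n + 1) * (X * C (q - 1) * mk (peakOp q G)) := by ring
      _ = (1 + X) * ((1 + C q * X) * (denom q y (n + 1) * rescale (q ^ 2) (mk G))
            - (1 + X) * (denom q y (n + 1) * rescale q (mk G))) := by rw [e]; ring
      _ = (1 + X) * ((1 + C q * X) * ((1 - C (q ^ (n + 1) * y) * X) * (u * (S2 * Y)))
            - (1 + X) * ((1 - C (q ^ (2 * n + 2) * y) * X) * (u * (S * Y)))) := by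
          congr 2
          · rw [d1, mul_assoc (1 - _), i2]
          · rw [d2, mul_comm (rescale q _), mul_assoc (1 - _), i1]
      _ = (1 + X) * u * Y * ((1 - C (q ^ (n + 1) * y) * X) * ((1 + C q * X) * S2)
            - (1 + X) * (1 - C (q ^ (2 * n + 2) * y) * X) * S) := by ring
      _ = X * C (q - 1) * (C (qInt q (n + 1) * qFact q n) *
            ((1 + X) * S * (Y * C (1 + q ^ (n + 1) * y)))) := by
          rw [p2]
          have hu : (C (qInt q (n + 1) * qFact q n) : A⟦X⟧) = C (qInt q (n + 1)) * u := map_mul _ _ _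
          have e1 : (C (q ^ (n + 1) * y) : A⟦X⟧) = C (q ^ (n + 1)) * C y := map_mul _ _ _
          have e2 : (C (q ^ (2 * n + 2) * y) : A⟦X⟧) = C (q ^ (n + 1)) ^ 2 * C y := by
            rw [← map_pow, ← map_mul]; congr 1; ring
          have e3 : (C (1 + q ^ (n + 1) * y) : A⟦X⟧) = 1 + C (q ^ (n + 1)) * C y := by
            rw [map_add, map_mul, map_one]
          rw [hu, e1, e2, e3]
          linear_combination (-(X * u * S * Y * (1 + X) * (1 + C (q ^ (n + 1)) * C y))) * hint

theorem mk_chordOp (q : A) (n : ℕ) (L : (ℕ → A) → ℕ → A) (f : ℕ → A) :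
    mk (chordOp q n L f) = (1 + X) * mk (chordCore q n L f) := by
  ext a
  rw [add_mul, one_mul, map_add, coeff_mk, coeff_mk]
  rcases a with _ | a
  · simp [chordOp]
  · simp [chordOp, coeff_succ_X_mul]

theorem iterate_peakOp_smul (q c : A) (n : ℕ) (f : ℕ → A) :
    (peakOp q)^[n] (fun b => c * f b) = fun a => c * (peakOp q)^[n] f a := by
  induction n generalizing f with
  | zero => rfl
  | succ n ih =>
    rw [Function.iterate_succ_apply, Function.iterate_succ_apply, ← ih]
    congr 1
    funext a
    simp only [peakOp]; ring

/-- On y^b the inner function is (1 + qy)(qy)^l times the geometric sequence of ratio qy. By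
linearity the sum over l is a convolution with the powers of q^(n+1)y. -/
theorem mk_chordCore_geom (q y : A) (n : ℕ) :
    (1 - C (q ^ (n + 1) * y) * X) * mk (chordCore q n ((peakOp q)^[n]) (fun b => y ^ b)) =
      C (1 + q * y) * rescale q (mk ((peakOp q)^[n] (fun b => (q * y) ^ b))) := by
  set G := (peakOp q)^[n] (fun b => (q * y) ^ b) with hG
  have core : ∀ a, chordCore q n ((peakOp q)^[n]) (fun b => y ^ b) a =
      ∑ l ∈ range (a + 1), (q ^ (n + 1) * y) ^ l * ((1 + q * y) * (q ^ (a - l) * G (a - l))) := by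
    intro a
    refine sum_congr rfl fun l _ => ?_
    have : (fun b => q ^ (b + l) * y ^ (b + l) + q ^ (b + l + 1) * y ^ (b + l + 1)) =
        fun b => ((1 + q * y) * (q * y) ^ l) * (q * y) ^ b := by
      funext b; ring
    rw [this, iterate_peakOp_smul]
    ring
  ext a
  rw [sub_mul, one_mul, map_sub, mul_assoc, coeff_C_mul, coeff_C_mul, coeff_rescale, coeff_mk,
    coeff_mk]
  rcases a with _ | a
  · simp [core]
  · rw [coeff_succ_X_mul, coeff_mk, core, core, sum_range_succ', mul_sum]
    have : ∑ k ∈ range (a + 1), (q ^ (n + 1) * y) ^ (k + 1) *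
        ((1 + q * y) * (q ^ (a + 1 - (k + 1)) * G (a + 1 - (k + 1)))) =
        ∑ i ∈ range (a + 1), q ^ (n + 1) * y *
          ((q ^ (n + 1) * y) ^ i * ((1 + q * y) * (q ^ (a - i) * G (a - i)))) := by
      refine sum_congr rfl fun i _ => ?_
      rw [Nat.add_sub_add_right]; ring
    rw [this]
    simp

/-- The denominators match: the convolution over l supplies the first factor of `denom q y (n + 1)`,
and the rescaled denominator of ratio qy supplies the others. -/
theorem chordOp_iterate_peakOp_geom [IsDomain A] (q : A) (hq : q ≠ 1) (y : A) (n a : ℕ) :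
    qInt q (n + 1) * chordOp q n ((peakOp q)^[n]) (fun b => y ^ b) a =
      (peakOp q)^[n + 1] (fun b => y ^ b) a := by
  have h1 := denom_mul_iterate_peakOp q hq y (n + 1)
  have h2 := congrArg (rescale q) (denom_mul_iterate_peakOp q hq (q * y) n)
  have h3 := mk_chordCore_geom q y n
  have h4 := mk_chordOp q n ((peakOp q)^[n]) (fun b => y ^ b)
  rw [map_mul, map_mul, rescale_C', rescale_numer] at h2
  have d : denom q y (n + 1) = (1 - C (q ^ (n + 1) * y) * X) * rescale q (denom q (q * y) n) := by
    rw [denom_succ_left, rescale_denom, rescale_denom]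
    congr 1
    refine prod_congr rfl fun i _ => ?_
    congr 3; ring
  have p3 : ∏ i ∈ range (n + 1), (1 + C (q ^ i) * X : A⟦X⟧) =
      (1 + X) * ∏ i ∈ range n, (1 + C (q ^ i * q) * X) := by
    rw [prod_range_succ', mul_comm]; simp [pow_succ]
  have p4 : ∏ i ∈ range (n + 1), (C (1 + q ^ (i + 1) * y) : A⟦X⟧) =
      C (1 + q * y) * ∏ i ∈ range n, C (1 + q ^ (i + 1) * (q * y)) := by
    rw [prod_range_succ', mul_comm]
    congr 1
    · simp
    · refine prod_congr rfl fun i _ => ?_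
      congr 2; ring
  have main : C (qInt q (n + 1)) * mk (chordOp q n ((peakOp q)^[n]) (fun b => y ^ b)) =
      mk ((peakOp q)^[n + 1] (fun b => y ^ b)) := by
    apply mul_left_cancel₀ (denom_ne_zero q y (n + 1))
    rw [h1, qFact_succ, map_mul, numer, p3, p4, h4, d]
    linear_combination (C (qInt q (n + 1)) * rescale q (denom q (q * y) n) * (1 + X)) * h3
      + (C (qInt q (n + 1)) * (1 + X) * C (1 + q * y)) * h2
  have := congrArg (coeff a) main
  simpa using this

theorem map_qInt {B : Type*} [CommRing B] (φ : A →+* B) (q : A) (n : ℕ) :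
    φ (qInt q n) = qInt (φ q) n := by simp [qInt]

/-- An `A`-linear functional on polynomials commutes with `peakOp`. -/
theorem map_iterate_peakOp (φ : Polynomial A →ₗ[A] A) (q : A) (n : ℕ)
    (f : ℕ → Polynomial A) (a : ℕ) :
    φ ((peakOp (Polynomial.C q))^[n] f a) = (peakOp q)^[n] (fun b => φ (f b)) a := by
  have hC : ∀ c p, φ (Polynomial.C c * p) = c * φ p := fun c p => by
    rw [← Polynomial.smul_eq_C_mul, map_smul, smul_eq_mul]
  induction n generalizing f with
  | zero => rfl
  | succ n ih =>
    rw [Function.iterate_succ_apply, Function.iterate_succ_apply, ih]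
    refine congrFun (congrArg _ (funext fun b => ?_)) a
    simp only [peakOp, ← map_qInt, ← map_pow, ← map_mul, ← map_add, map_add φ, hC]

/-- Geometric sequences suffice: take the ratio to be the variable of the polynomial ring over `A`,
and apply the linear functional that sends its b-th power to `f b`. Both operators commute with this
functional. -/
theorem chordOp_iterate_peakOp [IsDomain A] (q : A) (hq : q ≠ 1) (n : ℕ) (f : ℕ → A) (a : ℕ) :
    qInt q (n + 1) * chordOp q n ((peakOp q)^[n]) f a = (peakOp q)^[n + 1] f a := by
  let φ : Polynomial A →ₗ[A] A := (Polynomial.basisMonomials A).constr A f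
  have hφ : ∀ b, φ (Polynomial.X ^ b) = f b := fun b => by
    have := (Polynomial.basisMonomials A).constr_basis A f b
    rw [Polynomial.coe_basisMonomials] at this
    rw [← Polynomial.monomial_one_right_eq_X_pow]
    exact this
  have hC : ∀ c p, φ (Polynomial.C c * p) = c * φ p := fun c p => by
    rw [← Polynomial.smul_eq_C_mul, map_smul, smul_eq_mul]
  have hq' : Polynomial.C q ≠ 1 := fun h => hq (Polynomial.C_injective (by simpa using h))
  have h := congrArg φ (chordOp_iterate_peakOp_geom (Polynomial.C q) hq' Polynomial.X n a)
  rw [map_iterate_peakOp, ← map_qInt, hC] at h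
  have core : ∀ a, φ (chordCore (Polynomial.C q) n ((peakOp (Polynomial.C q))^[n])
      (fun b => Polynomial.X ^ b) a) = chordCore q n ((peakOp q)^[n]) f a := by
    intro a
    simp only [chordCore, map_sum, ← map_pow, hC, map_iterate_peakOp, map_add, hφ]
  have : φ (chordOp (Polynomial.C q) n ((peakOp (Polynomial.C q))^[n])
      (fun b => Polynomial.X ^ b) a) = chordOp q n ((peakOp q)^[n]) f a := by
    unfold chordOp
    rw [map_add, core]
    split_ifs
    · rw [map_zero]
    · rw [core]
  rw [this] at h
  simpa only [hφ] using h

/-! ### The operator of a pair of unmatched up steps. -/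

/-- The contribution of `U U w` when `w` has a tree with `n` edges and contributes `f`; the second
`U` carries an even number of tiles. -/
def doubleUpOp (q : A) (n : ℕ) (f : ℕ → A) (a : ℕ) : A :=
  let core := fun a₁ => ∑ l ∈ (range (a₁ + 1)).filter Even, q ^ (a₁ - l + l * n) * f (a₁ - l)
  let mid := fun a₀ => q ^ a₀ * (core a₀ + if a₀ = 0 then 0 else core (a₀ - 1))
  mid a + if a = 0 then 0 else mid (a - 1)

theorem mk_add_shift (g : ℕ → A) :
    mk (fun a => g a + if a = 0 then 0 else g (a - 1)) = (1 + X) * mk g := by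
  ext a
  rw [add_mul, one_mul, map_add, coeff_mk, coeff_mk]
  rcases a with _ | a <;> simp [coeff_succ_X_mul]

/-- The sum over even l is a convolution with 1/(1 - q^(2n)X²). Each of the two up steps multiplies
the series by 1 + X, and the weight `q ^ a₀` of the first rescales everything inside by q. -/
theorem mk_doubleUpOp (q : A) (n : ℕ) (f : ℕ → A) :
    (1 - C (q ^ (2 * n + 2)) * X ^ 2) * mk (doubleUpOp q n f) =
      (1 + X) * (1 + C q * X) * rescale (q ^ 2) (mk f) := by
  set core := fun a₁ => ∑ l ∈ (range (a₁ + 1)).filter Even, q ^ (a₁ - l + l * n) * f (a₁ - l)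
    with hcore
  have h1 : mk (doubleUpOp q n f) = (1 + X) * rescale q ((1 + X) * mk core) := by
    rw [← mk_add_shift]
    have : rescale q (mk fun a => core a + if a = 0 then 0 else core (a - 1)) =
        mk (fun a => q ^ a * (core a + if a = 0 then 0 else core (a - 1))) := by
      ext a; simp [coeff_rescale]
    rw [this, ← mk_add_shift]
    rfl
  have h2 : (1 - C (q ^ (2 * n)) * X ^ 2) * mk core = rescale q (mk f) := by
    ext a
    rw [sub_mul, one_mul, map_sub, mul_assoc, coeff_C_mul, coeff_mk, coeff_rescale, coeff_mk]
    rcases a with _ | _ | a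
    · simp [hcore, filter_singleton, pow_two, mul_assoc]
    · have : (range 2).filter Even = {0} := by decide
      simp [hcore, this, pow_two, mul_assoc, coeff_succ_X_mul]
    · rw [pow_two, mul_assoc, coeff_succ_X_mul, coeff_succ_X_mul, coeff_mk]
      simp only [hcore]
      simp only [sum_filter]
      rw [sum_range_succ', sum_range_succ', mul_sum]
      have : ∀ i, (if Even (i + 1 + 1) then q ^ (a + 1 + 1 - (i + 1 + 1) + (i + 1 + 1) * n) *
          f (a + 1 + 1 - (i + 1 + 1)) else 0) = q ^ (2 * n) *
          (if Even i then q ^ (a - i + i * n) * f (a - i) else 0) := by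
        intro i
        have : Even (i + 1 + 1) ↔ Even i := by simp [Nat.even_add_one]
        simp only [this]
        split_ifs
        · rw [Nat.add_sub_add_right, Nat.add_sub_add_right]; ring
        · ring
      simp only [this]
      simp
  have h3 := congrArg (rescale q) h2
  rw [map_mul, map_sub, map_mul, rescale_C', map_pow (rescale q) X, rescale_X, map_one,
    rescale_rescale, ← pow_two] at h3
  have e : (C (q ^ (2 * n + 2)) : A⟦X⟧) = C (q ^ (2 * n)) * C q ^ 2 := by
    rw [← map_pow, ← map_mul]; congr 1; ring
  rw [h1, map_mul, map_add, map_one, rescale_X, e]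
  linear_combination (1 + X) * (1 + C q * X) * h3

/-- The denominator 1 - q^(2n+2)X² splits: 1 - q^(n+1)X completes `denom`, and 1 + q^(n+1)X cancels
against the surplus factor of the numerator. The constant sequence is enough, because a dotted edge
has nothing to its right. The q-integer enters as [2(n+1)] = [n+1](1 + q^(n+1)). -/
theorem doubleUpOp_iterate_peakOp [IsDomain A] (q : A) (hq : q ≠ 1) (n a : ℕ) :
    qInt q (2 * (n + 1)) * doubleUpOp q n ((peakOp q)^[n] (fun _ => 1)) a =
      (peakOp q)^[n + 1] (fun _ => 1) a := by
  have h1 := denom_mul_iterate_peakOp q hq 1 (n + 1)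
  have h2 := congrArg (rescale (q ^ 2)) (denom_mul_iterate_peakOp q hq 1 n)
  simp only [one_pow] at h1 h2
  have h3 := mk_doubleUpOp q n ((peakOp q)^[n] (fun _ => 1))
  rw [map_mul, map_mul, rescale_C', rescale_numer] at h2
  have d := denom_succ_left q 1 n
  have p1 : (1 + X) * (1 + C q * X) * ∏ i ∈ range n, (1 + C (q ^ i * q ^ 2) * X : A⟦X⟧) =
      (∏ i ∈ range (n + 1), (1 + C (q ^ i) * X)) * (1 + C (q ^ (n + 1)) * X) := by
    rw [← prod_range_succ, prod_range_succ', prod_range_succ']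
    have : ∏ i ∈ range n, (1 + C (q ^ i * q ^ 2) * X : A⟦X⟧) =
      ∏ i ∈ range n, (1 + C (q ^ (i + 1 + 1)) * X : A⟦X⟧) := by
        refine prod_congr rfl fun i _ => ?_
        congr 3; ring
    rw [this]
    simp; ring
  have p2 : ∏ i ∈ range (n + 1), (C (1 + q ^ (i + 1) * 1) : A⟦X⟧) =
      (∏ i ∈ range n, C (1 + q ^ (i + 1) * 1)) * (1 + C (q ^ (n + 1))) := by
    rw [prod_range_succ]; simp
  have e : (C (q ^ (2 * n + 2)) : A⟦X⟧) = C (q ^ (n + 1)) ^ 2 := by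
    rw [← map_pow]; congr 1; ring
  have hint : (C (qInt q (2 * (n + 1))) : A⟦X⟧) =
      C (qInt q (n + 1)) * (1 + C (q ^ (n + 1))) := by
    rw [← map_one C, ← map_add, ← map_mul]
    congr 1
    apply mul_left_cancel₀ (sub_ne_zero.2 hq)
    rw [← mul_assoc, sub_one_mul_qInt, sub_one_mul_qInt]
    ring
  have hne : (denom q 1 (n + 1) * (1 + C (q ^ (n + 1)) * X) : A⟦X⟧) ≠ 0 := by
    refine mul_ne_zero (denom_ne_zero _ _ _) fun h => ?_
    have := congrArg constantCoeff h
    simp at this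
  have main : C (qInt q (2 * (n + 1))) * mk (doubleUpOp q n ((peakOp q)^[n] (fun _ => 1))) =
      mk ((peakOp q)^[n + 1] (fun _ => 1)) := by
    apply mul_left_cancel₀ hne
    rw [e] at h3
    rw [mul_right_comm (denom q 1 (n + 1)) (1 + _) (mk ((peakOp q)^[n + 1] _)), h1, qFact_succ,
      map_mul, numer, p2, d, hint]
    rw [mul_one]
    linear_combination (C (qInt q (n + 1)) * (1 + C (q ^ (n + 1))) *
        rescale (q ^ 2) (denom q 1 n)) * h3
      + (C (qInt q (n + 1)) * (1 + C (q ^ (n + 1))) * (1 + X) * (1 + C q * X)) * h2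
      + (C (qInt q (n + 1)) * (1 + C (q ^ (n + 1))) * C (qFact q n) *
        ∏ i ∈ range n, C (1 + q ^ (i + 1) * 1)) * p1
  have := congrArg (coeff a) main
  simpa using this

/-- At X = 0 and y = 1 the closed form is [n]! times the product of the 1 + q^(i+1), and [k](1 +
q^k) = [2k]. -/
theorem iterate_peakOp_one_zero [IsDomain A] (q : A) (hq : q ≠ 1) (n : ℕ) :
    (peakOp q)^[n] (fun _ => 1) 0 = ∏ i ∈ range n, qInt q (2 * (i + 1)) := by
  have h := congrArg constantCoeff (denom_mul_iterate_peakOp q hq 1 n)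
  simp only [one_pow, map_mul, constantCoeff_denom, one_mul, constantCoeff_C, numer, map_prod,
    map_add, map_one, constantCoeff_X, mul_zero, add_zero, prod_const_one, mul_one] at h
  rw [← coeff_zero_eq_constantCoeff_apply, coeff_mk] at h
  rw [h, qFact, ← prod_mul_distrib]
  refine prod_congr rfl fun i _ => ?_
  apply mul_left_cancel₀ (sub_ne_zero.2 hq)
  rw [← mul_assoc, sub_one_mul_qInt, sub_one_mul_qInt]
  ring

end QOperators

end BallotTiling

namespace BallotTiling

/-! ### Dotted trees, and the arrangements attached to them -/

namespace PlaneTree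

/-- Glue two trees at their roots. -/
def glue {α : Type} : PlaneTree α → PlaneTree α → PlaneTree α
  | nil, S => S
  | cons a below right, S => cons a below (right.glue S)

theorem numEdges_glue {α : Type} (T S : PlaneTree α) :
    (T.glue S).numEdges = T.numEdges + S.numEdges := by
  induction T with
  | nil => simp [glue, numEdges]
  | cons a below right _ ih => simp only [glue, numEdges, ih]; omega

end PlaneTree

/-- No edge carries a dot. -/
def IsUndotted : PlaneTree EdgeMark → Prop
  | .nil => True
  | .cons a below right => a.dot = false ∧ IsUndotted below ∧ IsUndotted right

/-- The dotted edges lie on the rightmost path from the root, and have nothing to their right. -/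
def IsSpined : PlaneTree EdgeMark → Prop
  | .nil => True
  | .cons a below right =>
      (a.dot = true ∧ right = .nil ∧ IsSpined below) ∨
      (a.dot = false ∧ IsUndotted below ∧ IsSpined right)

theorem IsUndotted.isSpined {T : PlaneTree EdgeMark} (h : IsUndotted T) : IsSpined T := by
  induction T with
  | nil => trivial
  | cons a below right _ ih => exact Or.inr ⟨h.1, h.2.1, ih h.2.2⟩

theorem IsUndotted.glue {T S : PlaneTree EdgeMark} (hT : IsUndotted T) (hS : IsSpined S) :
    IsSpined (T.glue S) := by
  induction T with
  | nil => exact hS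
  | cons a below right _ ih => exact Or.inr ⟨hT.1, hT.2.1, ih hT.2.2⟩

section Hook

variable {A : Type*} [CommRing A]

/-- The product of the hook lengths; dotted edges count with twice their hook length. -/
def hookProd (q : A) : PlaneTree EdgeMark → A
  | .nil => 1
  | .cons a below right =>
      qInt q (if a.dot then 2 * (below.numEdges + 1) else below.numEdges + 1) *
        (hookProd q below * hookProd q right)

theorem hookProd_glue (q : A) (T S : PlaneTree EdgeMark) :
    hookProd q (T.glue S) = hookProd q T * hookProd q S := by
  induction T with
  | nil => simp [PlaneTree.glue, hookProd]
  | cons a below right _ ih => simp only [PlaneTree.glue, hookProd, ih]; ring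

end Hook

/-- The smallest number of inversions of an arrangement compatible with a tree. -/
def minInv : PlaneTree EdgeMark → ℕ
  | .nil => 0
  | .cons a below right =>
      (if a.dot then 2 * below.numEdges + 1 else below.numEdges) + minInv below + minInv right

theorem minInv_glue (T S : PlaneTree EdgeMark) : minInv (T.glue S) = minInv T + minInv S := by
  induction T with
  | nil => simp [PlaneTree.glue, minInv]
  | cons a below right _ ih => simp only [PlaneTree.glue, minInv, ih]; ring

/-- The numbers of `xs`, put on the edges of the tree in pre-order, satisfy `x < y` if the edge of
`x` is above that of `y`, and moreover `x < 0` and `x < -y` if the edge of `x` is dotted. -/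
def Compatible : PlaneTree EdgeMark → List ℤ → Prop
  | .nil, xs => xs = []
  | .cons a below right, xs => ∃ x fs rs, xs = x :: (fs ++ rs) ∧ Compatible below fs ∧
      Compatible right rs ∧ (∀ f ∈ fs, x < f) ∧ (a.dot = true → x < 0 ∧ ∀ f ∈ fs, x < -f)

theorem Compatible.length {T : PlaneTree EdgeMark} {xs : List ℤ} (h : Compatible T xs) :
    xs.length = T.numEdges := by
  induction T generalizing xs with
  | nil => rw [h]; rfl
  | cons a below right ih1 ih2 =>
    obtain ⟨x, fs, rs, rfl, h1, h2, -⟩ := h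
    simp only [List.length_cons, List.length_append, ih1 h1, ih2 h2, PlaneTree.numEdges]; omega

theorem compatible_glue {T S : PlaneTree EdgeMark} {xs : List ℤ} :
    Compatible (T.glue S) xs ↔ ∃ fs rs, xs = fs ++ rs ∧ Compatible T fs ∧ Compatible S rs := by
  induction T generalizing xs with
  | nil =>
    constructor
    · intro h; exact ⟨[], xs, rfl, rfl, h⟩
    · rintro ⟨fs, rs, rfl, h1, h2⟩
      rw [show fs = [] from h1]; exact h2
  | cons a below right _ ih =>
    constructor
    · rintro ⟨x, fs, rs, rfl, h1, h2, h3⟩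
      obtain ⟨us, vs, rfl, h4, h5⟩ := ih.1 h2
      exact ⟨x :: (fs ++ us), vs, by simp, ⟨x, fs, us, rfl, h1, h4, h3⟩, h5⟩
    · rintro ⟨_, vs, rfl, ⟨x, fs, us, rfl, h1, h4, h3⟩, h5⟩
      exact ⟨x, fs, us ++ vs, by simp, h1, ih.2 ⟨us, vs, rfl, h4, h5⟩, h3⟩

theorem Compatible.map {T : PlaneTree EdgeMark} (hT : IsUndotted T) {f : ℤ → ℤ} {xs : List ℤ}
    (h : Compatible T xs) (hf : StrictMonoOn f {x | x ∈ xs}) : Compatible T (xs.map f) := by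
  induction T generalizing xs with
  | nil => rw [show xs = [] from h]; rfl
  | cons a below right ih1 ih2 =>
    obtain ⟨x, fs, rs, rfl, h1, h2, h3, -⟩ := h
    refine ⟨f x, fs.map f, rs.map f, by simp, ih1 hT.2.1 h1 (hf.mono ?_),
      ih2 hT.2.2 h2 (hf.mono ?_), ?_, by simp [hT.1]⟩
    · intro y hy; simp only [Set.mem_ofPred_eq] at hy ⊢; simp [hy]
    · intro y hy; simp only [Set.mem_ofPred_eq] at hy ⊢; simp [hy]
    · intro z hz
      obtain ⟨y, hy, rfl⟩ := List.mem_map.1 hz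
      exact hf (by simp) (by simp [hy]) (h3 y hy)

/-! ### Inversions of an arrangement -/

/-- The number of pairs `i < j` with `x_i < x_j`. -/
def ascents : List ℤ → ℕ
  | [] => 0
  | x :: xs => xs.countP (fun y => x < y) + ascents xs

/-- The number of pairs `i ≤ j` with `x_i + x_j < 0`. -/
def negSums : List ℤ → ℕ
  | [] => 0
  | x :: xs => xs.countP (fun y => x + y < 0) + (if x < 0 then 1 else 0) + negSums xs

/-- The number of inversions. -/
def arrInv (xs : List ℤ) : ℕ := ascents xs + negSums xs

/-- The condition x_i + x_j < 0 is symmetric, so only the multiset of entries matters. This allows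
entries to be rearranged while only ascents are tracked. -/
theorem negSums_perm {xs ys : List ℤ} (h : xs.Perm ys) : negSums xs = negSums ys := by
  induction h with
  | nil => rfl
  | cons x h ih => rw [negSums, negSums, ih, h.countP_eq]
  | swap x y l =>
    simp only [negSums, List.countP_cons, add_comm y x]; omega
  | trans _ _ ih1 ih2 => rw [ih1, ih2]

theorem ascents_append (xs ys : List ℤ) : ascents (xs ++ ys) =
    ascents xs + ascents ys + (xs.map fun x => ys.countP (fun y => x < y)).sum := by
  induction xs with
  | nil => simp [ascents]
  | cons x xs ih => simp only [List.cons_append, ascents, ih, List.countP_append, List.map_cons,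
      List.sum_cons]; omega

theorem ascents_map {f : ℤ → ℤ} {xs : List ℤ} (hf : StrictMonoOn f {x | x ∈ xs}) :
    ascents (xs.map f) = ascents xs := by
  induction xs with
  | nil => rfl
  | cons x xs ih =>
    rw [List.map_cons, ascents, ascents, ih (hf.mono fun y hy => List.mem_cons_of_mem _ hy),
      List.countP_map]
    congr 1
    refine List.countP_congr fun y hy => ?_
    simp only [Function.comp, decide_eq_true_eq]
    exact hf.lt_iff_lt (by simp) (by simp [hy])

/-! ### Order-preserving transport between finite sets of integers -/

open Classical in
/-- The order-preserving bijection between two finite sets of the same size. -/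
noncomputable def transport (S S' : Finset ℤ) (y : ℤ) : ℤ :=
  if h : S.card = S'.card ∧ y ∈ S then
    (S'.orderIsoOfFin rfl (Fin.cast h.1 ((S.orderIsoOfFin rfl).symm ⟨y, h.2⟩)) : ℤ)
  else y

theorem transport_eq {S S' : Finset ℤ} (h : S.card = S'.card) {y : ℤ} (hy : y ∈ S) :
    transport S S' y =
      S'.orderIsoOfFin rfl (Fin.cast h ((S.orderIsoOfFin rfl).symm ⟨y, hy⟩)) :=
  dif_pos ⟨h, hy⟩

theorem transport_mem {S S' : Finset ℤ} (h : S.card = S'.card) {y : ℤ} (hy : y ∈ S) :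
    transport S S' y ∈ S' := by
  rw [transport_eq h hy]; exact Subtype.coe_prop _

theorem transport_transport {S S' S'' : Finset ℤ} (h : S.card = S'.card) (h' : S'.card = S''.card)
    {y : ℤ} (hy : y ∈ S) : transport S' S'' (transport S S' y) = transport S S'' y := by
  have hm := transport_mem h hy
  rw [transport_eq h' hm, transport_eq (h.trans h') hy]
  congr 2
  have : (⟨transport S S' y, hm⟩ : S') =
      S'.orderIsoOfFin rfl (Fin.cast h ((S.orderIsoOfFin rfl).symm ⟨y, hy⟩)) := by
    apply Subtype.ext
    exact transport_eq h hy
  rw [this]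
  simp

theorem transport_self {S : Finset ℤ} {y : ℤ} (hy : y ∈ S) : transport S S y = y := by
  rw [transport_eq rfl hy]; simp

theorem strictMonoOn_transport {S S' : Finset ℤ} (h : S.card = S'.card) :
    StrictMonoOn (transport S S') S := by
  intro x hx y hy hxy
  rw [transport_eq h hx, transport_eq h hy, Subtype.coe_lt_coe,
    OrderIso.lt_iff_lt]
  change (S.orderIsoOfFin rfl).symm ⟨x, hx⟩ < (S.orderIsoOfFin rfl).symm ⟨y, hy⟩
  rw [OrderIso.lt_iff_lt]
  exact hxy

/-- Replace the first entry of `x :: fs` by `v`, keeping the set of entries and the relative order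
of the others. -/
noncomputable def shiftTail (v x : ℤ) (fs : List ℤ) : List ℤ :=
  fs.map (transport ((x :: fs).toFinset.erase x) ((x :: fs).toFinset.erase v))

section ShiftTail

variable {v x : ℤ} {fs : List ℤ}

theorem mem_erase_of_mem (hx : (x :: fs).Nodup) {y : ℤ} (hy : y ∈ fs) :
    y ∈ (x :: fs).toFinset.erase x := by
  have : x ∉ fs := (List.nodup_cons.1 hx).1
  simp only [Finset.mem_erase, List.mem_toFinset, List.mem_cons]
  exact ⟨fun h => this (h ▸ hy), Or.inr hy⟩

theorem card_erase_eq (hv : v ∈ x :: fs) :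
    ((x :: fs).toFinset.erase x).card = ((x :: fs).toFinset.erase v).card := by
  rw [Finset.card_erase_of_mem (by simp), Finset.card_erase_of_mem (by simpa using hv)]

theorem strictMonoOn_shift (hx : (x :: fs).Nodup) (hv : v ∈ x :: fs) :
    StrictMonoOn (transport ((x :: fs).toFinset.erase x) ((x :: fs).toFinset.erase v))
      {y | y ∈ fs} :=
  (strictMonoOn_transport (card_erase_eq hv)).mono fun _ hy => mem_erase_of_mem hx hy

theorem shiftTail_length : (shiftTail v x fs).length = fs.length := List.length_map _

theorem shiftTail_nodup (hx : (x :: fs).Nodup) (hv : v ∈ x :: fs) :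
    (v :: shiftTail v x fs).Nodup := by
  rw [List.nodup_cons]
  constructor
  · intro h
    obtain ⟨y, hy, e⟩ := List.mem_map.1 h
    have := transport_mem (card_erase_eq hv) (mem_erase_of_mem hx hy)
    rw [e] at this
    simp at this
  · exact (List.nodup_map_iff_inj_on (List.nodup_cons.1 hx).2).2 fun y hy z hz h =>
      (strictMonoOn_shift hx hv).injOn hy hz h

theorem shiftTail_perm (hx : (x :: fs).Nodup) (hv : v ∈ x :: fs) :
    (v :: shiftTail v x fs).Perm (x :: fs) := by
  refine (List.subperm_of_subset (shiftTail_nodup hx hv) ?_).perm_of_length_le ?_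
  · intro y hy
    rcases List.mem_cons.1 hy with rfl | hy
    · exact hv
    · obtain ⟨z, hz, rfl⟩ := List.mem_map.1 hy
      have := transport_mem (card_erase_eq hv) (mem_erase_of_mem hx hz)
      simpa using (Finset.mem_erase.1 this).2
  · simp [shiftTail_length]

theorem shiftTail_self (hx : (x :: fs).Nodup) : shiftTail x x fs = fs := by
  rw [shiftTail]
  conv_rhs => rw [← List.map_id fs]
  exact List.map_congr_left fun y hy => transport_self (mem_erase_of_mem hx hy)

theorem shiftTail_shiftTail (hx : (x :: fs).Nodup) (hv : v ∈ x :: fs) {u : ℤ}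
    (hu : u ∈ x :: fs) : shiftTail u v (shiftTail v x fs) = shiftTail u x fs := by
  have hs : (v :: shiftTail v x fs).toFinset = (x :: fs).toFinset := by
    ext y; simp only [List.mem_toFinset]; exact (shiftTail_perm hx hv).mem_iff
  rw [shiftTail, hs, shiftTail, List.map_map, shiftTail]
  refine List.map_congr_left fun y hy => ?_
  exact transport_transport (card_erase_eq hv) ((card_erase_eq hv).symm.trans (card_erase_eq hu))
    (mem_erase_of_mem hx hy)

/-- `negSums` and the ascents into `rs` see only the set of the leading entries, and the relative
order of the tail is kept. The only change is in the ascents that start at the first entry. -/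
theorem arrInv_shiftTail (hx : (x :: fs).Nodup) (hv : v ∈ x :: fs) (rs : List ℤ) :
    arrInv (v :: (shiftTail v x fs ++ rs)) + (x :: fs).countP (fun y => x < y) =
      arrInv (x :: (fs ++ rs)) + (x :: fs).countP (fun y => v < y) := by
  have hp := shiftTail_perm hx hv
  have h1 : negSums (v :: (shiftTail v x fs ++ rs)) = negSums (x :: (fs ++ rs)) :=
    negSums_perm (hp.append_right rs)
  have h2 : ((v :: shiftTail v x fs).map fun x => rs.countP (fun y => x < y)).sum =
      ((x :: fs).map fun x => rs.countP (fun y => x < y)).sum := (hp.map _).sum_eq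
  have h3 : ascents (shiftTail v x fs) = ascents fs := ascents_map (strictMonoOn_shift hx hv)
  have h4 : (x :: fs).countP (fun y => v < y) = (shiftTail v x fs).countP (fun y => v < y) := by
    rw [← hp.countP_eq]; simp
  have h5 : (x :: fs).countP (fun y => x < y) = fs.countP (fun y => x < y) := by simp
  rw [arrInv, arrInv, h1, h4, h5, ← List.cons_append, ← List.cons_append, ascents_append,
    ascents_append, h2, ascents, ascents, h3]
  omega

end ShiftTail

/-! ### Summing over arrangements -/

open Finset

/-- The lists of `n` integers whose absolute values are the elements of `W` (a set with `n`
elements). -/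
def arrangements : ℕ → Finset ℕ → Finset (List ℤ)
  | 0, _ => {[]}
  | n + 1, W => W.biUnion fun w => ({(w : ℤ), -(w : ℤ)} : Finset ℤ).biUnion fun x =>
      (arrangements n (W.erase w)).image (List.cons x)

theorem mem_arrangements {n : ℕ} {W : Finset ℕ} (hW : W.card = n) {xs : List ℤ} :
    xs ∈ arrangements n W ↔ ((xs.map Int.natAbs : List ℕ) : Multiset ℕ) = W.val := by
  induction n generalizing W xs with
  | zero =>
    rw [card_eq_zero] at hW
    subst hW
    simp [arrangements]
  | succ n ih =>
    simp only [arrangements, mem_biUnion, mem_image, mem_insert, mem_singleton]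
    constructor
    · rintro ⟨w, hw, x, hx, ys, hys, rfl⟩
      rw [ih (by rw [card_erase_of_mem hw, hW]; rfl)] at hys
      have : x.natAbs = w := by rcases hx with rfl | rfl <;> simp
      rw [List.map_cons, this, ← Multiset.cons_coe, hys, erase_val, Multiset.cons_erase hw]
    · intro h
      rcases xs with _ | ⟨x, ys⟩
      · have := congrArg Multiset.card h
        simp [hW] at this
      · have hx : x.natAbs ∈ W := by
          rw [← mem_val, ← h]; simp
        refine ⟨x.natAbs, hx, x, by omega, ys, ?_, rfl⟩
        rw [ih (by rw [card_erase_of_mem hx, hW]; rfl), erase_val, ← h]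
        simp

theorem sum_arrangements_succ {M : Type*} [AddCommMonoid M] (n : ℕ) {W : Finset ℕ} (h0 : 0 ∉ W)
    (g : List ℤ → M) :
    ∑ xs ∈ arrangements (n + 1) W, g xs = ∑ w ∈ W, ∑ x ∈ ({(w : ℤ), -(w : ℤ)} : Finset ℤ),
      ∑ ys ∈ arrangements n (W.erase w), g (x :: ys) := by
  have _ := h0
  rw [arrangements, sum_biUnion]
  · refine sum_congr rfl fun w _ => ?_
    rw [sum_biUnion]
    · refine sum_congr rfl fun x _ => ?_
      rw [sum_image]
      intro a _ b _ h
      exact List.cons_injective h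
    · intro x _ y _ hxy
      simp only [Function.onFun, disjoint_left, mem_image]
      rintro _ ⟨a, _, rfl⟩ ⟨b, _, h⟩
      exact hxy (List.cons_eq_cons.1 h).1.symm
  · intro v _ w _ hvw
    simp only [Function.onFun, disjoint_left, mem_biUnion, mem_image]
    rintro _ ⟨x, hx, a, _, rfl⟩ ⟨y, hy, b, _, h⟩
    obtain rfl := (List.cons_eq_cons.1 h).1
    simp only [mem_insert, mem_singleton] at hx hy
    omega

/-- The number of inversions between a new first entry `x` and later entries whose absolute values
are the elements of `W`. -/
def headCost (x : ℤ) (W : Finset ℕ) : ℕ :=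
  ∑ v ∈ W, (if x.natAbs < v then 1 else if x < 0 then 2 else 0) + if x < 0 then 1 else 0

theorem headCost_of_pos {x : ℤ} (hx : 0 < x) {W : Finset ℕ} (hW : ∀ v ∈ W, v ≤ x.natAbs) :
    headCost x W = 0 := by
  have : ∀ v ∈ W, (if x.natAbs < v then 1 else if x < 0 then 2 else 0) = 0 := fun v hv => by
    rw [if_neg (hW v hv).not_gt, if_neg hx.not_gt]
  rw [headCost, sum_eq_zero this, if_neg hx.not_gt]

theorem headCost_of_neg {x : ℤ} (hx : x < 0) {W : Finset ℕ} (hW : ∀ v ∈ W, v ≤ x.natAbs) :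
    headCost x W = 2 * W.card + 1 := by
  have : ∀ v ∈ W, (if x.natAbs < v then 1 else if x < 0 then 2 else 0) = 2 := fun v hv => by
    rw [if_neg (hW v hv).not_gt, if_pos hx]
  rw [headCost, sum_congr rfl this, if_pos hx, sum_const, smul_eq_mul, mul_comm]

/-- If |x| < |y|, exactly one of x < y and x + y < 0 holds. If |x| > |y|, both hold for x < 0 and
neither for x > 0. -/
theorem arrInv_cons {x : ℤ} {W : Finset ℕ} (hx : x.natAbs ∉ W) {ys : List ℤ}
    (hys : ((ys.map Int.natAbs : List ℕ) : Multiset ℕ) = W.val) :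
    arrInv (x :: ys) = headCost x W + arrInv ys := by
  have h1 : ∀ zs : List ℤ, (∀ y ∈ zs, y.natAbs ≠ x.natAbs) →
      zs.countP (fun y => x < y) + zs.countP (fun y => x + y < 0) =
      ((zs.map Int.natAbs).map fun v =>
        if x.natAbs < v then 1 else if x < 0 then 2 else 0).sum := by
    intro zs hzs
    induction zs with
    | nil => simp
    | cons z zs ih =>
      have hz := hzs z (by simp)
      have := ih fun y hy => hzs y (by simp [hy])
      simp only [List.countP_cons, List.map_cons, List.sum_cons, ← this, decide_eq_true_eq]
      split_ifs <;> omega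
  have h2 := h1 ys (by
    intro y hy e
    apply hx
    rw [← mem_val, ← hys, ← e]
    simpa using ⟨y, hy, rfl⟩)
  rw [arrInv, arrInv, ascents, negSums, headCost, Finset.sum, ← hys, Multiset.map_coe,
    Multiset.sum_coe, ← h2]
  omega

/-! ### The hook formula for signed arrangements. -/

section HookFormula

variable {A : Type*} [CommRing A]

/-- The head costs take each value 0, …, 2|W| - 1 once: a new maximum raises all earlier costs by
one, and its own two signs cost 0 and 2|W| + 1, where `W` is the set before the insertion. -/
theorem sum_headCost (q : A) (W : Finset ℕ) (h0 : 0 ∉ W) :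
    ∑ w ∈ W, ∑ x ∈ ({(w : ℤ), -(w : ℤ)} : Finset ℤ), q ^ headCost x (W.erase w) =
      qInt q (2 * W.card) := by
  induction W using Finset.induction_on_max with
  | empty => simp [qInt]
  | insert m W hm ih =>
    have hmW : m ∉ W := fun h => lt_irrefl _ (hm m h)
    have hW : 0 ∉ W := fun h => h0 (mem_insert_of_mem h)
    have hm0 : m ≠ 0 := fun h => h0 (by simp [h])
    rw [sum_insert hmW, erase_insert hmW, card_insert_of_notMem hmW]
    have h1 : ∀ w ∈ W, ∑ x ∈ ({(w : ℤ), -(w : ℤ)} : Finset ℤ),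
        q ^ headCost x ((insert m W).erase w) =
        q * ∑ x ∈ ({(w : ℤ), -(w : ℤ)} : Finset ℤ), q ^ headCost x (W.erase w) := by
      intro w hw
      have hwm := hm w hw
      rw [mul_sum]
      refine sum_congr rfl fun x hx => ?_
      have hx' : x.natAbs = w := by
        simp only [mem_insert, mem_singleton] at hx; omega
      rw [erase_insert_of_ne (by omega), headCost, sum_insert (by simp [hmW]), hx', if_pos hwm,
        headCost, hx', ← pow_succ']
      congr 1; ring
    rw [sum_congr rfl h1, ← mul_sum, ih hW, sum_pair (by omega)]
    have e1 : headCost (m : ℤ) W = 0 :=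
      headCost_of_pos (by omega) fun v hv => by have := hm v hv; omega
    have e2 : headCost (-(m : ℤ)) W = 2 * W.card + 1 :=
      headCost_of_neg (by omega) fun v hv => by have := hm v hv; omega
    rw [e1, e2, mul_add, mul_one, show 2 * #W + 2 = 2 * #W + 1 + 1 from rfl, qInt_succ]
    rw [qInt, qInt, sum_range_succ', mul_sum]
    simp only [pow_succ', pow_zero]
    ring

theorem sum_pow_countP (q : A) {xs : List ℤ} (h : xs.Nodup) :
    ∑ v ∈ xs.toFinset, q ^ xs.countP (fun y => v < y) = qInt q xs.length := by
  have h1 : ∀ v, xs.countP (fun y => v < y) = #{y ∈ xs.toFinset | v < y} := by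
    intro v
    rw [List.countP_eq_length_filter, ← List.toFinset_card_of_nodup (h.filter _)]
    congr 1
    ext; simp
  simp only [h1]
  rw [← List.toFinset_card_of_nodup h]
  generalize xs.toFinset = V
  induction V using Finset.induction_on_max with
  | empty => simp [qInt]
  | insert m V hm ih =>
    have hmV : m ∉ V := fun h => lt_irrefl _ (hm m h)
    rw [sum_insert hmV, card_insert_of_notMem hmV]
    have e1 : #{y ∈ insert m V | m < y} = 0 := by
      rw [card_eq_zero, filter_eq_empty_iff]
      intro y hy
      rcases mem_insert.1 hy with rfl | hy
      · exact lt_irrefl _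
      · exact (hm y hy).le.not_gt
    have e2 : ∀ v ∈ V, q ^ #{y ∈ insert m V | v < y} = q * q ^ #{y ∈ V | v < y} := by
      intro v hv
      rw [filter_insert, if_pos (hm v hv), card_insert_of_notMem (by simp [hmV]), pow_succ']
    rw [e1, sum_congr rfl e2, ← mul_sum, ih, qInt, qInt, sum_range_succ', mul_sum]
    simp only [pow_succ', pow_zero]
    ring

open Classical in
/-- The generating function of the arrangements of `W` compatible with `T`. -/
noncomputable def arrSum (q : A) (T : PlaneTree EdgeMark) (W : Finset ℕ) : A :=
  ∑ xs ∈ (arrangements T.numEdges W).filter (Compatible T), q ^ arrInv xs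

/-- An undotted edge with nothing below it leaves the first entry free, so its cost splits off and
is summed by `sum_headCost`. This requires the sum for the rest to be independent of which absolute
values remain. -/
theorem arrSum_leaf (q : A) (a : EdgeMark) (ha : a.dot = false) (R : PlaneTree EdgeMark)
    {W : Finset ℕ} (h0 : 0 ∉ W) (hW : W.card = R.numEdges + 1) (c : A)
    (hR : ∀ W' : Finset ℕ, 0 ∉ W' → W'.card = R.numEdges → arrSum q R W' = c) :
    arrSum q (.cons a .nil R) W = qInt q (2 * W.card) * c := by
  classical
  have hn : (PlaneTree.cons a .nil R).numEdges = R.numEdges + 1 := by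
    simp [PlaneTree.numEdges]; ring
  rw [arrSum, hn, sum_filter, sum_arrangements_succ _ h0, ← sum_headCost q W h0, sum_mul]
  refine sum_congr rfl fun w hw => ?_
  rw [sum_mul]
  refine sum_congr rfl fun x hx => ?_
  have hc : (W.erase w).card = R.numEdges := by rw [card_erase_of_mem hw, hW]; rfl
  have hx' : x.natAbs = w := by
    simp only [mem_insert, mem_singleton] at hx; omega
  rw [← hR (W.erase w) (fun h => h0 (mem_of_mem_erase h)) hc, arrSum, sum_filter, mul_sum]
  refine sum_congr rfl fun ys hys => ?_
  rw [mem_arrangements hc] at hys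
  have : Compatible (.cons a .nil R) (x :: ys) ↔ Compatible R ys := by
    constructor
    · rintro ⟨y, fs, rs, e, h1, h2, -⟩
      rw [show fs = [] from h1, List.nil_append, List.cons_eq_cons] at e
      rw [e.2]; exact h2
    · intro h
      exact ⟨x, [], ys, rfl, rfl, h, by simp, by simp [ha]⟩
  simp only [this]
  rw [arrInv_cons (by simp [hx']) hys, mul_ite, mul_zero, pow_add]

/-- The root entry is negative and smaller than f and -f for every other entry f, hence it is minus
the largest element of `W`. It is then inverted in every possible way, 2|F| + 1 times. -/
theorem arrSum_dotted (q : A) (a : EdgeMark) (ha : a.dot = true) (F : PlaneTree EdgeMark)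
    {W : Finset ℕ} (h0 : 0 ∉ W) (hW : W.card = F.numEdges + 1) :
    ∃ W' : Finset ℕ, 0 ∉ W' ∧ W'.card = F.numEdges ∧
      arrSum q (.cons a F .nil) W = q ^ (2 * F.numEdges + 1) * arrSum q F W' := by
  classical
  have hne : W.Nonempty := by rw [← card_pos]; omega
  set m := W.max' hne with hm
  have hmW : m ∈ W := max'_mem _ _
  have hc : (W.erase m).card = F.numEdges := by rw [card_erase_of_mem hmW, hW]; rfl
  have hm0 : m ≠ 0 := fun h => h0 (h ▸ hmW)
  have hmax : ∀ v ∈ W, v ≤ m := fun v hv => le_max' _ _ hv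
  refine ⟨W.erase m, fun h => h0 (mem_of_mem_erase h), hc, ?_⟩
  have hn : (PlaneTree.cons a F .nil).numEdges = F.numEdges + 1 := by
    simp [PlaneTree.numEdges]
  have key : ∀ w ∈ W, ∀ x ∈ ({(w : ℤ), -(w : ℤ)} : Finset ℤ),
      ∀ ys ∈ arrangements F.numEdges (W.erase w),
      (Compatible (.cons a F .nil) (x :: ys) ↔ x = -(m : ℤ) ∧ Compatible F ys) := by
    intro w hw x hx ys hys
    have hcw : (W.erase w).card = F.numEdges := by rw [card_erase_of_mem hw, hW]; rfl
    have hx' : x.natAbs = w := by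
      simp only [mem_insert, mem_singleton] at hx; omega
    rw [mem_arrangements hcw] at hys
    have hmem : ∀ v, v ∈ W.erase w ↔ ∃ y ∈ ys, y.natAbs = v := by
      intro v; rw [← mem_val, ← hys]; simp
    constructor
    · rintro ⟨y, fs, rs, e, h1, h2, h3, h4⟩
      rw [show rs = [] from h2, List.append_nil, List.cons_eq_cons] at e
      obtain ⟨rfl, rfl⟩ := e
      refine ⟨?_, h1⟩
      obtain ⟨h5, h6⟩ := h4 ha
      by_contra hxm
      have hwm : m ≠ w := by omega
      obtain ⟨y, hy, hym⟩ := (hmem m).1 (mem_erase.2 ⟨hwm, hmW⟩)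
      have := h3 y hy
      have := h6 y hy
      have := hmax w hw
      omega
    · rintro ⟨rfl, h⟩
      refine ⟨-(m : ℤ), ys, [], by simp, h, rfl, ?_⟩
      have hy : ∀ y ∈ ys, y.natAbs < m := by
        intro y hy
        have := (hmem y.natAbs).2 ⟨y, hy, rfl⟩
        have h7 := hmax _ (mem_of_mem_erase this)
        have h8 := ne_of_mem_erase this
        simp at hx'
        omega
      refine ⟨fun f hf => ?_, fun _ => ⟨by omega, fun f hf => ?_⟩⟩
      · have := hy f hf; omega
      · have := hy f hf; omega
  rw [arrSum, hn, sum_filter, sum_arrangements_succ _ h0,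
    sum_eq_single_of_mem m hmW, sum_eq_single_of_mem (-(m : ℤ)) (by simp), arrSum, sum_filter,
    mul_sum]
  · refine sum_congr rfl fun ys hys => ?_
    have e := key m hmW (-(m : ℤ)) (by simp) ys hys
    rw [mem_arrangements hc] at hys
    simp only [e, true_and]
    rw [arrInv_cons (by simp) hys, mul_ite, mul_zero, pow_add]
    have e2 : headCost (-(m : ℤ)) (W.erase m) = 2 * F.numEdges + 1 := by
      rw [headCost_of_neg (by omega) fun v hv => ?_, hc]
      have := hmax _ (mem_of_mem_erase hv)
      omega
    rw [e2]
  · intro x hx hne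
    refine sum_eq_zero fun ys hys => ?_
    rw [if_neg]
    rw [key m hmW x hx ys hys]
    tauto
  · intro w hw hne
    refine sum_eq_zero fun x hx => sum_eq_zero fun ys hys => ?_
    rw [if_neg]
    rw [key w hw x hx ys hys]
    rintro ⟨rfl, -⟩
    simp only [mem_insert, mem_singleton] at hx
    omega

/-- The condition at the root edge says that the first of the leading |F| + 1 entries is the least
of them. Dropping it turns the edge into a leaf beside `F.glue R`. `shiftTail` moves any of these
entries to the front and keeps the conditions in `F`, which concern only the order because `F` is
undotted. So an arrangement without the condition amounts to one with it together with a chosen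
leading value, namely the former first entry. The chosen value is weighted by the number of larger
leading entries, and these weights sum to [|F| + 1]. -/
theorem arrSum_undotted (q : A) (a : EdgeMark) (ha : a.dot = false) (F R : PlaneTree EdgeMark)
    (hF : IsUndotted F) {W : Finset ℕ} (hW : W.card = F.numEdges + 1 + R.numEdges) :
    qInt q (F.numEdges + 1) * arrSum q (.cons a F R) W =
      q ^ F.numEdges * arrSum q (.cons a .nil (F.glue R)) W := by
  let cnt : ℤ → List ℤ → ℕ := fun v l => l.countP (fun y => v < y)
  classical
  set h := F.numEdges + 1 with hh
  have n1 : (PlaneTree.cons a F R).numEdges = h + R.numEdges := rfl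
  have n2 : (PlaneTree.cons a .nil (F.glue R)).numEdges = h + R.numEdges := by
    simp [PlaneTree.numEdges, PlaneTree.numEdges_glue]; ring
  rw [arrSum, arrSum, n1, n2]
  -- the two families of arrangements, with the parts of the arrangement displayed
  have hA : ∀ xs ∈ (arrangements (h + R.numEdges) W).filter
      (Compatible (.cons a .nil (F.glue R))), ∃ x fs rs, xs = x :: (fs ++ rs) ∧
        fs.length + 1 = h ∧ (x :: fs).Nodup ∧ Compatible F fs ∧ Compatible R rs := by
    intro xs hxs
    rw [mem_filter, mem_arrangements hW] at hxs
    obtain ⟨hm, x, _, us, rfl, h1, h2, -⟩ := hxs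
    rw [show _ = [] from h1, List.nil_append] at hm ⊢
    obtain ⟨fs, rs, rfl, h3, h4⟩ := compatible_glue.1 h2
    refine ⟨x, fs, rs, rfl, by rw [h3.length], ?_, h3, h4⟩
    have : ((x :: (fs ++ rs)).map Int.natAbs).Nodup := by
      rw [← Multiset.coe_nodup, hm]; exact W.nodup
    have := this.of_map
    rw [← List.cons_append] at this
    exact (List.nodup_append.1 this).1
  have hB : ∀ xs, xs ∈ (arrangements (h + R.numEdges) W).filter (Compatible (.cons a F R)) ↔
      xs ∈ (arrangements (h + R.numEdges) W).filter (Compatible (.cons a .nil (F.glue R))) ∧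
        ∀ y ∈ xs.take h, xs.headI ≤ y := by
    intro xs
    constructor
    · intro hxs
      obtain ⟨hm, x, fs, rs, rfl, h1, h2, h3, -⟩ := mem_filter.1 hxs
      refine ⟨mem_filter.2 ⟨hm, x, [], fs ++ rs, by simp, rfl,
        compatible_glue.2 ⟨fs, rs, rfl, h1, h2⟩, by simp, by simp [ha]⟩, ?_⟩
      have : (x :: (fs ++ rs)).take h = x :: fs := by
        rw [hh, ← h1.length, List.take_succ_cons, List.take_left']; rfl
      rw [this]
      intro y hy
      rcases List.mem_cons.1 hy with rfl | hy
      · exact le_rfl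
      · exact (h3 y hy).le
    · rintro ⟨hxs, hmin⟩
      obtain ⟨x, fs, rs, rfl, hl, hnd, h1, h2⟩ := hA xs hxs
      have ht : (x :: (fs ++ rs)).take h = x :: fs := by
        rw [← hl, List.take_succ_cons, List.take_left']; rfl
      rw [ht] at hmin
      refine mem_filter.2 ⟨(mem_filter.1 hxs).1, x, fs, rs, rfl, h1, h2, fun f hf => ?_,
        by simp [ha]⟩
      refine lt_of_le_of_ne (hmin f (by simp [hf])) fun e => ?_
      exact (List.nodup_cons.1 hnd).1 (e ▸ hf)
  set P := (arrangements (h + R.numEdges) W).filter (Compatible (.cons a .nil (F.glue R))) with hP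
  -- moving a new value to the front
  let move : ℤ → List ℤ → List ℤ := fun v xs =>
    v :: (shiftTail v xs.headI (xs.tail.take F.numEdges) ++ xs.tail.drop F.numEdges)
  have move_eq : ∀ v x fs rs, fs.length + 1 = h →
      move v (x :: (fs ++ rs)) = v :: (shiftTail v x fs ++ rs) := by
    intro v x fs rs hl
    have hl : fs.length = F.numEdges := by omega
    simp [move, ← hl]
  have move_mem : ∀ xs ∈ P, ∀ v ∈ xs.take h, move v xs ∈ P := by
    intro xs hxs v hv
    obtain ⟨x, fs, rs, rfl, hl, hnd, h1, h2⟩ := hA xs hxs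
    have ht : (x :: (fs ++ rs)).take h = x :: fs := by
      rw [← hl, List.take_succ_cons, List.take_left']; rfl
    rw [ht] at hv
    rw [move_eq v x fs rs hl, hP, mem_filter]
    refine ⟨?_, v, [], _, by simp, rfl, compatible_glue.2
      ⟨shiftTail v x fs, rs, rfl, h1.map hF (strictMonoOn_shift hnd hv), h2⟩, by simp,
      by simp [ha]⟩
    have := (mem_arrangements hW).1 (mem_filter.1 hxs).1
    rw [mem_arrangements hW, ← this, Multiset.coe_eq_coe, ← List.cons_append, ← List.cons_append]
    exact ((shiftTail_perm hnd hv).append_right rs).map _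
  have head_le : ∀ xs ∈ P, ∃ m ∈ xs.take h, ∀ y ∈ xs.take h, m ≤ y := by
    intro xs hxs
    obtain ⟨x, fs, rs, rfl, hl, hnd, h1, h2⟩ := hA xs hxs
    have ht : (x :: (fs ++ rs)).take h = x :: fs := by
      rw [← hl, List.take_succ_cons, List.take_left']; rfl
    rw [ht]
    obtain ⟨m, hm, hmin⟩ := (x :: fs).toFinset.exists_min_image id ⟨x, by simp⟩
    exact ⟨m, List.mem_toFinset.1 hm, fun y hy => hmin y (List.mem_toFinset.2 hy)⟩
  choose! least hleast_mem hleast using head_le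
  have lhs : qInt q h * ∑ xs ∈ (arrangements (h + R.numEdges) W).filter
      (Compatible (.cons a F R)), q ^ arrInv xs =
      ∑ p ∈ ((arrangements (h + R.numEdges) W).filter (Compatible (.cons a F R))).sigma
        (fun xs => (xs.take h).toFinset),
        q ^ (arrInv p.1 + cnt p.2 (p.1.take h)) := by
    rw [sum_sigma, mul_sum]
    refine sum_congr rfl fun xs hxs => ?_
    obtain ⟨x, fs, rs, rfl, hl, hnd, h1, h2⟩ := hA xs ((hB xs).1 hxs).1
    have ht : (x :: (fs ++ rs)).take h = x :: fs := by
      rw [← hl, List.take_succ_cons, List.take_left']; rfl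
    simp only [pow_add, ← mul_sum, ht]
    rw [show ∑ v ∈ (x :: fs).toFinset, q ^ cnt v (x :: fs) = _ from sum_pow_countP q hnd, List.length_cons, hl, mul_comm]
  rw [lhs, mul_sum]
  symm
  refine sum_bij' (fun xs _ => ⟨move (least xs) xs, xs.headI⟩) (fun p _ => move p.2 p.1)
    ?_ ?_ ?_ ?_ ?_
  · intro xs hxs
    obtain ⟨x, fs, rs, rfl, hl, hnd, h1, h2⟩ := hA xs hxs
    have ht : ∀ x fs, fs.length + 1 = h → (x :: (fs ++ rs)).take h = x :: fs := by
      intro x fs hl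
      rw [← hl, List.take_succ_cons, List.take_left']; rfl
    have hl1 := hleast_mem _ hxs
    have hl2 := hleast _ hxs
    have hmm := move_mem _ hxs _ hl1
    rw [ht x fs hl] at hl1 hl2
    have hpm := shiftTail_perm hnd hl1
    rw [mem_sigma, hB]
    refine ⟨⟨hmm, ?_⟩, ?_⟩
    · simp only [move_eq _ x fs rs hl]
      rw [ht _ _ (by rw [shiftTail_length, hl])]
      intro y hy
      exact hl2 y (hpm.mem_iff.1 hy)
    · simp only [move_eq _ x fs rs hl]
      rw [ht _ _ (by rw [shiftTail_length, hl]), List.mem_toFinset, hpm.mem_iff]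
      simp
  · rintro ⟨xs, v⟩ hp
    rw [mem_sigma, List.mem_toFinset, hB] at hp
    exact move_mem _ hp.1.1 _ hp.2
  · intro xs hxs
    obtain ⟨x, fs, rs, rfl, hl, hnd, h1, h2⟩ := hA xs hxs
    have ht : (x :: (fs ++ rs)).take h = x :: fs := by
      rw [← hl, List.take_succ_cons, List.take_left']; rfl
    have hl1 := hleast_mem _ hxs
    rw [ht] at hl1
    simp only [move_eq _ x fs rs hl]
    rw [move_eq _ _ _ rs (by rw [shiftTail_length, hl]), shiftTail_shiftTail hnd hl1 (by simp)]
    simp [shiftTail_self hnd]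
  · rintro ⟨xs, v⟩ hp
    rw [mem_sigma, List.mem_toFinset, hB] at hp
    obtain ⟨⟨hxs, hmin⟩, hv⟩ := hp
    simp only at hxs hmin hv
    have hmm := move_mem _ hxs _ hv
    have hl1 := hleast_mem _ hmm
    have hl2 := hleast _ hmm
    obtain ⟨x, fs, rs, rfl, hl, hnd, h1, h2⟩ := hA xs hxs
    have ht : ∀ x fs, fs.length + 1 = h → (x :: (fs ++ rs)).take h = x :: fs := by
      intro x fs hl
      rw [← hl, List.take_succ_cons, List.take_left']; rfl
    rw [ht x fs hl] at hv hmin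
    simp only [move_eq _ x fs rs hl] at hl1 hl2 ⊢
    have hls : (shiftTail v x fs).length + 1 = h := by rw [shiftTail_length, hl]
    rw [ht _ _ hls] at hl1 hl2
    have hpm := shiftTail_perm hnd hv
    rw [move_eq _ _ _ rs hls]
    have hmem := hpm.mem_iff.1 hl1
    have : least (v :: (shiftTail v x fs ++ rs)) = x :=
      le_antisymm (hl2 x (hpm.mem_iff.2 (by simp))) (hmin _ hmem)
    rw [this, shiftTail_shiftTail hnd hv (by simp), shiftTail_self hnd]
    rfl
  · intro xs hxs
    obtain ⟨x, fs, rs, rfl, hl, hnd, h1, h2⟩ := hA xs hxs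
    have ht : ∀ x fs, fs.length + 1 = h → (x :: (fs ++ rs)).take h = x :: fs := by
      intro x fs hl
      rw [← hl, List.take_succ_cons, List.take_left']; rfl
    have hl1 := hleast_mem _ hxs
    have hl2 := hleast _ hxs
    rw [ht x fs hl] at hl1 hl2
    set m := least (x :: (fs ++ rs))
    have hpm := shiftTail_perm hnd hl1
    have hls : (shiftTail m x fs).length + 1 = h := by rw [shiftTail_length, hl]
    simp only [move_eq _ x fs rs hl]
    have e0 : ∀ v, cnt v (m :: shiftTail m x fs) = cnt v (x :: fs) := fun v => hpm.countP_eq _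
    rw [ht _ _ hls, e0, ← pow_add]
    have e : _ + cnt x (x :: fs) = _ + cnt m (x :: fs) := arrInv_shiftTail hnd hl1 rs
    -- The least leading entry lies below all |F| others; this is the source of the power of q in
    -- the statement.
    have e2 : cnt m (x :: fs) = F.numEdges := by
      change (x :: fs).countP _ = _
      rw [← hpm.countP_eq, List.countP_cons, if_neg (by simp), List.countP_eq_length.2, add_zero]
      · omega
      · intro y hy
        have hnd' := shiftTail_nodup hnd hl1
        have : m ≤ y := hl2 y (hpm.mem_iff.1 (by simp [hy]))
        have : m ≠ y := fun e => (List.nodup_cons.1 hnd').1 (e ▸ hy)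
        simp only [decide_eq_true_eq]; omega
    congr 1
    simp only [List.headI_cons]
    omega

/-- The hook formula for signed arrangements. -/
theorem hookProd_mul_arrSum (q : A) (T : PlaneTree EdgeMark) (hT : IsSpined T)
    {W : Finset ℕ} (h0 : 0 ∉ W) (hW : W.card = T.numEdges)
    (hreg : ∀ n, IsRegular (qInt q (n + 1))) :
    hookProd q T * arrSum q T W =
      q ^ minInv T * ∏ i ∈ range T.numEdges, qInt q (2 * (i + 1)) := by
  classical
  have hregT : ∀ T, IsRegular (hookProd q T) := by
    intro T
    induction T with
    | nil => exact isRegular_one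
    | cons a F R ih1 ih2 =>
      refine IsRegular.mul ?_ (ih1.mul ih2)
      rcases a.dot
      · exact hreg _
      · exact hreg (2 * F.numEdges + 1)
  induction hn : T.numEdges generalizing T W with
  | zero =>
    rcases T with _ | ⟨a, F, R⟩
    · rw [PlaneTree.numEdges, card_eq_zero] at hW
      simp [arrSum, hookProd, minInv, PlaneTree.numEdges, arrangements, Compatible,
        filter_singleton, arrInv, ascents, negSums]
    · simp [PlaneTree.numEdges] at hn
  | succ n ih =>
    rcases T with _ | ⟨a, F, R⟩
    · simp [PlaneTree.numEdges] at hn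
    · rw [prod_range_succ]
      simp only [PlaneTree.numEdges] at hn hW
      rcases hT with ⟨ha, rfl, hF⟩ | ⟨ha, hF, hR⟩
      · simp only [PlaneTree.numEdges, add_zero, Nat.succ.injEq] at hn hW
        obtain ⟨W', h0', hc', e⟩ := arrSum_dotted q a ha F h0 hW
        have := ih F hF h0' hc' hn
        rw [e, hookProd, minInv, if_pos ha, if_pos ha, pow_add, pow_add, hn, hookProd, minInv,
          mul_one]
        linear_combination (qInt q (2 * (n + 1)) * q ^ (2 * n + 1)) * this
      · have hn' : F.numEdges + R.numEdges = n := by omega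
        have e := arrSum_undotted q a ha F R hF hW
        set c := q ^ (minInv F + minInv R) * ∏ i ∈ range n, qInt q (2 * (i + 1))
        -- The glued tree is again spined, has one edge fewer, and its hook product is that of `F`
        -- times that of `R`.
        have hG : ∀ W' : Finset ℕ, 0 ∉ W' → W'.card = (F.glue R).numEdges →
            hookProd q F * hookProd q R * arrSum q (F.glue R) W' = c := by
          intro W' h0' hc'
          have := ih (F.glue R) (hF.glue hR) h0' hc' (by rw [PlaneTree.numEdges_glue, hn'])
          rw [hookProd_glue, minInv_glue] at this
          exact this
        obtain ⟨W₁, hW₁⟩ : ∃ w, w ∈ W := by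
          rw [← Finset.Nonempty, ← card_pos]; omega
        have hc₁ : (W.erase W₁).card = (F.glue R).numEdges := by
          rw [card_erase_of_mem hW₁, hW, PlaneTree.numEdges_glue]; omega
        have h0₁ : 0 ∉ W.erase W₁ := fun h => h0 (mem_of_mem_erase h)
        -- The right-hand side of the hook formula depends only on the size of the set, so by
        -- regularity of the hook product the arrangement sum does too.
        have hl := arrSum_leaf q a ha (F.glue R) (W := W) h0
          (by rw [PlaneTree.numEdges_glue]; omega) (arrSum q (F.glue R) (W.erase W₁)) (by
            intro W' h0' hc'
            have := (hG W' h0' hc').trans (hG _ h0₁ hc₁).symm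
            exact ((hregT F).mul (hregT R)).left this)
        have h1 := hG _ h0₁ hc₁
        rw [hookProd, minInv, ha]
        simp only [Bool.false_eq_true, if_false]
        rw [hl] at e
        have hWn : W.card = n + 1 := by omega
        rw [hWn] at e
        rw [add_assoc, pow_add]
        linear_combination (hookProd q F * hookProd q R) * e +
          (q ^ F.numEdges * qInt q (2 * (n + 1))) * h1

end HookFormula

end BallotTiling

namespace BallotTiling

open Finset

/-! ### Inversion sets of signed permutations -/

/-- The positive roots inverted by `x`: `(false, a, b)` stands for `e_a - e_b` and
`(true, a, b)` for `e_a + e_b`, or `e_a` if `a = b`. -/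
def Inverted {N : ℕ} (x : Fin N → ℤ) (r : Bool × Fin N × Fin N) : Prop :=
  (r.1 = true ∧ r.2.1 ≤ r.2.2 ∧ x r.2.1 + x r.2.2 < 0) ∨
    (r.1 = false ∧ r.2.1 < r.2.2 ∧ x r.2.1 < x r.2.2)

instance {N : ℕ} (x : Fin N → ℤ) : DecidablePred (Inverted x) := fun _ => by
  unfold Inverted; infer_instance

/-- The set of inverted roots. -/
def invSet {N : ℕ} (x : Fin N → ℤ) : Finset (Bool × Fin N × Fin N) := univ.filter (Inverted x)

namespace SignedPerm

variable {N : ℕ}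

/-- The letter `l` occurs at position `N - |x|`, and is barred if `x` is negative; `x` is the value
returned. -/
def letterVal (σ : SignedPerm N) (l : Fin N) : ℤ :=
  if σ.neg (σ.perm.symm l) then -((N : ℤ) - (σ.perm.symm l : ℕ))
  else (N : ℤ) - (σ.perm.symm l : ℕ)

theorem letterVal_perm (σ : SignedPerm N) (i : Fin N) :
    σ.letterVal (σ.perm i) = if σ.neg i then -((N : ℤ) - (i : ℕ)) else (N : ℤ) - (i : ℕ) := by
  simp [letterVal]

theorem natAbs_letterVal (σ : SignedPerm N) (l : Fin N) :
    (σ.letterVal l).natAbs = N - (σ.perm.symm l : ℕ) := by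
  have := (σ.perm.symm l).isLt
  rw [letterVal]; split_ifs <;> omega

theorem natAbs_letterVal_injective (σ : SignedPerm N) :
    Function.Injective fun l => (σ.letterVal l).natAbs := by
  intro a b h
  simp only [natAbs_letterVal] at h
  have h1 := (σ.perm.symm a).isLt
  have h2 := (σ.perm.symm b).isLt
  exact σ.perm.symm.injective (Fin.ext (by omega))

theorem letterVal_injective : Function.Injective (letterVal (N := N)) := by
  intro σ τ h
  have hp : ∀ l, σ.perm.symm l = τ.perm.symm l := by
    intro l
    have h1 := natAbs_letterVal σ l
    rw [h, natAbs_letterVal] at h1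
    have h2 := (σ.perm.symm l).isLt
    have h3 := (τ.perm.symm l).isLt
    exact Fin.ext (by omega)
  have hp' : σ.perm = τ.perm := by
    rw [← σ.perm.symm_symm, ← τ.perm.symm_symm]
    exact congrArg Equiv.symm (Equiv.ext hp)
  have hn : σ.neg = τ.neg := by
    funext i
    have h1 := letterVal_perm σ i
    rw [h, hp', letterVal_perm] at h1
    have := i.isLt
    cases hσ : σ.neg i <;> cases hτ : τ.neg i <;> simp [hσ, hτ] at h1 ⊢ <;> omega
  cases σ; cases τ; simp_all

theorem letterVal_one (l : Fin N) : (one : SignedPerm N).letterVal l = (N : ℤ) - (l : ℕ) := by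
  simp [letterVal, one]

theorem invSet_one : invSet (one : SignedPerm N).letterVal = ∅ := by
  rw [invSet, filter_eq_empty_iff]
  rintro ⟨β, a, b⟩ - h
  have ha := a.isLt
  have hb := b.isLt
  simp only [Inverted, letterVal_one, Fin.lt_def, Fin.le_def] at h
  omega

theorem mul_simple_perm (σ : SignedPerm N) (i : Fin N) (l : Fin N) :
    ((mul (simple i) σ).perm.symm l) = (simple i).perm.symm (σ.perm.symm l) := rfl

theorem mem_invSet {x : Fin N → ℤ} {β : Bool} {a b : Fin N} : (β, a, b) ∈ invSet x ↔
    (β = true ∧ (a : ℕ) ≤ b ∧ x a + x b < 0) ∨ (β = false ∧ (a : ℕ) < b ∧ x a < x b) := by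
  simp [invSet, Inverted]

/-- Exchanging two adjacent absolute values changes exactly one inversion. -/
theorem exists_root_of_exchange {y y' : Fin N → ℤ} {a b : Fin N} (hab : (a : ℕ) < b) {m m' : ℤ}
    (hm : 1 ≤ m) (hm' : 1 ≤ m') (hmm : m' = m - 1 ∨ m = m' - 1) {ε δ : Bool}
    (ya : y a = if ε then -m else m) (yb : y b = if δ then -m' else m')
    (ya' : y' a = if ε then -m' else m') (yb' : y' b = if δ then -m else m)
    (hy : ∀ c, c ≠ a → c ≠ b → y' c = y c ∧ y c ≠ m ∧ y c ≠ -m ∧ y c ≠ m' ∧ y c ≠ -m') :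
    (∀ r', r' ≠ (xor ε δ, a, b) → (r' ∈ invSet y' ↔ r' ∈ invSet y)) ∧
    ((xor ε δ, a, b) ∈ invSet y' ↔ (xor ε δ, a, b) ∉ invSet y) ∧
    ∀ u : Fin N → ℤ, u a + u b ≠ 0 → u a ≠ u b →
      ((xor ε δ, a, b) ∈ invSet u ↔ (xor ε δ, a, b) ∈ invSet y) →
      ((if δ then -u b else u b) < (if ε then -u a else u a) ↔ m' < m) := by
  refine ⟨?_, ?_, ?_⟩
  · rintro ⟨β, c, d⟩ hr
    rw [mem_invSet, mem_invSet]
    have hr' : ¬ (β = xor ε δ ∧ c = a ∧ d = b) := by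
      rintro ⟨rfl, rfl, rfl⟩; exact hr rfl
    by_cases hca : c = a
    · subst hca
      by_cases hda : d = c
      · subst hda
        rw [ya, ya']
        cases ε <;> simp <;> omega
      · by_cases hdb : d = b
        · subst hdb
          rw [ya, ya', yb, yb']
          cases ε <;> cases δ <;> cases β <;> simp at hr' ⊢ <;> omega
        · obtain ⟨h1, h2, h3, h4, h5⟩ := hy d hda hdb
          rw [h1, ya, ya']
          cases ε <;> cases β <;> simp <;> omega
    · by_cases hcb : c = b
      · subst hcb
        by_cases hda : d = a
        · subst hda
          cases β <;> simp <;> omega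
        · by_cases hdb : d = c
          · subst hdb
            rw [yb, yb']
            cases δ <;> simp <;> omega
          · obtain ⟨h1, h2, h3, h4, h5⟩ := hy d hda hdb
            rw [h1, yb, yb']
            cases δ <;> cases β <;> simp <;> omega
      · obtain ⟨h1, h2, h3, h4, h5⟩ := hy c hca hcb
        rw [h1]
        by_cases hda : d = a
        · subst hda
          rw [ya, ya']
          cases ε <;> cases β <;> simp <;> omega
        · by_cases hdb : d = b
          · subst hdb
            rw [yb, yb']
            cases δ <;> cases β <;> simp <;> omega
          · rw [(hy d hda hdb).1]
  · rw [mem_invSet, mem_invSet, ya, ya', yb, yb']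
    cases ε <;> cases δ <;> simp <;> omega
  · intro u h1 h2
    rw [mem_invSet, mem_invSet, ya, yb]
    cases ε <;> cases δ <;> simp <;> omega

/-- The counterpart of `exists_root_of_exchange` for the last position. An entry ±1 changes sign;
every other entry has absolute value at least 2, so no comparison or sum with it is affected. -/
theorem exists_root_of_flip {y y' : Fin N → ℤ} {a : Fin N} {ε : Bool}
    (ya : y a = if ε then -1 else 1) (ya' : y' a = if ε then 1 else -1)
    (hy : ∀ c, c ≠ a → y' c = y c ∧ y c ≠ 0 ∧ y c ≠ 1 ∧ y c ≠ -1) :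
    (∀ r', r' ≠ (true, a, a) → (r' ∈ invSet y' ↔ r' ∈ invSet y)) ∧
    ((true, a, a) ∈ invSet y' ↔ (true, a, a) ∉ invSet y) ∧
    ∀ u : Fin N → ℤ, u a ≠ 0 → ((true, a, a) ∈ invSet u ↔ (true, a, a) ∈ invSet y) →
      0 < (if ε then -u a else u a) := by
  refine ⟨?_, ?_, ?_⟩
  · rintro ⟨β, c, d⟩ hr
    rw [mem_invSet, mem_invSet]
    have hr' : ¬ (β = true ∧ c = a ∧ d = a) := by
      rintro ⟨rfl, rfl, rfl⟩; exact hr rfl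
    by_cases hca : c = a
    · subst hca
      by_cases hda : d = c
      · subst hda
        have : β = false := by simpa using hr'
        simp [this]
      · obtain ⟨h1, h2, h3, h4⟩ := hy d hda
        rw [h1, ya, ya']
        cases ε <;> cases β <;> simp <;> omega
    · obtain ⟨h1, h2, h3, h4⟩ := hy c hca
      rw [h1]
      by_cases hda : d = a
      · subst hda
        rw [ya, ya']
        cases ε <;> cases β <;> simp <;> omega
      · rw [(hy d hda).1]
  · rw [mem_invSet, mem_invSet, ya, ya']
    cases ε <;> simp
  · intro u h1
    rw [mem_invSet, mem_invSet, ya]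
    cases ε <;> simp
    all_goals omega

theorem letterVal_ne {σ : SignedPerm N} {l l' : Fin N} (h : l ≠ l') :
    σ.letterVal l ≠ σ.letterVal l' ∧ σ.letterVal l + σ.letterVal l' ≠ 0 := by
  have : (σ.letterVal l).natAbs ≠ (σ.letterVal l').natAbs :=
    σ.natAbs_letterVal_injective.ne h
  omega

theorem letterVal_ne_zero (σ : SignedPerm N) (l : Fin N) : σ.letterVal l ≠ 0 := by
  have h := natAbs_letterVal σ l
  have := (σ.perm.symm l).isLt
  omega

/-- Multiplying by a simple reflection changes exactly one inversion, and whether this inversion is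
shared by `u` determines the relative order in `u` of the letters which are exchanged. -/
theorem exists_root (σ : SignedPerm N) (i : Fin N) : ∃ r : Bool × Fin N × Fin N,
    (∀ r', r' ≠ r → (r' ∈ invSet (mul (simple i) σ).letterVal ↔ r' ∈ invSet σ.letterVal)) ∧
    (r ∈ invSet (mul (simple i) σ).letterVal ↔ r ∉ invSet σ.letterVal) ∧
    (∀ u : SignedPerm N, (r ∈ invSet u.letterVal ↔ r ∈ invSet σ.letterVal) →
      (∀ h : (i : ℕ) + 1 < N,
        (if σ.neg ⟨i + 1, h⟩ then -u.letterVal (σ.perm ⟨i + 1, h⟩)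
          else u.letterVal (σ.perm ⟨i + 1, h⟩)) <
        (if σ.neg i then -u.letterVal (σ.perm i) else u.letterVal (σ.perm i))) ∧
      (¬ (i : ℕ) + 1 < N →
        0 < if σ.neg i then -u.letterVal (σ.perm i) else u.letterVal (σ.perm i))) := by
  by_cases h : (i : ℕ) + 1 < N
  · set j : Fin N := ⟨i + 1, h⟩ with hj
    have hsp : (simple i).perm = Equiv.swap i j := by simp [simple, h, hj]
    have hsn : ∀ k, (simple i).neg k = false := by simp [simple, h]
    have hij : i ≠ j := fun e => by
      have := congrArg Fin.val e
      simp [hj] at this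
    have hab : σ.perm i ≠ σ.perm j := σ.perm.injective.ne hij
    have hneg : ∀ k, (mul (simple i) σ).neg k = σ.neg (Equiv.swap i j k) := by
      intro k; simp [mul, hsp, hsn]
    have hsymm : ∀ l, (mul (simple i) σ).perm.symm l = Equiv.swap i j (σ.perm.symm l) := by
      intro l; rw [mul_simple_perm, hsp]; rfl
    have hi := i.isLt
    have ya := letterVal_perm σ i
    have yb := letterVal_perm σ j
    have ya' : (mul (simple i) σ).letterVal (σ.perm i) =
        if σ.neg i then -((N : ℤ) - (j : ℕ)) else (N : ℤ) - (j : ℕ) := by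
      rw [letterVal, hsymm, hneg]; simp
    have yb' : (mul (simple i) σ).letterVal (σ.perm j) =
        if σ.neg j then -((N : ℤ) - (i : ℕ)) else (N : ℤ) - (i : ℕ) := by
      rw [letterVal, hsymm, hneg]; simp
    have hjv : (j : ℕ) = i + 1 := rfl
    have hy : ∀ c, c ≠ σ.perm i → c ≠ σ.perm j →
        (mul (simple i) σ).letterVal c = σ.letterVal c ∧ σ.letterVal c ≠ (N : ℤ) - (i : ℕ) ∧
        σ.letterVal c ≠ -((N : ℤ) - (i : ℕ)) ∧ σ.letterVal c ≠ (N : ℤ) - (j : ℕ) ∧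
        σ.letterVal c ≠ -((N : ℤ) - (j : ℕ)) := by
      intro c hci hcj
      have h1 : σ.perm.symm c ≠ i := fun e => hci (by rw [← e]; simp)
      have h2 : σ.perm.symm c ≠ j := fun e => hcj (by rw [← e]; simp)
      refine ⟨?_, ?_⟩
      · rw [letterVal, hneg, hsymm, Equiv.swap_apply_of_ne_of_ne h1 h2,
          Equiv.swap_apply_of_ne_of_ne h1 h2, letterVal]
      · have h3 := letterVal_ne (σ := σ) hci
        have h4 := letterVal_ne (σ := σ) hcj
        rw [ya] at h3
        rw [yb] at h4
        split_ifs at h3 h4 <;> omega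
    rcases lt_or_gt_of_ne hab with hlt | hlt
    · obtain ⟨h1, h2, h3⟩ := exists_root_of_exchange (Fin.lt_def.1 hlt) (by omega) (by omega)
        (by omega) ya yb ya' yb' hy
      refine ⟨_, h1, h2, fun u hu => ⟨fun _ => ?_, fun h' => absurd h h'⟩⟩
      have := (h3 _ (letterVal_ne hab).2 (letterVal_ne hab).1 hu).2 (by omega)
      exact this
    · obtain ⟨h1, h2, h3⟩ := exists_root_of_exchange (Fin.lt_def.1 hlt) (by omega) (by omega)
        (by omega) yb ya yb' ya' (fun c h1 h2 => by
          have := hy c h2 h1; tauto)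
      refine ⟨_, h1, h2, fun u hu => ⟨fun _ => ?_, fun h' => absurd h h'⟩⟩
      have h5 := h3 _ (letterVal_ne hab.symm).2 (letterVal_ne hab.symm).1 hu
      have h6 := letterVal_ne (σ := u) hab
      change (if σ.neg j then -u.letterVal (σ.perm j) else u.letterVal (σ.perm j)) < _
      split_ifs at h5 ⊢ <;> omega
  · have hiN : (i : ℕ) + 1 = N := by have := i.isLt; omega
    have hsp : (simple i).perm = Equiv.refl _ := by simp [simple, h]
    have hsn : ∀ k, (simple i).neg k = decide (k = i) := by simp [simple, h]
    have hneg : ∀ k, (mul (simple i) σ).neg k = xor (decide (k = i)) (σ.neg k) := by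
      intro k; simp [mul, hsp, hsn]
    have hsymm : ∀ l, (mul (simple i) σ).perm.symm l = σ.perm.symm l := by
      intro l; rw [mul_simple_perm, hsp]; rfl
    have ya : σ.letterVal (σ.perm i) = if σ.neg i then -1 else 1 := by
      rw [letterVal_perm, show (N : ℤ) - (i : ℕ) = 1 by omega]
    have ya' : (mul (simple i) σ).letterVal (σ.perm i) = if σ.neg i then 1 else -1 := by
      rw [letterVal, hsymm, hneg, Equiv.symm_apply_apply, show (N : ℤ) - (i : ℕ) = 1 by omega]
      cases σ.neg i <;> simp
    obtain ⟨h1, h2, h3⟩ := exists_root_of_flip ya ya' (fun c hc => by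
      have e : σ.perm.symm c ≠ i := fun e => hc (by rw [← e]; simp)
      have h3 := letterVal_ne (σ := σ) hc
      rw [ya] at h3
      refine ⟨?_, letterVal_ne_zero σ c, ?_⟩
      · rw [letterVal, hneg, hsymm, letterVal]
        simp [e]
      · split_ifs at h3 <;> omega)
    exact ⟨_, h1, h2, fun u hu => ⟨fun h' => absurd h' h,
      fun _ => h3 _ (letterVal_ne_zero u _) hu⟩⟩

theorem card_invSet_simple (σ : SignedPerm N) (i : Fin N) :
    (invSet σ.letterVal ⊆ invSet (mul (simple i) σ).letterVal ∧
      (invSet (mul (simple i) σ).letterVal).card = (invSet σ.letterVal).card + 1) ∨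
    (invSet (mul (simple i) σ).letterVal ⊆ invSet σ.letterVal ∧
      (invSet σ.letterVal).card = (invSet (mul (simple i) σ).letterVal).card + 1) := by
  obtain ⟨r, h1, h2, -⟩ := exists_root σ i
  by_cases hr : r ∈ invSet σ.letterVal
  · right
    have : invSet σ.letterVal = insert r (invSet (mul (simple i) σ).letterVal) := by
      ext r'
      by_cases e : r' = r
      · subst e; simp [hr]
      · simp [e, h1 r' e]
    rw [this, card_insert_of_notMem (by tauto)]
    exact ⟨subset_insert _ _, rfl⟩
  · left
    have : invSet (mul (simple i) σ).letterVal = insert r (invSet σ.letterVal) := by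
      ext r'
      by_cases e : r' = r
      · subst e; simp [h2.2 hr]
      · simp [e, h1 r' e]
    rw [this, card_insert_of_notMem hr]
    exact ⟨subset_insert _ _, rfl⟩

/-- N strictly decreasing positive integers not exceeding N leave no freedom: the value at i is
bounded above from the left end and below from the right end by N - i. -/
theorem eq_sub_of_strictAnti {f : Fin N → ℤ} (h1 : ∀ (i : Fin N) (h : (i : ℕ) + 1 < N),
    f ⟨i + 1, h⟩ < f i) (h2 : ∀ i : Fin N, ¬ (i : ℕ) + 1 < N → 0 < f i) (h3 : ∀ i, f i ≤ N)
    (i : Fin N) : f i = N - (i : ℕ) := by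
  have up : ∀ k (hk : k < N), f ⟨k, hk⟩ ≤ N - (k : ℤ) := by
    intro k
    induction k with
    | zero => intro hk; simpa using h3 ⟨0, hk⟩
    | succ k ih =>
      intro hk
      have := ih (by omega)
      have := h1 ⟨k, by omega⟩ hk
      simp only at this
      push_cast; omega
  have down : ∀ d k (hk : k < N), k + d + 1 = N → (N : ℤ) - k ≤ f ⟨k, hk⟩ := by
    intro d
    induction d with
    | zero =>
      intro k hk e
      have := h2 ⟨k, hk⟩ (by simp; omega)
      omega
    | succ d ih =>
      intro k hk e
      have := ih (k + 1) (by omega) (by omega)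
      have := h1 ⟨k, hk⟩ (by simp; omega)
      simp only at this
      push_cast at *; omega
  have hi := i.isLt
  exact le_antisymm (up i hi) (down (N - 1 - i) i hi (by omega))

/-- Read in the order and with the signs of σ, the values of u form a sequence as in
`eq_sub_of_strictAnti`, hence they are the values of σ. -/
theorem eq_of_agree (σ u : SignedPerm N)
    (h1 : ∀ (i : Fin N) (h : (i : ℕ) + 1 < N),
        (if σ.neg ⟨i + 1, h⟩ then -u.letterVal (σ.perm ⟨i + 1, h⟩)
          else u.letterVal (σ.perm ⟨i + 1, h⟩)) <
        (if σ.neg i then -u.letterVal (σ.perm i) else u.letterVal (σ.perm i)))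
    (h2 : ∀ i : Fin N, ¬ (i : ℕ) + 1 < N →
        0 < if σ.neg i then -u.letterVal (σ.perm i) else u.letterVal (σ.perm i)) : u = σ := by
  apply letterVal_injective
  funext l
  have h3 : ∀ i, (if σ.neg i then -u.letterVal (σ.perm i) else u.letterVal (σ.perm i)) ≤ N := by
    intro i
    have := natAbs_letterVal u (σ.perm i)
    split_ifs <;> omega
  have := eq_sub_of_strictAnti (f := fun i =>
    if σ.neg i then -u.letterVal (σ.perm i) else u.letterVal (σ.perm i)) h1 h2 h3 (σ.perm.symm l)
  simp only [Equiv.apply_symm_apply] at this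
  have h4 : σ.letterVal l = if σ.neg (σ.perm.symm l) then -((N : ℤ) - (σ.perm.symm l : ℕ))
    else (N : ℤ) - (σ.perm.symm l : ℕ) := rfl
  rw [h4, ← this]
  split_ifs <;> simp

/-- If some s_i v loses an inversion of v that u does not have, it still contains those of u. If no
i does so, then for every i the one root that distinguishes s_i v from v has the same status in u as
in v. By `exists_root` this orders the letters of u as in v, and u = v. -/
theorem exists_descent {u v : SignedPerm N} (h : invSet u.letterVal ⊆ invSet v.letterVal)
    (hne : u ≠ v) : ∃ i, invSet u.letterVal ⊆ invSet (mul (simple i) v).letterVal ∧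
      (invSet v.letterVal).card = (invSet (mul (simple i) v).letterVal).card + 1 := by
  by_contra hcon
  push Not at hcon
  apply hne
  have key : ∀ i : Fin N, (∀ h : (i : ℕ) + 1 < N,
        (if v.neg ⟨i + 1, h⟩ then -u.letterVal (v.perm ⟨i + 1, h⟩)
          else u.letterVal (v.perm ⟨i + 1, h⟩)) <
        (if v.neg i then -u.letterVal (v.perm i) else u.letterVal (v.perm i))) ∧
      (¬ (i : ℕ) + 1 < N →
        0 < if v.neg i then -u.letterVal (v.perm i) else u.letterVal (v.perm i)) := fun i => by
    obtain ⟨r, hr1, hr2, hr3⟩ := exists_root v i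
    refine hr3 u ⟨fun hu => h hu, fun hv => ?_⟩
    by_contra hu
    have hr : r ∉ invSet (mul (simple i) v).letterVal := fun e => (hr2.1 e) hv
    refine hcon i (fun r' hr' => ?_) ?_
    · have hne : r' ≠ r := fun e => hu (e ▸ hr')
      exact (hr1 r' hne).2 (h hr')
    · have : invSet v.letterVal = insert r (invSet (mul (simple i) v).letterVal) := by
        ext r'
        by_cases e : r' = r
        · subst e; simp [hv]
        · simp [e, hr1 r' e]
      rw [this, card_insert_of_notMem hr]
  exact eq_of_agree v u (fun i hi => (key i).1 hi) (fun i hi => (key i).2 hi)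

theorem simple_mul_self (i : Fin N) (σ : SignedPerm N) :
    mul (simple i) (mul (simple i) σ) = σ := by
  rcases σ with ⟨p, ν⟩
  by_cases h : (i : ℕ) + 1 < N
  · simp only [mul, simple, h, dif_pos, SignedPerm.mk.injEq]
    constructor
    · ext; simp
    · funext; simp
  · simp only [mul, simple, h, dif_neg, not_false_eq_true, SignedPerm.mk.injEq]
    constructor
    · ext; simp
    · funext j; by_cases e : j = i <;> simp [e]

/-! ### The weak left order as inclusion of inversion sets. -/

/-- `wordMul w u` is the product of the word `w` with `u`. -/
def wordMul (w : List (Fin N)) (u : SignedPerm N) : SignedPerm N :=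
  w.foldr (fun i σ => mul (simple i) σ) u

theorem wordProd_append (w₁ w₂ : List (Fin N)) :
    wordProd (w₁ ++ w₂) = wordMul w₁ (wordProd w₂) := by
  simp [wordProd, wordMul]

theorem exists_word {u v : SignedPerm N} (h : invSet u.letterVal ⊆ invSet v.letterVal) :
    ∃ w, wordMul w u = v ∧ (invSet v.letterVal).card = w.length + (invSet u.letterVal).card := by
  induction hn : (invSet v.letterVal).card generalizing v with
  | zero =>
    by_cases e : u = v
    · exact ⟨[], e, by rw [e, hn]; simp⟩
    · obtain ⟨i, -, h2⟩ := exists_descent h e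
      omega
  | succ n ih =>
    by_cases e : u = v
    · exact ⟨[], e, by rw [e, hn]; simp⟩
    · obtain ⟨i, h1, h2⟩ := exists_descent h e
      obtain ⟨w, hw1, hw2⟩ := ih h1 (by omega)
      refine ⟨i :: w, ?_, by simp; omega⟩
      rw [wordMul, List.foldr_cons]
      change mul (simple i) (wordMul w u) = v
      rw [hw1, simple_mul_self]

theorem card_wordMul_le (w : List (Fin N)) (u : SignedPerm N) :
    (invSet (wordMul w u).letterVal).card ≤ w.length + (invSet u.letterVal).card := by
  induction w with
  | nil => simp [wordMul]
  | cons i w ih =>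
    have : wordMul (i :: w) u = mul (simple i) (wordMul w u) := rfl
    rw [this, List.length_cons]
    rcases card_invSet_simple (wordMul w u) i with h | h <;> omega

theorem invSet_subset_wordMul (w : List (Fin N)) (u : SignedPerm N)
    (h : (invSet (wordMul w u).letterVal).card = w.length + (invSet u.letterVal).card) :
    invSet u.letterVal ⊆ invSet (wordMul w u).letterVal := by
  induction w with
  | nil => exact Subset.rfl
  | cons i w ih =>
    have e : wordMul (i :: w) u = mul (simple i) (wordMul w u) := rfl
    rw [e, List.length_cons] at h
    rw [e]
    have := card_wordMul_le w u
    rcases card_invSet_simple (wordMul w u) i with h' | h'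
    · exact (ih (by omega)).trans h'.1
    · omega

/-- Each letter adds at most one inversion, and descending from σ to the identity with `exists_word`
produces a word in which each letter adds exactly one. -/
theorem isReducedWord_iff (w : List (Fin N)) (σ : SignedPerm N) :
    IsReducedWord w σ ↔ wordProd w = σ ∧ w.length = (invSet σ.letterVal).card := by
  have hle : ∀ w, (invSet (wordProd w : SignedPerm N).letterVal).card ≤ w.length := by
    intro w
    have := card_wordMul_le w (one : SignedPerm N)
    rwa [invSet_one, card_empty, add_zero] at this
  constructor
  · rintro ⟨h1, h2⟩
    refine ⟨h1, le_antisymm ?_ (h1 ▸ hle w)⟩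
    obtain ⟨w', hw1, hw2⟩ := exists_word (u := one) (v := σ) (by rw [invSet_one]; simp)
    rw [invSet_one, card_empty, add_zero] at hw2
    rw [hw2]
    exact h2 w' hw1
  · rintro ⟨h1, h2⟩
    refine ⟨h1, fun w' hw' => ?_⟩
    rw [h2, ← hw']
    exact hle w'

/-- When lengths add, each letter put in front adds an inversion and removes none, so a final
subword has a smaller inversion set. Conversely, the descent of `exists_word` from v to u is
prolonged by a reduced word for u. -/
theorem weakLeftGE_iff (v u : SignedPerm N) :
    WeakLeftGE v u ↔ invSet u.letterVal ⊆ invSet v.letterVal := by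
  constructor
  · rintro ⟨w₁, w₂, h1, h2⟩
    rw [isReducedWord_iff, wordProd_append, List.length_append] at h1
    rw [isReducedWord_iff] at h2
    rw [h2.1] at h1
    rw [← h1.1]
    apply invSet_subset_wordMul
    rw [h1.1, ← h1.2, h2.2]
  · intro h
    obtain ⟨w₁, h1, h2⟩ := exists_word h
    obtain ⟨w₂, h3, h4⟩ := exists_word (u := one) (v := u) (by rw [invSet_one]; simp)
    rw [invSet_one, card_empty, add_zero] at h4
    refine ⟨w₁, w₂, ?_, ?_⟩
    · rw [isReducedWord_iff, wordProd_append, List.length_append]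
      change wordMul w₁ (wordMul w₂ one) = v ∧ _
      rw [h3]
      exact ⟨h1, by omega⟩
    · rw [isReducedWord_iff]
      exact ⟨h3, by omega⟩

/-! ### The inversion statistic counts the inverted roots -/

/-- Converts a sum over pairs ordered by letters into one over pairs ordered by positions: for i <
j, at most one of `F i j` and `F j i` is present in the application. -/
theorem sum_lt_swap {F G : Fin N → Fin N → ℕ} (h0 : ∀ i, F i i = 0)
    (h : ∀ i j, i < j → F i j + F j i = G i j) :
    ∑ i, ∑ j, F i j = ∑ i, ∑ j, if i < j then G i j else 0 := by
  have h1 : ∑ i, ∑ j, F i j =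
      ∑ i, ∑ j, (if i < j then F i j else 0) + ∑ i, ∑ j, (if j < i then F i j else 0) := by
    rw [← sum_add_distrib]
    refine sum_congr rfl fun i _ => ?_
    rw [← sum_add_distrib]
    refine sum_congr rfl fun j _ => ?_
    rcases lt_trichotomy i j with hij | rfl | hij
    · rw [if_pos hij, if_neg hij.asymm, add_zero]
    · simp [h0]
    · rw [if_pos hij, if_neg hij.asymm, zero_add]
  rw [h1, sum_comm (f := fun i j => if j < i then F i j else 0), ← sum_add_distrib]
  refine sum_congr rfl fun i _ => ?_
  rw [← sum_add_distrib]
  refine sum_congr rfl fun j _ => ?_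
  split_ifs with hij
  · exact h i j hij
  · rfl

theorem card_invSet (x : Fin N → ℤ) : (invSet x).card =
    (∑ a, ∑ b, if a < b then (if x a < x b then 1 else 0) + (if x a + x b < 0 then 1 else 0)
      else 0) + ∑ a, if x a < 0 then 1 else 0 := by
  rw [invSet, card_filter, ← univ_product_univ, sum_product]
  simp only [Fintype.univ_bool, mem_singleton, Bool.true_eq_false, not_false_eq_true, sum_insert,
    sum_singleton]
  rw [← univ_product_univ, sum_product, sum_product, ← sum_add_distrib, ← sum_add_distrib]
  refine sum_congr rfl fun a _ => ?_
  have : (if x a < 0 then 1 else 0) = ∑ b, if a = b then (if x a < 0 then 1 else 0) else 0 := by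
    simp
  rw [this, ← sum_add_distrib, ← sum_add_distrib]
  refine sum_congr rfl fun b _ => ?_
  simp only [Inverted]
  rcases lt_trichotomy a b with h | rfl | h
  · simp [h, h.le, h.ne]; ring
  · have : x a + x a < 0 ↔ x a < 0 := by omega
    simp [this]
  · simp [h.not_gt, h.ne', h.not_ge]

/-- Here p belongs to the earlier position of the two, which is further from the end. The first
equation treats the case where it carries the smaller letter, the second the case where it carries
the larger one. -/
theorem pair_count {p r : ℤ} (hp : 0 < r) (hpr : r < p) (s t : Bool) :
    (if (if s then -p else p) < (if t then -r else r) then 1 else 0) +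
      (if (if s then -p else p) + (if t then -r else r) < 0 then 1 else 0) = (if s then 2 else 0) ∧
    (if (if t then -r else r) < (if s then -p else p) then 1 else 0) +
      (if (if t then -r else r) + (if s then -p else p) < 0 then 1 else 0) = 1 := by
  cases s <;> cases t <;> simp only [if_true, Bool.false_eq_true, if_false] <;>
    constructor <;> split_ifs <;> omega

/-- Take positions i < j. By `pair_count` they contribute 1 if the letter at i is larger in absolute
value than that at j, and otherwise 2 or 0 according to whether the letter at i is barred. The roots
e_a account for the barred letters themselves. -/
theorem inv_eq_card_invSet (σ : SignedPerm N) : σ.inv = (invSet σ.letterVal).card := by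
  have hv : ∀ i, σ.val i < 0 ↔ σ.neg i = true := by
    intro i; rw [val]; split_ifs with h <;> simp [h] <;> omega
  have ha : ∀ i, |σ.val i| = ((σ.perm i : ℕ) : ℤ) + 1 := by
    intro i; rw [val]; split_ifs
    · rw [abs_neg, abs_of_nonneg (by omega)]
    · rw [abs_of_nonneg (by omega)]
  have hs : ∀ i, 0 < -σ.val i → -σ.val i = ((σ.perm i : ℕ) : ℤ) + 1 := by
    intro i h; rw [← ha, abs_of_neg (by omega)]
  have h1 : (∑ a, ∑ b, if a < b then (if σ.letterVal a < σ.letterVal b then 1 else 0) +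
      (if σ.letterVal a + σ.letterVal b < 0 then 1 else 0) else 0) =
      ∑ i, ∑ j, if σ.perm i < σ.perm j then
        (if σ.letterVal (σ.perm i) < σ.letterVal (σ.perm j) then 1 else 0) +
        (if σ.letterVal (σ.perm i) + σ.letterVal (σ.perm j) < 0 then 1 else 0) else 0 := by
    rw [← Equiv.sum_comp σ.perm]
    refine sum_congr rfl fun i _ => ?_
    rw [← Equiv.sum_comp σ.perm]
  have h2 : (∑ a, if σ.letterVal a < 0 then 1 else 0) = ∑ i, if σ.val i < 0 then 1 else 0 := by
    rw [← Equiv.sum_comp σ.perm]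
    refine sum_congr rfl fun i _ => ?_
    rw [letterVal_perm]
    have := i.isLt
    simp only [hv]
    cases σ.neg i <;> simp
  rw [card_invSet, h1, h2, sum_lt_swap (G := fun i j => (if |σ.val i| > |σ.val j| then 1 else 0) +
    2 * (if 0 < -σ.val i ∧ -σ.val i < |σ.val j| then 1 else 0)) (by simp), inv, card_filter,
    card_filter, card_filter, ← univ_product_univ, sum_product, sum_product]
  · congr 1
    rw [mul_sum, ← sum_add_distrib]
    refine sum_congr rfl fun i _ => ?_
    rw [mul_sum, ← sum_add_distrib]
    refine sum_congr rfl fun j _ => ?_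
    by_cases h : i < j <;> simp [h]
  · intro i j hij
    have hne : (σ.perm i : ℕ) ≠ σ.perm j := fun e => hij.ne (σ.perm.injective (Fin.ext e))
    have hi := i.isLt
    have hj := j.isLt
    rw [Fin.lt_def] at hij
    have h3 : (0 < -σ.val i ∧ -σ.val i < |σ.val j|) ↔
        (σ.neg i = true ∧ (σ.perm i : ℕ) < σ.perm j) := by
      rw [← hv, ha]
      constructor
      · rintro ⟨e1, e2⟩
        rw [hs i e1] at e2
        exact ⟨by omega, by omega⟩
      · rintro ⟨e1, e2⟩
        rw [hs i (by omega)]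
        exact ⟨by omega, by omega⟩
    obtain ⟨e1, e2⟩ := pair_count (p := (N : ℤ) - (i : ℕ)) (r := (N : ℤ) - (j : ℕ)) (by omega)
      (by omega) (σ.neg i) (σ.neg j)
    simp only [h3]
    have h4 : ((σ.perm i : ℕ) : ℤ) + 1 > ((σ.perm j : ℕ) : ℤ) + 1 ↔ (σ.perm j : ℕ) < σ.perm i := by
      omega
    simp only [ha, h4, letterVal_perm, Fin.lt_def]
    rcases lt_or_gt_of_ne hne with h | h
    · rw [if_pos h, if_neg h.not_gt, e1]
      rw [if_neg h.not_gt]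
      cases σ.neg i
      · simp
      · rw [if_pos rfl, if_pos ⟨rfl, h⟩]
    · rw [if_neg h.not_gt, if_pos h, e2]
      rw [if_pos h, if_neg fun e => h.not_gt e.2]

end SignedPerm
end BallotTiling

namespace BallotTiling

open Finset

/-! ### The arrangement of the reference labelling -/

/-- The arrangement belonging to the modified post-order word of the reference labelling. -/
def refArr : PlaneTree EdgeMark → List ℤ
  | .nil => []
  | .cons a below right =>
      if a.dot then -((below.numEdges : ℤ) + 1) :: (refArr below ++ refArr right)
      else ((right.numEdges : ℤ) + 1) ::
        ((refArr below).map (· + ((right.numEdges : ℤ) + 1)) ++ refArr right)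

theorem length_refArr (T : PlaneTree EdgeMark) : (refArr T).length = T.numEdges := by
  induction T with
  | nil => rfl
  | cons a below right ih1 ih2 =>
    rw [refArr]
    split_ifs <;>
      simp only [List.length_cons, List.length_append, List.length_map, ih1, ih2,
        PlaneTree.numEdges] <;> omega

theorem refArr_pos {T : PlaneTree EdgeMark} (hT : IsUndotted T) : ∀ x ∈ refArr T, 0 < x := by
  induction T with
  | nil => simp [refArr]
  | cons a below right ih1 ih2 =>
    obtain ⟨ha, hF, hR⟩ := hT
    intro x hx
    simp only [refArr, ha, Bool.false_eq_true, if_false, List.mem_cons, List.mem_append,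
      List.mem_map] at hx
    rcases hx with rfl | ⟨y, hy, rfl⟩ | hx
    · omega
    · have := ih1 hF y hy; omega
    · exact ih2 hR x hx

theorem abs_refArr_le {T : PlaneTree EdgeMark} (hT : IsSpined T) :
    ∀ x ∈ refArr T, x ≠ 0 ∧ x ≤ T.numEdges ∧ -x ≤ T.numEdges := by
  induction T with
  | nil => simp [refArr]
  | cons a below right ih1 ih2 =>
    intro x hx
    rcases hT with ⟨ha, rfl, hF⟩ | ⟨ha, hF, hR⟩
    · simp only [refArr, ha, if_true, List.mem_cons, List.append_nil] at hx
      simp only [PlaneTree.numEdges]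
      rcases hx with rfl | hx
      · push_cast; omega
      · have := ih1 hF x hx; push_cast; omega
    · simp only [refArr, ha, Bool.false_eq_true, if_false, List.mem_cons, List.mem_append,
        List.mem_map] at hx
      simp only [PlaneTree.numEdges]
      rcases hx with rfl | ⟨y, hy, rfl⟩ | hx
      · push_cast; omega
      · have := ih1 hF.isSpined y hy
        have := refArr_pos hF y hy
        push_cast; omega
      · have := ih2 hR x hx; push_cast; omega

/-- Each inversion of the first components is an inversion of the second components. -/
def Dominated (l : List (ℤ × ℤ)) : Prop :=
  l.Pairwise (fun p p' => (p.1 < p'.1 → p.2 < p'.2) ∧ (p.1 + p'.1 < 0 → p.2 + p'.2 < 0)) ∧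
    ∀ p ∈ l, p.1 < 0 → p.2 < 0

theorem dominated_cons {p : ℤ × ℤ} {l : List (ℤ × ℤ)} : Dominated (p :: l) ↔
    (p.1 < 0 → p.2 < 0) ∧ (∀ p' ∈ l, (p.1 < p'.1 → p.2 < p'.2) ∧
      (p.1 + p'.1 < 0 → p.2 + p'.2 < 0)) ∧ Dominated l := by
  simp only [Dominated, List.pairwise_cons, List.forall_mem_cons]; tauto

theorem dominated_append {l l' : List (ℤ × ℤ)} : Dominated (l ++ l') ↔
    Dominated l ∧ Dominated l' ∧ ∀ p ∈ l, ∀ p' ∈ l', (p.1 < p'.1 → p.2 < p'.2) ∧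
      (p.1 + p'.1 < 0 → p.2 + p'.2 < 0) := by
  simp only [Dominated, List.pairwise_append, List.forall_mem_append]; tauto

/-- The first components stay positive, so they have no negative sums before or after the shift, and
their comparisons do not change. -/
theorem dominated_zip_map {c : ℤ} (hc : 0 ≤ c) {xs ys : List ℤ} (hpos : ∀ x ∈ xs, 0 < x) :
    Dominated ((xs.map (· + c)).zip ys) ↔ Dominated (xs.zip ys) := by
  induction xs generalizing ys with
  | nil => simp
  | cons x xs ih =>
    rcases ys with _ | ⟨y, ys⟩
    · simp
    · have hx := hpos x (by simp)
      have hxs : ∀ x ∈ xs, 0 < x := fun x h => hpos x (by simp [h])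
      rw [List.map_cons, List.zip_cons_cons, List.zip_cons_cons, dominated_cons, dominated_cons,
        ih hxs, List.zip_map_left]
      simp only [List.mem_map, forall_exists_index, and_imp, forall_apply_eq_imp_iff₂]
      have key : ∀ p ∈ xs.zip ys, (x + c < p.1 + c ↔ x < p.1) ∧
          ¬ (x + c + (p.1 + c) < 0) ∧ ¬ (x + p.1 < 0) := by
        rintro ⟨u, v⟩ hp
        have := hxs u (List.of_mem_zip hp).1
        simp only
        omega
      constructor
      · rintro ⟨-, h2, h3⟩
        refine ⟨by omega, fun p hp => ⟨fun h => (h2 p hp).1 ((key p hp).1.2 h),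
          fun h => absurd h (key p hp).2.2⟩, h3⟩
      · rintro ⟨-, h2, h3⟩
        refine ⟨by omega, fun p hp => ⟨fun h => (h2 p hp).1 ((key p hp).1.1 h),
          fun h => absurd h (key p hp).2.1⟩, h3⟩

theorem forall_mem_zip_snd {α β : Type*} {xs : List α} {ys : List β} (h : xs.length = ys.length)
    {P : β → Prop} : (∀ p ∈ xs.zip ys, P p.2) ↔ ∀ y ∈ ys, P y := by
  have : ys = (xs.zip ys).map Prod.snd := (List.map_snd_zip h.ge).symm
  conv_rhs => rw [this]
  simp only [List.forall_mem_map]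

/-- An arrangement has all inversions of the reference arrangement if and only if it is compatible
with the tree. -/
theorem dominated_refArr_iff {T : PlaneTree EdgeMark} (hT : IsSpined T) {xs : List ℤ}
    (hl : xs.length = T.numEdges) : Dominated ((refArr T).zip xs) ↔ Compatible T xs := by
  induction T generalizing xs with
  | nil =>
    rw [PlaneTree.numEdges, List.length_eq_zero_iff] at hl
    subst hl
    simp [Compatible, Dominated, refArr]
  | cons a F R ih1 ih2 =>
    simp only [PlaneTree.numEdges] at hl
    rcases xs with _ | ⟨x, ys⟩
    · simp only [List.length_nil] at hl; omega
    obtain ⟨fs, rs, rfl, hfs⟩ : ∃ fs rs, ys = fs ++ rs ∧ fs.length = F.numEdges :=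
      ⟨ys.take F.numEdges, ys.drop F.numEdges, by simp, by simp at hl ⊢; omega⟩
    have hrs : rs.length = R.numEdges := by simp at hl; omega
    have hcomp : Compatible (.cons a F R) (x :: (fs ++ rs)) ↔ Compatible F fs ∧ Compatible R rs ∧
        (∀ f ∈ fs, x < f) ∧ (a.dot = true → x < 0 ∧ ∀ f ∈ fs, x < -f) := by
      constructor
      · rintro ⟨x', fs', rs', e, h1, h2, h3⟩
        rw [List.cons_eq_cons] at e
        obtain ⟨rfl, e⟩ := e
        obtain ⟨rfl, rfl⟩ := List.append_inj e (hfs.trans h1.length.symm)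
        exact ⟨h1, h2, h3⟩
      · rintro ⟨h1, h2, h3⟩
        exact ⟨x, fs, rs, rfl, h1, h2, h3⟩
    rw [hcomp]
    rcases hT with ⟨ha, rfl, hF⟩ | ⟨ha, hF, hR⟩
    · rw [PlaneTree.numEdges, List.length_eq_zero_iff] at hrs
      subst hrs
      simp only [refArr, ha, if_true, List.append_nil, List.zip_cons_cons, dominated_cons,
        ih1 hF hfs, forall_const]
      have hlen : (refArr F).length = fs.length := by rw [length_refArr, hfs]
      -- The root entry -(|F| + 1) lies below every other entry and has a negative sum with each, so
      -- all roots involving it are inverted.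
      have hb : ∀ p ∈ (refArr F).zip fs, -((F.numEdges : ℤ) + 1) < p.1 ∧
          -((F.numEdges : ℤ) + 1) + p.1 < 0 := by
        rintro ⟨u, v⟩ hp
        have := abs_refArr_le hF u (List.of_mem_zip hp).1
        simp only; omega
      rw [← forall_mem_zip_snd hlen (P := fun f => x < f),
        ← forall_mem_zip_snd hlen (P := fun f => x < -f)]
      constructor
      · rintro ⟨h1, h2, h3⟩
        refine ⟨h3, rfl, fun p hp => (h2 p hp).1 (hb p hp).1, h1 (by omega), fun p hp => ?_⟩
        have := (h2 p hp).2 (hb p hp).2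
        omega
      · rintro ⟨h1, -, h2, h3, h4⟩
        refine ⟨fun _ => h3, fun p hp => ⟨fun _ => h2 p hp, fun _ => ?_⟩, h1⟩
        have := h4 p hp
        omega
    · have hlen : (refArr F).length = fs.length := by rw [length_refArr, hfs]
      have hlen' : (refArr R).length = rs.length := by rw [length_refArr, hrs]
      have hposF := refArr_pos hF
      have hR' := abs_refArr_le hR
      -- The root entry |R| + 1 lies below the shifted entries of `F` and exceeds all entries of `R`
      -- in absolute value. Hence it is inverted only with `F`, by ascents, and there are no
      -- inversions between `F` and `R`.
      simp only [refArr, ha, Bool.false_eq_true, if_false, List.zip_cons_cons, dominated_cons,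
        false_imp_iff, and_true]
      rw [List.zip_append (by simpa using hlen), dominated_append,
        dominated_zip_map (by omega) hposF, ih1 hF.isSpined hfs, ih2 hR hrs, List.zip_map_left]
      simp only [List.mem_append, List.mem_map]
      rw [← forall_mem_zip_snd hlen (P := fun f => x < f)]
      constructor
      · rintro ⟨-, h2, h3, h4, -⟩
        refine ⟨h3, h4, fun p hp => ?_⟩
        have := (h2 _ (Or.inl ⟨p, hp, rfl⟩)).1
        apply this
        have := hposF p.1 (List.of_mem_zip hp).1
        simp; omega
      · rintro ⟨h1, h2, h3⟩
        refine ⟨by omega, ?_, h1, h2, ?_⟩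
        · rintro p' (⟨p, hp, rfl⟩ | hp)
          · have := hposF p.1 (List.of_mem_zip hp).1
            refine ⟨fun _ => h3 p hp, fun h => ?_⟩
            simp at h; omega
          · have := hR' p'.1 (List.of_mem_zip hp).1
            constructor <;> intro h <;> omega
        · rintro _ ⟨p, hp, rfl⟩ p' hp'
          have := hposF p.1 (List.of_mem_zip hp).1
          have := hR' p'.1 (List.of_mem_zip hp').1
          constructor <;> intro h <;> simp at h <;> omega

theorem negSums_eq_zero {xs : List ℤ} (h : ∀ x ∈ xs, 0 < x) : negSums xs = 0 := by
  induction xs with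
  | nil => rfl
  | cons x xs ih =>
    have hx := h x (by simp)
    rw [negSums, ih fun y hy => h y (by simp [hy]), if_neg (by omega), List.countP_eq_zero.2]
    intro y hy
    have := h y (by simp [hy])
    simp only [decide_eq_true_eq]; omega

theorem negSums_append_of_pos {xs ys : List ℤ} (hxs : ∀ x ∈ xs, 0 < x)
    (h : ∀ x ∈ xs, ∀ y ∈ ys, 0 ≤ x + y) : negSums (xs ++ ys) = negSums ys := by
  induction xs with
  | nil => rfl
  | cons x xs ih =>
    have hx := hxs x (by simp)
    rw [List.cons_append, negSums, ih (fun y hy => hxs y (by simp [hy]))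
      (fun y hy => h y (by simp [hy])), if_neg (by omega), List.countP_eq_zero.2]
    · ring
    · intro y hy
      simp only [decide_eq_true_eq, not_lt]
      rcases List.mem_append.1 hy with hy | hy
      · have := hxs y (by simp [hy]); omega
      · exact h x (by simp) y hy

theorem arrInv_refArr {T : PlaneTree EdgeMark} (hT : IsSpined T) :
    arrInv (refArr T) = minInv T := by
  induction T with
  | nil => rfl
  | cons a F R ih1 ih2 =>
    rcases hT with ⟨ha, rfl, hF⟩ | ⟨ha, hF, hR⟩
    · have hb := abs_refArr_le hF
      have h1 := ih1 hF
      simp only [arrInv] at h1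
      simp only [refArr, ha, if_true, List.append_nil, minInv, arrInv, ascents, negSums]
      rw [List.countP_eq_length.2, List.countP_eq_length.2, length_refArr, if_pos (by omega)]
      · omega
      · intro x hx; have := hb x hx; simp only [decide_eq_true_eq]; omega
      · intro x hx; have := hb x hx; simp only [decide_eq_true_eq]; omega
    · have hp := refArr_pos hF
      have hb := abs_refArr_le hR
      have h1 := ih1 hF.isSpined
      have h2 := ih2 hR
      simp only [arrInv] at h1 h2
      rw [negSums_eq_zero hp] at h1
      simp only [refArr, ha, Bool.false_eq_true, if_false, minInv, arrInv]
      rw [← List.cons_append, negSums_append_of_pos, List.cons_append, ascents, ascents_append,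
        ascents_map (fun x _ y _ h => by simpa using h), List.countP_append,
        List.countP_eq_length.2, List.countP_eq_zero.2, List.sum_eq_zero, List.length_map,
        length_refArr]
      · omega
      · intro k hk
        obtain ⟨x, hx, rfl⟩ := List.mem_map.1 hk
        obtain ⟨y, hy, rfl⟩ := List.mem_map.1 hx
        rw [List.countP_eq_zero]
        intro z hz
        have := hp y hy
        have := hb z hz
        simp only [decide_eq_true_eq]; omega
      · intro z hz; have := hb z hz; simp only [decide_eq_true_eq]; omega
      · intro z hz
        obtain ⟨y, hy, rfl⟩ := List.mem_map.1 hz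
        have := hp y hy
        simp only [decide_eq_true_eq]; omega
      · intro x hx
        rcases List.mem_cons.1 hx with rfl | hx
        · omega
        · obtain ⟨y, hy, rfl⟩ := List.mem_map.1 hx
          have := hp y hy
          omega
      · intro x hx z hz
        have := hb z hz
        rcases List.mem_cons.1 hx with rfl | hx
        · omega
        · obtain ⟨y, hy, rfl⟩ := List.mem_map.1 hx
          have := hp y hy
          omega

/-! ### The word of the reference labelling -/

theorem length_postWord (T : PlaneTree EdgeMark) (k : ℕ) :
    (postWord (numberFrom k T)).length = T.numEdges := by
  induction T generalizing k with
  | nil => rfl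
  | cons a F R ih1 ih2 =>
    simp only [numberFrom, postWord]
    split_ifs <;>
      simp only [List.length_cons, List.length_append, List.length_nil, ih1, ih2,
        PlaneTree.numEdges, zero_add]

/-- The integers `n + c, …, c + 1`. -/
def descending (n : ℕ) (c : ℤ) : List ℤ := (List.range n).map fun i => (n : ℤ) - (i : ℕ) + c

theorem length_descending (n : ℕ) (c : ℤ) : (descending n c).length = n := by simp [descending]

theorem descending_add (m n : ℕ) (c : ℤ) :
    descending (m + n) c = descending m (n + c) ++ descending n c := by
  simp only [descending, List.range_add, List.map_append, List.map_map]
  congr 1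
  · refine List.map_congr_left fun i _ => ?_
    push_cast; ring
  · refine List.map_congr_left fun i _ => ?_
    simp only [Function.comp]; push_cast; ring

theorem descending_one (c : ℤ) : descending 1 c = [c + 1] := by
  simp [descending, add_comm]

/-- The letter and its value, from a signed letter and its distance from the end of the word. -/
def signedPair (p : ℤ × ℤ) : ℕ × ℤ := (p.1.natAbs, if p.1 < 0 then -p.2 else p.2)

/-- Post-order reads an undotted edge between what is below it and what is to its right, pre-order
reads it before both; the pairs of letter and value are the same. -/
theorem signedPair_zip_perm {p₁ p₂ d₁ d₂ u₁ u₂ : List ℤ} {r₁ r₂ : List ℕ} (k : ℕ) (v : ℤ)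
    (hp : p₁.length = d₁.length) (hr : r₁.length = u₁.length)
    (h₁ : ((p₁.zip d₁).map signedPair).Perm (r₁.zip u₁))
    (h₂ : ((p₂.zip d₂).map signedPair).Perm (r₂.zip u₂)) :
    (((p₁ ++ [(k : ℤ)] ++ p₂).zip (d₁ ++ [v] ++ d₂)).map signedPair).Perm
      ((k :: (r₁ ++ r₂)).zip (v :: (u₁ ++ u₂))) := by
  rw [List.append_assoc, List.append_assoc, List.zip_append hp, List.zip_cons_cons,
    List.zip_append hr, List.singleton_append, List.singleton_append, List.zip_cons_cons,
    List.map_append, List.map_cons]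
  have e : signedPair ((k : ℤ), v) = (k, v) := by simp [signedPair]
  rw [e]
  exact List.perm_middle.trans ((h₁.append h₂).cons _)

theorem range'_add_one_add (k m n : ℕ) : List.range' k (m + 1 + n) =
    k :: (List.range' (k + 1) m ++ List.range' (k + 1 + m) n) := by
  rw [show m + 1 + n = (m + n) + 1 by ring, List.range'_succ, ← List.range'_append_1]

theorem descending_add_one_add (m n : ℕ) (c : ℤ) : descending (m + 1 + n) c =
    descending m ((n : ℤ) + 1 + c) ++ [(n : ℤ) + 1 + c] ++ descending n c := by
  rw [descending_add, descending_add, descending_one,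
    show ((1 : ℕ) : ℤ) + ((n : ℤ) + c) = (n : ℤ) + 1 + c by push_cast; ring,
    show (n : ℤ) + c + 1 = (n : ℤ) + 1 + c by ring]

/-- The constant c accounts for the letters that follow the word of `T`, which increase all
distances from the end. -/
theorem postWord_perm_of_undotted {T : PlaneTree EdgeMark} (hT : IsUndotted T) {k : ℕ}
    (hk : 0 < k) (c : ℤ) :
    (((postWord (numberFrom k T)).zip (descending T.numEdges c)).map signedPair).Perm
      ((List.range' k T.numEdges).zip ((refArr T).map (· + c))) := by
  induction T generalizing k c with
  | nil => simp [numberFrom, postWord, PlaneTree.numEdges]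
  | cons a F R ih1 ih2 =>
    obtain ⟨ha, hF, hR⟩ := hT
    have i1 := ih1 hF (k := k + 1) (by omega) ((R.numEdges : ℤ) + 1 + c)
    have i2 := ih2 hR (k := k + 1 + F.numEdges) (by omega) c
    have e3 : ((fun x => x + c) ∘ fun x => x + ((R.numEdges : ℤ) + 1)) =
        (fun x => x + ((R.numEdges : ℤ) + 1 + c)) := by
      funext x; simp only [Function.comp]; ring
    simp only [numberFrom, postWord, ha, Bool.false_eq_true, if_false, PlaneTree.numEdges, refArr]
    rw [descending_add_one_add, range'_add_one_add, List.map_cons, List.map_append, List.map_map,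
      e3]
    exact signedPair_zip_perm k _ (by rw [length_postWord, length_descending])
      (by simp [length_refArr]) i1 i2

/-- Explains `refArr`: it lists, by letter, the signed distances from the end of the post-order
word. A dotted edge is read first and has distance |F| + 1. An undotted edge is followed only by the
|R| letters to its right, and the letters of `F` are followed by these and by the edge itself,
whence the shift by |R| + 1. -/
theorem postWord_perm {T : PlaneTree EdgeMark} (hT : IsSpined T) {k : ℕ} (hk : 0 < k) :
    (((postWord (numberFrom k T)).zip (descending T.numEdges 0)).map signedPair).Perm
      ((List.range' k T.numEdges).zip (refArr T)) := by
  induction T generalizing k with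
  | nil => simp [numberFrom, postWord, PlaneTree.numEdges]
  | cons a F R ih1 ih2 =>
    rcases hT with ⟨ha, rfl, hF⟩ | ⟨ha, hF, hR⟩
    · have i1 := ih1 hF (k := k + 1) (by omega)
      have e1 : descending (F.numEdges + 1) 0 =
          ((F.numEdges : ℤ) + 1) :: descending F.numEdges 0 := by
        rw [add_comm, descending_add, descending_one]
        simp
      simp only [numberFrom, postWord, ha, if_true, PlaneTree.numEdges, refArr, List.append_nil,
        add_zero]
      rw [e1, List.zip_cons_cons, List.map_cons, List.range'_succ, List.zip_cons_cons]
      have e2 : signedPair (-(k : ℤ), (F.numEdges : ℤ) + 1) = (k, -((F.numEdges : ℤ) + 1)) := by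
        simp [signedPair, hk]
      rw [e2]
      exact i1.cons _
    · have i1 := postWord_perm_of_undotted hF (k := k + 1) (by omega) ((R.numEdges : ℤ) + 1)
      have i2 := ih2 hR (k := k + 1 + F.numEdges) (by omega)
      simp only [numberFrom, postWord, ha, Bool.false_eq_true, if_false, PlaneTree.numEdges,
        refArr]
      rw [descending_add_one_add, range'_add_one_add, add_zero]
      exact signedPair_zip_perm k _ (by rw [length_postWord, length_descending])
        (by simp [length_refArr]) i1 i2

theorem eq_numberFrom_of_preWord (L : PlaneTree (EdgeMark × ℕ)) (k : ℕ)
    (h : preWord L = List.range' k (L.map Prod.fst).numEdges) :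
    L = numberFrom k (L.map Prod.fst) := by
  have hlen : ∀ L : PlaneTree (EdgeMark × ℕ), (preWord L).length = (L.map Prod.fst).numEdges := by
    intro L
    induction L with
    | nil => rfl
    | cons a F R ih1 ih2 =>
      simp only [preWord, List.length_map] at ih1 ih2
      simp only [preWord, PlaneTree.preOrder, List.length_map, List.length_cons,
        List.length_append, ih1, ih2, PlaneTree.map, PlaneTree.numEdges]
      omega
  induction L generalizing k with
  | nil => rfl
  | cons a F R ih1 ih2 =>
    have h1 : preWord (.cons a F R) = a.2 :: (preWord F ++ preWord R) := by
      simp [preWord, PlaneTree.preOrder]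
    simp only [PlaneTree.map, PlaneTree.numEdges] at h ⊢
    rw [h1, show (F.map Prod.fst).numEdges + 1 + (R.map Prod.fst).numEdges =
      ((F.map Prod.fst).numEdges + (R.map Prod.fst).numEdges) + 1 by ring,
      List.range'_succ, ← List.range'_append_1, List.cons_eq_cons] at h
    obtain ⟨ha, h2⟩ := h
    obtain ⟨h3, h4⟩ := List.append_inj h2 (by rw [hlen]; simp)
    rw [numberFrom, ← ih1 _ h3, ← ih2 _ h4, ← ha]

/-! ### Signed permutations as arrangements -/

theorem countP_ofFn {n : ℕ} (f : Fin n → ℤ) (P : ℤ → Prop) [DecidablePred P] :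
    (List.ofFn f).countP (fun y => P y) = ∑ i, if P (f i) then 1 else 0 := by
  induction n with
  | zero => simp
  | succ n ih =>
    rw [List.ofFn_succ, List.countP_cons, Fin.sum_univ_succ, ih, add_comm]
    simp

theorem arrInv_ofFn {n : ℕ} (x : Fin n → ℤ) : arrInv (List.ofFn x) = (invSet x).card := by
  rw [SignedPerm.card_invSet]
  induction n with
  | zero => simp [arrInv, ascents, negSums]
  | succ n ih =>
    have h := ih fun i => x i.succ
    rw [arrInv] at h
    rw [List.ofFn_succ, arrInv, ascents, negSums, countP_ofFn, countP_ofFn]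
    simp only [Fin.sum_univ_succ, if_false, Fin.succ_pos, if_true,
      Fin.not_lt_zero, Fin.succ_lt_succ_iff, zero_add, sum_add_distrib] at h ⊢
    omega

theorem zip_ofFn {α β : Type*} {n : ℕ} (f : Fin n → α) (g : Fin n → β) :
    (List.ofFn f).zip (List.ofFn g) = List.ofFn fun i => (f i, g i) := by
  apply List.ext_getElem
  · simp
  · intro i h1 h2; simp

theorem invSet_subset_iff {n : ℕ} (x y : Fin n → ℤ) :
    invSet x ⊆ invSet y ↔ Dominated ((List.ofFn x).zip (List.ofFn y)) := by
  rw [zip_ofFn, Dominated, List.pairwise_ofFn, List.forall_mem_ofFn_iff]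
  constructor
  · intro h
    refine ⟨fun i j hij => ⟨fun hx => ?_, fun hx => ?_⟩, fun i hx => ?_⟩
    · have := h (SignedPerm.mem_invSet (β := false) (a := i) (b := j).2 (Or.inr ⟨rfl, hij, hx⟩))
      simpa [SignedPerm.mem_invSet, Fin.lt_def.1 hij] using this
    · have := h (SignedPerm.mem_invSet (β := true) (a := i) (b := j).2
        (Or.inl ⟨rfl, (Fin.lt_def.1 hij).le, hx⟩))
      simpa [SignedPerm.mem_invSet, (Fin.lt_def.1 hij).le, hij.le] using this
    · have := h (SignedPerm.mem_invSet (β := true) (a := i) (b := i).2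
        (Or.inl ⟨rfl, le_rfl, by simp only at hx; omega⟩))
      simp [SignedPerm.mem_invSet] at this
      simp only; omega
  · rintro ⟨h1, h2⟩ ⟨β, a, b⟩ h
    rw [SignedPerm.mem_invSet] at h ⊢
    rcases h with ⟨rfl, hab, h⟩ | ⟨rfl, hab, h⟩
    · refine Or.inl ⟨rfl, hab, ?_⟩
      rcases hab.lt_or_eq with hlt | he
      · exact (h1 hlt).2 h
      · obtain rfl := Fin.ext he
        have := h2 a (by simp only; omega)
        simp only at this; omega
    · exact Or.inr ⟨rfl, hab, (h1 hab).1 h⟩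

namespace SignedPerm

variable {N : ℕ}

theorem ofFn_letterVal_mem (σ : SignedPerm N) :
    List.ofFn σ.letterVal ∈ arrangements N (Icc 1 N) := by
  rw [mem_arrangements (by simp), List.map_ofFn]
  have hnd : (List.ofFn (Int.natAbs ∘ σ.letterVal)).Nodup :=
    List.nodup_ofFn.2 σ.natAbs_letterVal_injective
  have : (List.ofFn (Int.natAbs ∘ σ.letterVal)).toFinset = Icc 1 N := by
    apply eq_of_subset_of_card_le
    · intro v hv
      simp only [List.mem_toFinset, List.mem_ofFn, Function.comp] at hv
      obtain ⟨l, rfl⟩ := hv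
      rw [natAbs_letterVal, mem_Icc]
      have := (σ.perm.symm l).isLt
      omega
    · rw [List.toFinset_card_of_nodup hnd]; simp
  rw [← this, List.toFinset_val, hnd.dedup]

theorem exists_ofFn_letterVal {xs : List ℤ} (h : xs ∈ arrangements N (Icc 1 N)) :
    ∃ σ : SignedPerm N, List.ofFn σ.letterVal = xs := by
  rw [mem_arrangements (by simp)] at h
  have hlen : xs.length = N := by
    have := congrArg Multiset.card h
    simpa using this
  have hnd : (xs.map Int.natAbs).Nodup := by
    rw [← Multiset.coe_nodup, h]; exact (Icc 1 N).nodup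
  have hmem : ∀ x ∈ xs, 1 ≤ x.natAbs ∧ x.natAbs ≤ N := by
    intro x hx
    rw [← mem_Icc, ← mem_val, ← h, Multiset.mem_coe]
    exact List.mem_map_of_mem hx
  let x : Fin N → ℤ := fun l => xs[l]
  have hx : ∀ l, 1 ≤ (x l).natAbs ∧ (x l).natAbs ≤ N := fun l => hmem _ (List.getElem_mem _)
  -- A letter whose value has absolute value v stands v places from the end.
  let pos : Fin N → Fin N := fun l => ⟨N - (x l).natAbs, by have := hx l; omega⟩
  have hinj : Function.Injective pos := by
    intro a b hab
    have h1 := congrArg Fin.val hab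
    simp only [pos] at h1
    have h2 := hx a
    have h3 := hx b
    have h4 : (xs.map Int.natAbs)[(a : ℕ)]'(by simp [hlen]) =
        (xs.map Int.natAbs)[(b : ℕ)]'(by simp [hlen]) := by
      simp only [List.getElem_map]
      change (x a).natAbs = (x b).natAbs
      omega
    exact Fin.ext ((hnd.getElem_inj_iff).1 h4)
  let e : Fin N ≃ Fin N := Equiv.ofBijective pos (Finite.injective_iff_bijective.1 hinj)
  refine ⟨⟨e.symm, fun i => decide (x (e.symm i) < 0)⟩, ?_⟩
  apply List.ext_getElem
  · simp [hlen]
  · intro i h1 h2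
    rw [List.getElem_ofFn]
    have hi : i < N := by simpa using h1
    have h3 := hx ⟨i, hi⟩
    have h4 : ((e ⟨i, hi⟩ : Fin N) : ℕ) = N - (x ⟨i, hi⟩).natAbs := rfl
    change letterVal _ _ = x ⟨i, hi⟩
    simp only [letterVal, Equiv.symm_symm, Equiv.symm_apply_apply, decide_eq_true_eq, h4]
    split_ifs <;> omega

/-- A signed word whose letters and their positions match the reference arrangement is the one-line
notation of a signed permutation with that arrangement. -/
theorem exists_oneLine_eq {w xs : List ℤ} (hw : w.length = N) (hxs : xs.length = N)
    (h : ((w.zip (descending N 0)).map signedPair).Perm ((List.range' 1 N).zip xs)) :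
    ∃ σ : SignedPerm N, σ.oneLine = w ∧ List.ofFn σ.letterVal = xs := by
  have hperm : (w.map Int.natAbs).Perm (List.range' 1 N) := by
    have := h.map Prod.fst
    rw [List.map_map, List.map_fst_zip (by simp [hxs])] at this
    have e : Prod.fst ∘ signedPair = Int.natAbs ∘ Prod.fst := rfl
    rw [e, ← List.map_map, List.map_fst_zip (by simp [hw, length_descending])] at this
    exact this
  have hnd : (w.map Int.natAbs).Nodup := hperm.nodup_iff.2 List.nodup_range'
  have hmem : ∀ z ∈ w, 1 ≤ z.natAbs ∧ z.natAbs ≤ N := by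
    intro z hz
    have := hperm.mem_iff.1 (List.mem_map_of_mem (f := Int.natAbs) hz)
    rw [List.mem_range'_1] at this
    omega
  let z : Fin N → ℤ := fun i => w[i]
  have hz : ∀ i, 1 ≤ (z i).natAbs ∧ (z i).natAbs ≤ N := fun i => hmem _ (List.getElem_mem _)
  let p : Fin N → Fin N := fun i => ⟨(z i).natAbs - 1, by have := hz i; omega⟩
  have hinj : Function.Injective p := by
    intro a b hab
    have h1 := congrArg Fin.val hab
    simp only [p] at h1
    have h2 := hz a
    have h3 := hz b
    have h4 : (w.map Int.natAbs)[(a : ℕ)]'(by simp [hw]) =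
        (w.map Int.natAbs)[(b : ℕ)]'(by simp [hw]) := by
      simp only [List.getElem_map]
      change (z a).natAbs = (z b).natAbs
      omega
    exact Fin.ext ((hnd.getElem_inj_iff).1 h4)
  let σ : SignedPerm N := ⟨Equiv.ofBijective p (Finite.injective_iff_bijective.1 hinj),
    fun i => decide (z i < 0)⟩
  have hσp : ∀ i, ((σ.perm i : Fin N) : ℕ) = (z i).natAbs - 1 := fun i => rfl
  refine ⟨σ, ?_, ?_⟩
  · apply List.ext_getElem
    · simp [oneLine, hw]
    · intro i h1 h2
      have hi : i < N := by simpa [oneLine] using h1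
      have h3 := hz ⟨i, hi⟩
      have h4 := hσp ⟨i, hi⟩
      simp only [oneLine, List.getElem_ofFn]
      change σ.val ⟨i, hi⟩ = z ⟨i, hi⟩
      simp only [val, h4]
      change (if decide (z ⟨i, hi⟩ < 0) = true then _ else _) = _
      simp only [decide_eq_true_eq]
      split_ifs <;> omega
  · apply List.ext_getElem
    · simp [hxs]
    · intro l h1 h2
      have hl : l < N := by simpa using h1
      have hin : (l + 1, xs[l]) ∈ (List.range' 1 N).zip xs := by
        rw [List.mem_iff_getElem]
        refine ⟨l, by simp [hl, hxs], ?_⟩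
        simp [add_comm]
      rw [← h.mem_iff, List.mem_map] at hin
      obtain ⟨q, hq, e⟩ := hin
      obtain ⟨i, hi, rfl⟩ := List.mem_iff_getElem.1 hq
      have hiN : i < N := by simp [hw] at hi; omega
      simp only [List.getElem_zip, signedPair, Prod.mk.injEq, descending, List.getElem_map,
        List.getElem_range, add_zero] at e
      have h3 : σ.perm ⟨i, hiN⟩ = ⟨l, hl⟩ := by
        apply Fin.ext
        rw [hσp]
        change (w[i]).natAbs - 1 = l
        omega
      rw [List.getElem_ofFn]
      change σ.letterVal ⟨l, hl⟩ = _
      rw [← h3, letterVal_perm, ← e.2]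
      change (if decide (w[i] < 0) = true then _ else _) = _
      simp

end SignedPerm

open Classical in
/-- The side of the weak order: the generating function of the upper interval of the reference
permutation is given by the hook formula. -/
theorem exists_reference_perm {A : Type*} [CommRing A] (q : A)
    (hreg : ∀ n, IsRegular (qInt q (n + 1))) (hq : IsRegular q) {T : PlaneTree EdgeMark}
    (hT : IsSpined T) :
    ∃ σ₀ : SignedPerm T.numEdges, σ₀.oneLine = postWord (numberFrom 1 T) ∧
      (∀ σ, SignedPerm.WeakLeftGE σ σ₀ → σ₀.inv ≤ σ.inv) ∧
      hookProd q T * ∑ σ ∈ univ.filter (fun σ => SignedPerm.WeakLeftGE σ σ₀),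
        q ^ (σ.inv - σ₀.inv) = ∏ i ∈ range T.numEdges, qInt q (2 * (i + 1)) := by
  obtain ⟨σ₀, h1, h2⟩ := SignedPerm.exists_oneLine_eq (N := T.numEdges)
    (length_postWord T 1) (length_refArr T) (postWord_perm hT one_pos)
  have hle : ∀ σ, SignedPerm.WeakLeftGE σ σ₀ → σ₀.inv ≤ σ.inv := by
    intro σ h
    rw [SignedPerm.inv_eq_card_invSet, SignedPerm.inv_eq_card_invSet]
    exact card_le_card ((SignedPerm.weakLeftGE_iff _ _).1 h)
  refine ⟨σ₀, h1, hle, ?_⟩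
  have h0 : σ₀.inv = minInv T := by
    rw [SignedPerm.inv_eq_card_invSet, ← arrInv_ofFn, h2, arrInv_refArr hT]
  -- The hook formula counts all inversions, while the sum is normalised by those of the reference
  -- permutation, of which there are `minInv T`.
  apply (hq.pow (minInv T)).left
  simp only
  rw [← hookProd_mul_arrSum q T hT (W := Icc 1 T.numEdges) (by simp) (by simp) hreg,
    mul_left_comm, mul_sum, arrSum]
  congr 1
  have hge : ∀ σ, SignedPerm.WeakLeftGE σ σ₀ ↔ Compatible T (List.ofFn σ.letterVal) := by
    intro σ
    rw [SignedPerm.weakLeftGE_iff, invSet_subset_iff, h2, dominated_refArr_iff hT (by simp)]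
  refine sum_bij (fun σ _ => List.ofFn σ.letterVal) ?_ ?_ ?_ ?_
  · intro σ hσ
    rw [mem_filter] at hσ ⊢
    exact ⟨σ.ofFn_letterVal_mem, (hge σ).1 hσ.2⟩
  · intro σ _ τ _ e
    exact SignedPerm.letterVal_injective (List.ofFn_injective e)
  · intro xs hxs
    rw [mem_filter] at hxs
    obtain ⟨σ, rfl⟩ := SignedPerm.exists_ofFn_letterVal hxs.1
    exact ⟨σ, mem_filter.2 ⟨mem_univ _, (hge σ).2 hxs.2⟩, rfl⟩
  · intro σ hσ
    rw [mem_filter] at hσ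
    rw [arrInv_ofFn, ← SignedPerm.inv_eq_card_invSet, ← pow_add, ← h0,
      Nat.add_sub_cancel' (hle σ hσ.2)]

end BallotTiling

namespace BallotTiling

open Finset

/-! ### Layered configurations

The boxes in column `x` of a skew shape are numbered `1, …, c x` from below. A cover-inclusive
tiling joins, in the layers `1, …, L x`, the boxes of the columns `x - 1` and `x`. -/

/-- The height function `h` follows, from abscissa `o` on, the word of the tree. -/
def FollowsWord (h : ℕ → ℤ) : PlaneTree EdgeMark → ℕ → Prop
  | .nil, _ => True
  | .cons a F R, o =>
      if a.dot then h (o + 1) = h o + 1 ∧ h (o + 2) = h (o + 1) + 1 ∧ FollowsWord h F (o + 2)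
      else h (o + 1) = h o + 1 ∧ FollowsWord h F (o + 1) ∧
        h (o + 1 + 2 * F.numEdges + 1) = h (o + 1 + 2 * F.numEdges) - 1 ∧
        FollowsWord h R (o + 1 + 2 * F.numEdges + 1)

/-- A chord returns to its initial height and a dotted edge climbs by two, so the path stays above
its start and its total rise is even. This parity is what excludes ballot tiles at the first step of
a pair. -/
theorem FollowsWord.le {h : ℕ → ℤ} {T : PlaneTree EdgeMark} (hT : IsSpined T) {o : ℕ}
    (hh : FollowsWord h T o) : (∀ i, o ≤ i → i ≤ o + 2 * T.numEdges → h o ≤ h i) ∧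
      Even (h (o + 2 * T.numEdges) - h o) ∧
      (IsUndotted T → h (o + 2 * T.numEdges) = h o) := by
  induction T generalizing o with
  | nil =>
    simp only [PlaneTree.numEdges, mul_zero, add_zero]
    refine ⟨fun i h1 h2 => ?_, by simp, by simp⟩
    rw [le_antisymm h1 h2]
  | cons a F R ih1 ih2 =>
    rcases hT with ⟨ha, rfl, hF⟩ | ⟨ha, hF, hR⟩
    · simp only [FollowsWord, ha, if_true] at hh
      obtain ⟨h1, h2, h3⟩ := hh
      obtain ⟨k1, k2, -⟩ := ih1 hF h3
      simp only [PlaneTree.numEdges, add_zero]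
      have e : o + 2 * (F.numEdges + 1) = o + 2 + 2 * F.numEdges := by ring
      rw [e]
      refine ⟨fun i hi1 hi2 => ?_, ?_, fun hu => ?_⟩
      · rcases lt_or_ge i (o + 2) with hlt | hge
        · obtain rfl | rfl : i = o ∨ i = o + 1 := by omega
          · rfl
          · omega
        · have := k1 i hge hi2; omega
      · obtain ⟨r, hr⟩ := k2
        exact ⟨r + 1, by omega⟩
      · simp [IsUndotted, ha] at hu
    · simp only [FollowsWord, ha, Bool.false_eq_true, if_false] at hh
      obtain ⟨h1, h2, h3, h4⟩ := hh
      obtain ⟨k1, -, k3⟩ := ih1 hF.isSpined h2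
      obtain ⟨m1, m2, m3⟩ := ih2 hR h4
      have k3 := k3 hF
      simp only [PlaneTree.numEdges]
      have e : o + 2 * (F.numEdges + 1 + R.numEdges) =
        o + 1 + 2 * F.numEdges + 1 + 2 * R.numEdges := by ring
      rw [e]
      refine ⟨fun i hi1 hi2 => ?_, ?_, fun hu => ?_⟩
      · rcases lt_or_ge i (o + 1) with hlt | hge
        · obtain rfl : i = o := by omega
          rfl
        · rcases lt_or_ge i (o + 1 + 2 * F.numEdges + 1) with hlt' | hge'
          · have := k1 i hge (by omega); omega
          · have := m1 i hge' hi2; omega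
      · obtain ⟨r, hr⟩ := m2
        exact ⟨r, by omega⟩
      · have := m3 hu.2.2
        omega

/-- `c` and `L` are compatible with each other and with the height function `h` of a path of
length `N`. -/
structure Layered (h : ℕ → ℤ) (N : ℕ) (c L : ℕ → ℕ) : Prop where
  c_zero : c 0 = 0
  c_top : ∀ x, N < x → c x = 0
  le : ∀ x, L x ≤ c x
  le_pred : ∀ x, L (x + 1) ≤ c x
  up : ∀ x < N, h (x + 1) = h x + 1 → c (x + 1) = c x ∨ c (x + 1) + 1 = c x
  down : ∀ x < N, h (x + 1) = h x - 1 → c (x + 1) = c x ∨ c (x + 1) = c x + 1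

/-- In layer `k`, the boxes of the columns `s, …, e` form a tile. -/
def IsRun (c L : ℕ → ℕ) (s e k : ℕ) : Prop :=
  s ≤ e ∧ k ≤ c s ∧ L s < k ∧ (∀ i ∈ Ioc s e, k ≤ L i) ∧ L (e + 1) < k

instance (c L : ℕ → ℕ) (s e k : ℕ) : Decidable (IsRun c L s e k) := by
  unfold IsRun; infer_instance

theorem IsRun.unique {c L : ℕ → ℕ} {s e s' e' k x : ℕ} (h : IsRun c L s e k)
    (h' : IsRun c L s' e' k) (h1 : s ≤ x) (h2 : x ≤ e) (h1' : s' ≤ x) (h2' : x ≤ e') :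
    s = s' ∧ e = e' := by
  obtain ⟨-, -, a1, a2, a3⟩ := h
  obtain ⟨-, -, b1, b2, b3⟩ := h'
  constructor
  · rcases lt_trichotomy s s' with hlt | he | hlt
    · have := a2 s' (mem_Ioc.2 ⟨hlt, by omega⟩); omega
    · exact he
    · have := b2 s (mem_Ioc.2 ⟨hlt, by omega⟩); omega
  · rcases lt_trichotomy e e' with hlt | he | hlt
    · have := b2 (e + 1) (mem_Ioc.2 ⟨by omega, by omega⟩); omega
    · exact he
    · have := a2 (e' + 1) (mem_Ioc.2 ⟨by omega, by omega⟩); omega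

namespace Layered

variable {h : ℕ → ℤ} {N : ℕ} {c L : ℕ → ℕ}

theorem L_zero (hl : Layered h N c L) : L 0 = 0 := by
  have := hl.le 0; have := hl.c_zero; omega

theorem L_top (hl : Layered h N c L) {x : ℕ} (hx : N < x) : L x = 0 := by
  have := hl.le x; have := hl.c_top x hx; omega

theorem exists_run (hl : Layered h N c L) {x k : ℕ} (hk : 1 ≤ k) (hx : k ≤ c x) :
    ∃ s e, IsRun c L s e k ∧ s ≤ x ∧ x ≤ e := by
  have hxN : x ≤ N := by
    by_contra hlt
    have := hl.c_top x (by omega); omega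
  have left : ∀ y, k ≤ c y → ∃ s ≤ y, k ≤ c s ∧ L s < k ∧ ∀ i ∈ Ioc s y, k ≤ L i := by
    intro y
    induction y with
    | zero =>
      intro hy
      have := hl.c_zero; omega
    | succ y ih =>
      intro hy
      rcases lt_or_ge (L (y + 1)) k with hlt | hge
      · exact ⟨y + 1, le_rfl, hy, hlt, by simp⟩
      · obtain ⟨s, h1, h2, h3, h4⟩ := ih (hge.trans (hl.le_pred y))
        refine ⟨s, by omega, h2, h3, fun i hi => ?_⟩
        rw [mem_Ioc] at hi
        rcases lt_or_ge y i with hlt | hge'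
        · rwa [show i = y + 1 by omega]
        · exact h4 i (mem_Ioc.2 ⟨hi.1, hge'⟩)
  -- Here d bounds the length of the search to the right. For d = N the search has certainly
  -- stopped, because `L` vanishes beyond N.
  have right : ∀ d, ∃ e, x ≤ e ∧ (∀ i ∈ Ioc x e, k ≤ L i) ∧ (L (e + 1) < k ∨ x + d ≤ e) := by
    intro d
    induction d with
    | zero => exact ⟨x, le_rfl, by simp, Or.inr le_rfl⟩
    | succ d ih =>
      obtain ⟨e, h1, h2, h3⟩ := ih
      rcases lt_or_ge (L (e + 1)) k with hlt | hge
      · exact ⟨e, h1, h2, Or.inl hlt⟩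
      · refine ⟨e + 1, by omega, fun i hi => ?_, Or.inr (by omega)⟩
        rw [mem_Ioc] at hi
        rcases lt_or_ge e i with hlt | hge'
        · rwa [show i = e + 1 by omega]
        · exact h2 i (mem_Ioc.2 ⟨hi.1, hge'⟩)
  obtain ⟨s, h1, h2, h3, h4⟩ := left x hx
  obtain ⟨e, h5, h6, h7⟩ := right N
  refine ⟨s, e, ⟨by omega, h2, h3, fun i hi => ?_, ?_⟩, h1, h5⟩
  · rw [mem_Ioc] at hi
    rcases lt_or_ge x i with hlt | hge'
    · exact h6 i (mem_Ioc.2 ⟨hlt, hi.2⟩)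
    · exact h4 i (mem_Ioc.2 ⟨hi.1, hge'⟩)
  · rcases h7 with h7 | h7
    · exact h7
    · rw [hl.L_top (by omega)]; omega

theorem exists_run_of_le (hl : Layered h N c L) {i k : ℕ} (hk : 1 ≤ k) (hi : k ≤ L (i + 1)) :
    ∃ s e, IsRun c L s e k ∧ s ≤ i ∧ i < e := by
  obtain ⟨s, e, hr, h1, h2⟩ := hl.exists_run hk (hi.trans (hl.le_pred i))
  refine ⟨s, e, hr, h1, ?_⟩
  rcases h2.lt_or_eq with hlt | rfl
  · exact hlt
  · have := hr.2.2.2.2; omega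

theorem run_end_le (hl : Layered h N c L) {s e k : ℕ} (hr : IsRun c L s e k) :
    1 ≤ s ∧ e ≤ N ∧ 1 ≤ k := by
  obtain ⟨h1, h2, h3, h4, -⟩ := hr
  refine ⟨?_, ?_, by omega⟩
  · rcases Nat.eq_zero_or_pos s with rfl | hs
    · have := hl.c_zero; omega
    · exact hs
  · by_contra hlt
    rcases h1.lt_or_eq with h1 | rfl
    · have := h4 e (mem_Ioc.2 ⟨h1, le_rfl⟩)
      have := hl.L_top (x := e) (by omega)
      omega
    · have := hl.c_top s (by omega); omega

end Layered

/-- The tiles are ballot tiles satisfying the conditions of type BI. -/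
structure HasBallotRuns (h : ℕ → ℤ) (N : ℕ) (c L : ℕ → ℕ) : Prop where
  le : ∀ s e k, IsRun c L s e k → ∀ i, s ≤ i → i ≤ e → h s ≤ h i
  anchored : ∀ s e k, IsRun c L s e k → h s < h e →
    e = N ∧ Odd (h e - h s) ∧ Even (#{k' ∈ Icc 1 (c s) | IsRun c L s N k'})

/-! ### From conditions on tiles to conditions on `c` and `L`. -/

section ToValues

variable {h : ℕ → ℤ} {N : ℕ} {c L : ℕ → ℕ}

/-- A tile passing the closing step cannot begin inside the chord, where it would start higher than
it later gets. A tile passing the opening step cannot end inside the chord: it would have risen,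
hence be anchored in column N, which lies further right. -/
theorem HasBallotRuns.le_of_matched (hl : Layered h N c L) (hb : HasBallotRuns h N c L)
    {o j : ℕ} (hj : j + 1 ≤ N) (h1 : h (j + 1) = h o)
    (h2 : ∀ i, o < i → i ≤ j → h o < h i) (hoj : o < j) :
    L (j + 1) = L (o + 1) ∧ ∀ i, o < i → i ≤ j + 1 → L (o + 1) ≤ L i := by
  have a1 : ∀ k, k ≤ L (j + 1) → ∀ i, o < i → i ≤ j + 1 → k ≤ L i := by
    intro k hk i hi1 hi2
    rcases Nat.eq_zero_or_pos k with rfl | hk0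
    · omega
    obtain ⟨s, e, hr, hs, he⟩ := hl.exists_run_of_le hk0 hk
    have := hb.le s e k hr (j + 1) (by omega) he
    rcases lt_or_ge o s with hlt | hge
    · have := h2 s hlt hs; omega
    · exact hr.2.2.2.1 i (mem_Ioc.2 ⟨by omega, by omega⟩)
  have a2 : ∀ k, k ≤ L (o + 1) → ∀ i, o < i → i ≤ j + 1 → k ≤ L i := by
    intro k hk i hi1 hi2
    rcases Nat.eq_zero_or_pos k with rfl | hk0
    · omega
    obtain ⟨s, e, hr, hs, he⟩ := hl.exists_run_of_le hk0 hk
    have h3 := hb.le s e k hr o hs he.le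
    rcases lt_or_ge e (j + 1) with hlt | hge
    · have h4 := h2 e he (by omega)
      have := (hb.anchored s e k hr (by omega)).1
      omega
    · exact hr.2.2.2.1 i (mem_Ioc.2 ⟨by omega, by omega⟩)
  refine ⟨le_antisymm (a1 _ le_rfl _ (by omega) (by omega)) (a2 _ le_rfl _ (by omega) le_rfl),
    a2 _ le_rfl⟩

/-- A tile that crosses the unmatched step and ends later ends above its start, so it is anchored
and reaches column N. -/
theorem HasBallotRuns.le_of_unmatched (hl : Layered h N c L) (hb : HasBallotRuns h N c L)
    {o : ℕ} (h2 : ∀ i, o < i → i ≤ N → h o < h i) :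
    ∀ i, o < i → i ≤ N → L (o + 1) ≤ L i := by
  intro i hi1 hi2
  rcases Nat.eq_zero_or_pos (L (o + 1)) with hk | hk0
  · omega
  obtain ⟨s, e, hr, hs, he⟩ := hl.exists_run_of_le hk0 le_rfl
  have h3 := hb.le s e _ hr o hs he.le
  rcases lt_or_ge e i with hlt | hge
  · have h4 := h2 e he (by omega)
    have := (hb.anchored s e _ hr (by omega)).1
    omega
  · exact hr.2.2.2.1 i (mem_Ioc.2 ⟨by omega, by omega⟩)

end ToValues

/-- The conditions on `c` and `L` along the word of a tree starting at abscissa `o`, where the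
layers up to `b` are joined along the whole word. -/
def IsValuation (c L : ℕ → ℕ) : PlaneTree EdgeMark → ℕ → ℕ → Prop
  | .nil, _, _ => True
  | .cons a F R, o, b =>
      if a.dot then
        (L (o + 1) = b ∧ b ≤ c (o + 1) ∧ (c (o + 1) = c o ∨ c (o + 1) + 1 = c o)) ∧
        (b ≤ L (o + 2) ∧ L (o + 2) ≤ c (o + 2) ∧ Even (L (o + 2) - b) ∧
          (c (o + 2) = c (o + 1) ∨ c (o + 2) + 1 = c (o + 1))) ∧
        IsValuation c L F (o + 2) (L (o + 2))
      else
        (b ≤ L (o + 1) ∧ L (o + 1) ≤ c (o + 1) ∧ (c (o + 1) = c o ∨ c (o + 1) + 1 = c o)) ∧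
        IsValuation c L F (o + 1) (L (o + 1)) ∧
        (L (o + 1 + 2 * F.numEdges + 1) = L (o + 1) ∧ L (o + 1) ≤ c (o + 1 + 2 * F.numEdges) ∧
          (c (o + 1 + 2 * F.numEdges + 1) = c (o + 1 + 2 * F.numEdges) ∨
            c (o + 1 + 2 * F.numEdges + 1) = c (o + 1 + 2 * F.numEdges) + 1)) ∧
        IsValuation c L R (o + 1 + 2 * F.numEdges + 1) b

section ToValues

variable {h : ℕ → ℤ} {N : ℕ} {c L : ℕ → ℕ}

theorem HasBallotRuns.isValuation_of_undotted (hl : Layered h N c L) (hb : HasBallotRuns h N c L)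
    {T : PlaneTree EdgeMark} (hT : IsUndotted T) {o b : ℕ} (hh : FollowsWord h T o)
    (ho : o + 2 * T.numEdges ≤ N) (hL : ∀ i, o < i → i ≤ o + 2 * T.numEdges → b ≤ L i) :
    IsValuation c L T o b := by
  induction T generalizing o b with
  | nil => trivial
  | cons a F R ih1 ih2 =>
    obtain ⟨ha, hF, hR⟩ := hT
    simp only [FollowsWord, ha, Bool.false_eq_true, if_false] at hh
    obtain ⟨h1, h2, h3, h4⟩ := hh
    obtain ⟨k1, -, k3⟩ := h2.le hF.isSpined
    have k3 := k3 hF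
    simp only [PlaneTree.numEdges] at ho hL
    simp only [IsValuation, ha, Bool.false_eq_true, if_false]
    obtain ⟨m1, m2⟩ := hb.le_of_matched hl (o := o) (j := o + 1 + 2 * F.numEdges) (by omega)
      (by omega) (fun i hi1 hi2 => by have := k1 i (by omega) (by omega); omega) (by omega)
    refine ⟨⟨hL _ (by omega) (by omega), hl.le _, hl.up _ (by omega) h1⟩,
      ih1 hF h2 (by omega) (fun i hi1 hi2 => m2 i (by omega) (by omega)),
      ⟨m1, m1 ▸ hl.le_pred _, hl.down _ (by omega) h3⟩,
      ih2 hR h4 (by omega) (fun i hi1 hi2 => hL i (by omega) (by omega))⟩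

/-- The abscissa `o'` is where the current part of the spine begins: the right end of the last pair
UU, or the start of the whole word. Only chords lie between `o'` and `o`, and `L o'` is the number
of layers joined throughout the remaining word. -/
theorem HasBallotRuns.isValuation (hl : Layered h N c L) (hb : HasBallotRuns h N c L)
    {T : PlaneTree EdgeMark} (hT : IsSpined T) {o o' : ℕ} (hh : FollowsWord h T o)
    (ho : o + 2 * T.numEdges = N) (ho' : o' ≤ o) (h0 : h o' = h o)
    (h0' : ∀ i, o' ≤ i → i ≤ o → h o ≤ h i) (hL : ∀ i, o < i → i ≤ N → L o' ≤ L i) :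
    IsValuation c L T o (L o') := by
  induction T generalizing o o' with
  | nil => trivial
  | cons a F R ih1 ih2 =>
    have hle := hh.le hT
    rw [ho] at hle
    rcases hT with ⟨ha, rfl, hF⟩ | ⟨ha, hF, hR⟩
    · simp only [FollowsWord, ha, if_true] at hh
      obtain ⟨h1, h2, h3⟩ := hh
      simp only [PlaneTree.numEdges, add_zero] at ho
      have e : N = o + 2 + 2 * F.numEdges := by omega
      obtain ⟨k1, -, -⟩ := h3.le hF
      rw [← e] at k1
      have hN := k1 N (by omega) le_rfl
      -- A further join would belong to a tile that begins at the height of `o` and rises. Such a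
      -- tile is anchored, and its total rise h N - h o is even, against type BI.
      have q1 : L (o + 1) = L o' := by
        by_contra hne
        have hgt : L o' < L (o + 1) :=
          lt_of_le_of_ne (hL _ (by omega) (by omega)) (Ne.symm hne)
        obtain ⟨s, e', hr, hs, he⟩ := hl.exists_run_of_le (by omega) (le_refl (L (o + 1)))
        have hs' : o' ≤ s := by
          by_contra hlt
          have := hr.2.2.2.1 o' (mem_Ioc.2 ⟨by omega, by omega⟩)
          omega
        have e1 := h0' s hs' hs
        have e2 := hb.le _ _ _ hr o hs he.le
        have e3 : h o < h e' := by
          rcases Nat.lt_or_ge e' (o + 2) with hlt | hge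
          · rw [show e' = o + 1 by omega]; omega
          · have := k1 e' hge (hl.run_end_le hr).2.1; omega
        obtain ⟨rfl, hodd, -⟩ := hb.anchored _ _ _ hr (by omega)
        rw [show h s = h o by omega] at hodd
        exact (Int.not_even_iff_odd.2 hodd) hle.2.1
      have um := hb.le_of_unmatched hl (o := o + 1) (fun i hi1 hi2 => by
        have := k1 i (by omega) (by omega); omega)
      -- The tiles beginning in column `o + 1` and reaching column N fill exactly the layers above
      -- `L o'` up to `L (o + 2)`. Type BI makes their number even.
      have q2 : Even (L (o + 2) - L o') := by
        rcases (hL (o + 2) (by omega) (by omega)).lt_or_eq with hlt | heq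
        · have hrun : ∀ k, IsRun c L (o + 1) N k ↔ k ∈ Ioc (L o') (L (o + 2)) := by
            intro k
            rw [mem_Ioc]
            constructor
            · rintro ⟨-, -, r3, r4, -⟩
              exact ⟨by omega, r4 (o + 2) (mem_Ioc.2 ⟨by omega, by omega⟩)⟩
            · rintro ⟨r1, r2⟩
              refine ⟨by omega, r2.trans (hl.le_pred (o + 1)), by omega, fun i hi => ?_, ?_⟩
              · rw [mem_Ioc] at hi
                exact r2.trans (um i hi.1 hi.2)
              · rw [hl.L_top (Nat.lt_succ_self N)]; omega
          have hev := (hb.anchored _ _ _ ((hrun (L (o + 2))).2 (mem_Ioc.2 ⟨hlt, le_rfl⟩))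
            (by omega)).2.2
          have hset : {k' ∈ Icc 1 (c (o + 1)) | IsRun c L (o + 1) N k'} =
              Ioc (L o') (L (o + 2)) := by
            ext k
            rw [mem_filter, hrun, mem_Icc, mem_Ioc]
            have : L (o + 2) ≤ c (o + 1) := hl.le_pred (o + 1)
            constructor
            · exact fun hk => hk.2
            · exact fun hk => ⟨⟨by omega, by omega⟩, hk⟩
          rwa [hset, Nat.card_Ioc] at hev
        · rw [heq, Nat.sub_self]; exact Even.zero
      simp only [IsValuation, ha, if_true]
      refine ⟨⟨q1, q1 ▸ hl.le _, hl.up _ (by omega) h1⟩,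
        ⟨hL _ (by omega) (by omega), hl.le _, q2, hl.up _ (by omega) h2⟩, ?_⟩
      exact ih1 hF h3 (by omega) le_rfl rfl (fun i i1 i2 => by rw [le_antisymm i1 i2])
        (fun i i1 i2 => um i (by omega) i2)
    · simp only [FollowsWord, ha, Bool.false_eq_true, if_false] at hh
      obtain ⟨h1, h2, h3, h4⟩ := hh
      obtain ⟨k1, -, k3⟩ := h2.le hF.isSpined
      have k3 := k3 hF
      simp only [PlaneTree.numEdges] at ho
      simp only [IsValuation, ha, Bool.false_eq_true, if_false]
      obtain ⟨m1, m2⟩ := hb.le_of_matched hl (o := o) (j := o + 1 + 2 * F.numEdges) (by omega)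
        (by omega) (fun i hi1 hi2 => by have := k1 i (by omega) (by omega); omega) (by omega)
      refine ⟨⟨hL _ (by omega) (by omega), hl.le _, hl.up _ (by omega) h1⟩,
        hb.isValuation_of_undotted hl hF h2 (by omega)
          (fun i hi1 hi2 => m2 i (by omega) (by omega)),
        ⟨m1, m1 ▸ hl.le_pred _, hl.down _ (by omega) h3⟩, ?_⟩
      refine ih2 hR h4 (by omega) (by omega) (by omega) (fun i i1 i2 => ?_)
        (fun i i1 i2 => hL i (by omega) i2)
      rcases Nat.lt_or_ge i o with hlt | hge
      · have := h0' i i1 hlt.le; omega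
      · have := hle.1 i hge (by omega); omega

end ToValues

/-! ### From valuations to tiles -/

section FromValues

variable {h : ℕ → ℤ} {N : ℕ} {c L : ℕ → ℕ}

theorem IsValuation.le {T : PlaneTree EdgeMark} (hT : IsSpined T) {o b : ℕ}
    (hv : IsValuation c L T o b) : ∀ i, o < i → i ≤ o + 2 * T.numEdges → b ≤ L i := by
  induction T generalizing o b with
  | nil => intro i h1 h2; simp only [PlaneTree.numEdges] at h2; omega
  | cons a F R ih1 ih2 =>
    intro i i1 i2
    simp only [PlaneTree.numEdges] at i2
    rcases hT with ⟨ha, rfl, hF⟩ | ⟨ha, hF, hR⟩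
    · simp only [IsValuation, ha, if_true] at hv
      simp only [PlaneTree.numEdges] at i2
      obtain ⟨⟨v1, -, -⟩, ⟨v2, -, -, -⟩, v3⟩ := hv
      rcases Nat.lt_or_ge (o + 2) i with hlt | hge
      · exact v2.trans (ih1 hF v3 i hlt (by omega))
      · obtain rfl | rfl : i = o + 1 ∨ i = o + 2 := by omega
        · exact v1.ge
        · exact v2
    · simp only [IsValuation, ha, Bool.false_eq_true, if_false] at hv
      obtain ⟨⟨v1, -, -⟩, v2, ⟨v3, -, -⟩, v4⟩ := hv
      rcases Nat.lt_or_ge (o + 1 + 2 * F.numEdges + 1) i with hlt | hge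
      · exact ih2 hR v4 i hlt (by omega)
      · rcases hge.lt_or_eq with hlt' | rfl
        · rcases Nat.lt_or_ge (o + 1) i with hlt'' | hge''
          · exact v1.trans (ih1 hF.isSpined v2 i hlt'' (by omega))
          · rwa [show i = o + 1 by omega]
        · omega

/-- The abscissae of the left ends of the up steps at which ballot tiles may begin. -/
def ballotStarts : PlaneTree EdgeMark → ℕ → Finset ℕ
  | .nil, _ => ∅
  | .cons a F R, o =>
      if a.dot then insert (o + 1) (ballotStarts F (o + 2))
      else ballotStarts R (o + 1 + 2 * F.numEdges + 1)

theorem le_of_mem_ballotStarts {T : PlaneTree EdgeMark} (hT : IsSpined T) {o s : ℕ}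
    (hs : s ∈ ballotStarts T o) : o + 1 ≤ s ∧ s < o + 2 * T.numEdges := by
  induction T generalizing o with
  | nil => simp [ballotStarts] at hs
  | cons a F R ih1 ih2 =>
    simp only [PlaneTree.numEdges]
    rcases hT with ⟨ha, rfl, hF⟩ | ⟨ha, hF, hR⟩
    · simp only [ballotStarts, ha, if_true, mem_insert] at hs
      rcases hs with rfl | hs
      · omega
      · have := ih1 hF hs; omega
    · simp only [ballotStarts, ha, Bool.false_eq_true, if_false] at hs
      have := ih2 hR hs; omega

theorem IsValuation.of_mem_ballotStarts {T : PlaneTree EdgeMark} (hT : IsSpined T) {o b s : ℕ}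
    (hh : FollowsWord h T o) (hv : IsValuation c L T o b) (hN : o + 2 * T.numEdges = N)
    (hs : s ∈ ballotStarts T o) :
    (∀ i, s < i → i ≤ N → L (s + 1) ≤ L i) ∧ Odd (h N - h s) ∧ h s < h N ∧
      (∀ i, s ≤ i → i ≤ N → h s ≤ h i) ∧ L s ≤ L (s + 1) ∧ Even (L (s + 1) - L s) := by
  induction T generalizing o b with
  | nil => simp [ballotStarts] at hs
  | cons a F R ih1 ih2 =>
    rcases hT with ⟨ha, rfl, hF⟩ | ⟨ha, hF, hR⟩
    · simp only [ballotStarts, ha, if_true, mem_insert] at hs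
      simp only [IsValuation, ha, if_true] at hv
      simp only [FollowsWord, ha, if_true] at hh
      simp only [PlaneTree.numEdges] at hN
      obtain ⟨h1, h2, h3⟩ := hh
      obtain ⟨⟨v1, -, -⟩, ⟨v2, -, v2', -⟩, v3⟩ := hv
      rcases hs with rfl | hs
      · have hle := h3.le hF
        have hN' : o + 2 + 2 * F.numEdges = N := by omega
        rw [hN'] at hle
        have hvl := v3.le hF
        have hge := hle.1 N (by omega) le_rfl
        refine ⟨fun i i1 i2 => ?_, ?_, by omega, fun i i1 i2 => ?_, ?_, ?_⟩
        · rcases Nat.lt_or_ge (o + 2) i with hlt | hge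
          · exact hvl i hlt (by omega)
          · rw [show i = o + 2 by omega]
        · obtain ⟨r, hr⟩ := hle.2.1
          exact ⟨r, by omega⟩
        · rcases Nat.lt_or_ge (o + 1) i with hlt | hge
          · have := hle.1 i hlt i2; omega
          · rw [show i = o + 1 by omega]
        · rw [v1]; exact v2
        · rw [v1]; exact v2'
      · exact ih1 hF h3 v3 (by omega) hs
    · simp only [ballotStarts, ha, Bool.false_eq_true, if_false] at hs
      simp only [IsValuation, ha, Bool.false_eq_true, if_false] at hv
      simp only [FollowsWord, ha, Bool.false_eq_true, if_false] at hh
      simp only [PlaneTree.numEdges] at hN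
      exact ih2 hR hh.2.2.2 hv.2.2.2 (by omega) hs

/-- A tile entering a chord leaves at its right end, since `L` agrees at both ends and is not
smaller inside; it goes on to the next chord of the same level while its layer is joined there. A
tile that begins strictly inside lies in a layer above those joined at the closing step and ends
inside. -/
theorem IsValuation.exists_end_of_undotted {T : PlaneTree EdgeMark} (hT : IsUndotted T)
    {o b s k : ℕ} (hh : FollowsWord h T o) (hv : IsValuation c L T o b) (ho : o ≤ s)
    (hs : s < o + 2 * T.numEdges) (hk : k ≤ L (s + 1)) (hs' : s = o ∨ L s < k) :
    ∃ e, s < e ∧ e ≤ o + 2 * T.numEdges ∧ (∀ i ∈ Ioc s e, k ≤ L i) ∧ h e = h s ∧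
      (∀ i, s ≤ i → i ≤ e → h s ≤ h i) ∧ (e = o + 2 * T.numEdges ∨ L (e + 1) < k) := by
  induction T generalizing o b s with
  | nil => simp only [PlaneTree.numEdges] at hs; omega
  | cons a F R ih1 ih2 =>
    obtain ⟨ha, hF, hR⟩ := hT
    simp only [IsValuation, ha, Bool.false_eq_true, if_false] at hv
    simp only [FollowsWord, ha, Bool.false_eq_true, if_false] at hh
    simp only [PlaneTree.numEdges] at hs ⊢
    obtain ⟨h1, h2, h3, h4⟩ := hh
    obtain ⟨⟨v1, -, -⟩, v2, ⟨v3, -, -⟩, v4⟩ := hv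
    obtain ⟨k1, -, k3⟩ := h2.le hF.isSpined
    have k3 := k3 hF
    have vl := v2.le hF.isSpined
    have hend : o + 2 * (F.numEdges + 1 + R.numEdges) =
      o + 1 + 2 * F.numEdges + 1 + 2 * R.numEdges := by ring
    rw [hend] at hs ⊢
    rcases Nat.lt_or_ge s (o + 1 + 2 * F.numEdges + 1) with hlt | hge
    · rcases ho.lt_or_eq with hlt' | rfl
      · have hs'' : L s < k := hs'.resolve_left (by omega)
        have hgt : L (o + 1) < k := by
          rcases Nat.lt_or_ge (o + 1) s with h5 | h5
          · exact (vl s h5 (by omega)).trans_lt hs''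
          · rwa [show o + 1 = s by omega]
        have hne : s ≠ o + 1 + 2 * F.numEdges := by rintro rfl; omega
        obtain ⟨e, e1, e2, e3, e4, e5, e6⟩ := ih1 hF h2 v2 (by omega) (by omega) hk
          (Or.inr hs'')
        refine ⟨e, e1, by omega, e3, e4, e5, Or.inr ?_⟩
        rcases e6 with rfl | e6
        · omega
        · exact e6
      · have hrun : ∀ i ∈ Ioc o (o + 1 + 2 * F.numEdges + 1), k ≤ L i := by
          intro i hi
          rw [mem_Ioc] at hi
          rcases Nat.lt_or_ge (o + 1) i with h5 | h5
          · rcases hi.2.lt_or_eq with h6 | rfl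
            · exact hk.trans (vl i h5 (by omega))
            · omega
          · rwa [show i = o + 1 by omega]
        have hhgt : ∀ i, o ≤ i → i ≤ o + 1 + 2 * F.numEdges + 1 → h o ≤ h i := by
          intro i i1 i2
          rcases i1.lt_or_eq with i1 | rfl
          · rcases i2.lt_or_eq with i2 | rfl
            · have := k1 i i1 (by omega); omega
            · omega
          · rfl
        by_cases hcont : R.numEdges ≠ 0 ∧ k ≤ L (o + 1 + 2 * F.numEdges + 1 + 1)
        · obtain ⟨e, e1, e2, e3, e4, e5, e6⟩ := ih2 hR h4 v4 le_rfl (by omega) hcont.2 (Or.inl rfl)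
          refine ⟨e, by omega, e2, fun i hi => ?_, by omega, fun i i1 i2 => ?_, e6⟩
          · rw [mem_Ioc] at hi
            rcases Nat.lt_or_ge (o + 1 + 2 * F.numEdges + 1) i with h5 | h5
            · exact e3 i (mem_Ioc.2 ⟨h5, hi.2⟩)
            · exact hrun i (mem_Ioc.2 ⟨hi.1, h5⟩)
          · rcases Nat.lt_or_ge (o + 1 + 2 * F.numEdges + 1) i with h5 | h5
            · have := e5 i h5.le i2; omega
            · exact hhgt i i1 h5
        · refine ⟨o + 1 + 2 * F.numEdges + 1, by omega, by omega, hrun, by omega, hhgt, ?_⟩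
          omega
    · obtain ⟨e, e1, e2, e3, e4, e5, e6⟩ := ih2 hR h4 v4 hge (by omega) hk (by omega)
      exact ⟨e, e1, e2, e3, e4, e5, e6⟩

/-- At a dotted edge, a beginning at `o` is impossible because `L (o + 1) = b < k`, and a beginning
at `o + 1` is excluded by `hst`. All remaining tiles lie within runs of consecutive chords. -/
theorem IsValuation.exists_end {T : PlaneTree EdgeMark} (hT : IsSpined T)
    {o b s k : ℕ} (hh : FollowsWord h T o) (hv : IsValuation c L T o b)
    (hN : o + 2 * T.numEdges = N) (hLN : L (N + 1) = 0) (hb : b < k) (ho : o ≤ s)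
    (hs : s < N) (hk : k ≤ L (s + 1)) (hs' : s = o ∨ L s < k) (hst : s ∉ ballotStarts T o) :
    ∃ e, s < e ∧ e ≤ N ∧ (∀ i ∈ Ioc s e, k ≤ L i) ∧ h e = h s ∧
      (∀ i, s ≤ i → i ≤ e → h s ≤ h i) ∧ L (e + 1) < k := by
  induction T generalizing o b s with
  | nil => simp only [PlaneTree.numEdges] at hN; omega
  | cons a F R ih1 ih2 =>
    rcases hT with ⟨ha, rfl, hF⟩ | ⟨ha, hF, hR⟩
    · simp only [ballotStarts, ha, if_true, mem_insert, not_or] at hst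
      simp only [IsValuation, ha, if_true] at hv
      simp only [FollowsWord, ha, if_true] at hh
      simp only [PlaneTree.numEdges] at hN
      obtain ⟨h1, h2, h3⟩ := hh
      obtain ⟨⟨v1, -, -⟩, ⟨v2, -, -, -⟩, v3⟩ := hv
      have vl := v3.le hF
      have hne : s ≠ o := by rintro rfl; omega
      have hs'' : L s < k := hs'.resolve_left hne
      have hgt : L (o + 2) < k := by
        rcases Nat.lt_or_ge (o + 2) s with h5 | h5
        · exact (vl s h5 (by omega)).trans_lt hs''
        · rwa [show o + 2 = s by omega]
      exact ih1 hF h3 v3 (by omega) hgt (by omega) hs hk (Or.inr hs'') hst.2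
    · simp only [ballotStarts, ha, Bool.false_eq_true, if_false] at hst
      have hle := hh.le (T := .cons a F R) (Or.inr ⟨ha, hF, hR⟩)
      rw [hN] at hle
      have hvl := hv.le (T := .cons a F R) (Or.inr ⟨ha, hF, hR⟩)
      rw [hN] at hvl
      simp only [IsValuation, ha, Bool.false_eq_true, if_false] at hv
      simp only [FollowsWord, ha, Bool.false_eq_true, if_false] at hh
      simp only [PlaneTree.numEdges] at hN
      obtain ⟨h1, h2, h3, h4⟩ := hh
      obtain ⟨⟨v1, -, -⟩, v2, ⟨v3, -, -⟩, v4⟩ := hv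
      obtain ⟨k1, -, k3⟩ := h2.le hF.isSpined
      have k3 := k3 hF
      have vl := v2.le hF.isSpined
      rcases Nat.lt_or_ge s (o + 1 + 2 * F.numEdges + 1) with hlt | hge
      · rcases ho.lt_or_eq with hlt' | rfl
        · have hs'' : L s < k := hs'.resolve_left (by omega)
          have hgt : L (o + 1) < k := by
            rcases Nat.lt_or_ge (o + 1) s with h5 | h5
            · exact (vl s h5 (by omega)).trans_lt hs''
            · rwa [show o + 1 = s by omega]
          have hne : s ≠ o + 1 + 2 * F.numEdges := by rintro rfl; omega
          obtain ⟨e, e1, e2, e3, e4, e5, e6⟩ :=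
            v2.exists_end_of_undotted hF h2 (by omega) (by omega) hk (Or.inr hs'')
          refine ⟨e, e1, by omega, e3, e4, e5, ?_⟩
          rcases e6 with rfl | e6
          · omega
          · exact e6
        · have hrun : ∀ i ∈ Ioc o (o + 1 + 2 * F.numEdges + 1), k ≤ L i := by
            intro i hi
            rw [mem_Ioc] at hi
            rcases Nat.lt_or_ge (o + 1) i with h5 | h5
            · rcases hi.2.lt_or_eq with h6 | rfl
              · exact hk.trans (vl i h5 (by omega))
              · omega
            · rwa [show i = o + 1 by omega]
          have hhgt : ∀ i, o ≤ i → i ≤ o + 1 + 2 * F.numEdges + 1 → h o ≤ h i :=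
            fun i i1 i2 => hle.1 i i1 (by omega)
          by_cases hcont : k ≤ L (o + 1 + 2 * F.numEdges + 1 + 1)
          · have hlt : o + 1 + 2 * F.numEdges + 1 < N := by
              rcases (show o + 1 + 2 * F.numEdges + 1 ≤ N by omega).lt_or_eq with h5 | h5
              · exact h5
              · rw [h5] at hcont; omega
            obtain ⟨e, e1, e2, e3, e4, e5, e6⟩ := ih2 hR h4 v4 (by omega) hb le_rfl hlt hcont
              (Or.inl rfl) (fun hmem => by have := le_of_mem_ballotStarts hR hmem; omega)
            refine ⟨e, by omega, e2, fun i hi => ?_, by omega, fun i i1 i2 => ?_, e6⟩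
            · rw [mem_Ioc] at hi
              rcases Nat.lt_or_ge (o + 1 + 2 * F.numEdges + 1) i with h5 | h5
              · exact e3 i (mem_Ioc.2 ⟨h5, hi.2⟩)
              · exact hrun i (mem_Ioc.2 ⟨hi.1, h5⟩)
            · exact hle.1 i i1 (by omega)
          · exact ⟨o + 1 + 2 * F.numEdges + 1, by omega, by omega, hrun, by omega, hhgt,
              by omega⟩
      · exact ih2 hR h4 v4 (by omega) hb hge hs hk (by omega) hst

/-- For a valuation, the tiles beginning at `s` are ballot tiles of positive height if `s` is a
ballot start and they contain at least two boxes, and Dyck tiles otherwise. -/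
theorem IsValuation.run_cases (hl : Layered h N c L) {T : PlaneTree EdgeMark} (hT : IsSpined T)
    {o : ℕ} (hh : FollowsWord h T o) (hv : IsValuation c L T o 0)
    (hN : o + 2 * T.numEdges = N) (hco : ∀ x ≤ o, x ≠ o → c x = 0) {s e k : ℕ}
    (hr : IsRun c L s e k) : (∀ i, s ≤ i → i ≤ e → h s ≤ h i) ∧
      if s ∈ ballotStarts T o ∧ k ≤ L (s + 1) then e = N ∧ h s < h e ∧ Odd (h e - h s)
      else h e = h s := by
  have hre := hl.run_end_le hr
  have hso : o ≤ s := by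
    by_contra hlt
    have := hco s (by omega) (by omega)
    have := hr.2.1
    omega
  have hLN := hl.L_top (Nat.lt_succ_self N)
  rcases hr.1.lt_or_eq with hlt | rfl
  · have hk := hr.2.2.2.1 (s + 1) (mem_Ioc.2 ⟨by omega, by omega⟩)
    by_cases hst : s ∈ ballotStarts T o
    · obtain ⟨b1, b2, b3, b4, -, -⟩ := hv.of_mem_ballotStarts hT hh hN hst
      have heN : e = N := by
        by_contra hne
        have := b1 (e + 1) (by omega) (by omega)
        have := hr.2.2.2.2
        omega
      subst heN
      rw [if_pos ⟨hst, hk⟩]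
      exact ⟨b4, rfl, b3, b2⟩
    · obtain ⟨e', e1, e2, e3, e4, e5, e6⟩ := hv.exists_end hT hh hN hLN hre.2.2 hso (by omega) hk
        (Or.inr hr.2.2.1) hst
      obtain ⟨-, rfl⟩ := hr.unique (x := s) ⟨e1.le, hr.2.1, hr.2.2.1, e3, e6⟩ le_rfl hlt.le le_rfl
        e1.le
      rw [if_neg (fun hmem => hst hmem.1)]
      exact ⟨e5, e4⟩
  · rw [if_neg]
    · exact ⟨fun i i1 i2 => by rw [le_antisymm i1 i2], rfl⟩
    · have := hr.2.2.2.2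
      omega

theorem IsValuation.hasBallotRuns (hl : Layered h N c L) {T : PlaneTree EdgeMark}
    (hT : IsSpined T) {o : ℕ} (hh : FollowsWord h T o) (hv : IsValuation c L T o 0)
    (hN : o + 2 * T.numEdges = N) (hco : ∀ x ≤ o, x ≠ o → c x = 0) :
    HasBallotRuns h N c L := by
  refine ⟨fun s e k hr => (hv.run_cases hl hT hh hN hco hr).1, fun s e k hr hlt => ?_⟩
  have := (hv.run_cases hl hT hh hN hco hr).2
  split_ifs at this with hst
  · refine ⟨this.1, this.2.2, ?_⟩
    obtain ⟨b1, -, -, -, b5, b6⟩ := hv.of_mem_ballotStarts hT hh hN hst.1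
    have hset : {k' ∈ Icc 1 (c s) | IsRun c L s N k'} = Ioc (L s) (L (s + 1)) := by
      ext k'
      have hsN := (le_of_mem_ballotStarts hT hst.1).2
      rw [mem_filter, mem_Icc, mem_Ioc]
      constructor
      · rintro ⟨-, -, -, r3, r4, -⟩
        exact ⟨r3, r4 (s + 1) (mem_Ioc.2 ⟨by omega, by omega⟩)⟩
      · rintro ⟨r1, r2⟩
        have := hl.le_pred s
        refine ⟨⟨by omega, by omega⟩, by omega, by omega, r1, fun i hi => ?_, ?_⟩
        · rw [mem_Ioc] at hi
          exact r2.trans (b1 i hi.1 hi.2)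
        · rw [hl.L_top (Nat.lt_succ_self N)]; omega
    rw [hset, Nat.card_Ioc]
    exact b6
  · omega

/-- The sum of the statistics of the tiles, in terms of the steps of the path. -/
def valuationWeight (c L : ℕ → ℕ) : PlaneTree EdgeMark → ℕ → ℕ
  | .nil, _ => 0
  | .cons a F R, o =>
      if a.dot then c (o + 1) + (c (o + 2) - L (o + 2)) + valuationWeight c L F (o + 2)
      else (c (o + 1) - L (o + 1)) + valuationWeight c L F (o + 1) +
        c (o + 1 + 2 * F.numEdges + 1) + valuationWeight c L R (o + 1 + 2 * F.numEdges + 1)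

/-- There are Σ(c - L) tiles, so twice the total statistic is 2Σc - ΣL minus the number of ballot
tiles of positive height. The halving is local: the two ends of a chord have equal `L`, and a pair
UU gives b + L + (L - b) = 2L. -/
theorem IsValuation.two_mul_weight {T : PlaneTree EdgeMark} (hT : IsSpined T) {o b : ℕ}
    (hv : IsValuation c L T o b) :
    2 * valuationWeight c L T o + ∑ i ∈ Ioc o (o + 2 * T.numEdges), L i +
      ∑ s ∈ ballotStarts T o, (L (s + 1) - L s) =
        2 * ∑ i ∈ Ioc o (o + 2 * T.numEdges), c i := by
  induction T generalizing o b with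
  | nil => simp [valuationWeight, ballotStarts, PlaneTree.numEdges]
  | cons a F R ih1 ih2 =>
    rcases hT with ⟨ha, rfl, hF⟩ | ⟨ha, hF, hR⟩
    · have hnm : o + 1 ∉ ballotStarts F (o + 2) := fun hm => by
        have := le_of_mem_ballotStarts hF hm; omega
      simp only [ballotStarts, ha, if_true, valuationWeight, sum_insert hnm]
      simp only [IsValuation, ha, if_true] at hv
      simp only [PlaneTree.numEdges]
      obtain ⟨⟨v1, -, -⟩, ⟨v2, v2', -, -⟩, v3⟩ := hv
      have i1 := ih1 hF v3
      have e : ∀ f : ℕ → ℕ, ∑ i ∈ Ioc o (o + 2 * (F.numEdges + 1 + 0)), f i =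
          f (o + 1) + f (o + 2) + ∑ i ∈ Ioc (o + 2) (o + 2 + 2 * F.numEdges), f i := by
        intro f
        rw [show o + 2 * (F.numEdges + 1 + 0) = o + 2 + 2 * F.numEdges by ring,
          ← sum_Ioc_consecutive f (show o ≤ o + 2 by omega) (by omega),
          sum_Ioc_succ_top (by omega), sum_Ioc_succ_top (by omega)]
        simp
      rw [e, e, v1, show o + 1 + 1 = o + 2 by ring]
      omega
    · simp only [ballotStarts, ha, Bool.false_eq_true, if_false, valuationWeight]
      simp only [IsValuation, ha, Bool.false_eq_true, if_false] at hv
      simp only [PlaneTree.numEdges]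
      obtain ⟨⟨v1, v1', -⟩, v2, ⟨v3, v3', -⟩, v4⟩ := hv
      have i1 := ih1 hF.isSpined v2
      have i2 := ih2 hR v4
      have hbs : ballotStarts F (o + 1) = ∅ := by
        clear ih1 ih2 v1 v1' v2 v3 v3' v4 i1 i2
        generalize o + 1 = p
        induction F generalizing p with
        | nil => rfl
        | cons a' F' R' ih1' ih2' =>
          simp only [ballotStarts, hF.1, Bool.false_eq_true, if_false]
          exact ih2' hF.2.2 _
      rw [hbs, sum_empty] at i1
      have e : ∀ f : ℕ → ℕ, ∑ i ∈ Ioc o (o + 2 * (F.numEdges + 1 + R.numEdges)), f i =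
          f (o + 1) + ∑ i ∈ Ioc (o + 1) (o + 1 + 2 * F.numEdges), f i +
            f (o + 1 + 2 * F.numEdges + 1) + ∑ i ∈ Ioc (o + 1 + 2 * F.numEdges + 1)
              (o + 1 + 2 * F.numEdges + 1 + 2 * R.numEdges), f i := by
        intro f
        rw [show o + 2 * (F.numEdges + 1 + R.numEdges) =
            o + 1 + 2 * F.numEdges + 1 + 2 * R.numEdges by ring,
          ← sum_Ioc_consecutive f (show o ≤ o + 1 + 2 * F.numEdges + 1 by omega) (by omega),
          sum_Ioc_succ_top (by omega),
          ← sum_Ioc_consecutive f (show o ≤ o + 1 by omega) (by omega),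
          sum_Ioc_succ_top (by omega)]
        simp
      rw [e, e, v3]
      omega

end FromValues

end BallotTiling

namespace BallotTiling

open Finset

/-! ### Heights -/

theorem height_zero (l : List DyckStep) : height l 0 = 0 := by simp [height]

theorem height_append_of_le {l l' : List DyckStep} {i : ℕ} (hi : i ≤ l.length) :
    height (l ++ l') i = height l i := by
  rw [height, height, List.take_append_of_le_length hi]

theorem height_append_add (l l' : List DyckStep) (i : ℕ) :
    height (l ++ l') (l.length + i) = height l l.length + height l' i := by
  rw [height, height, height, List.take_length_add_append, List.take_length]
  simp only [List.count_append]; push_cast; ring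

theorem height_cons_succ (a : DyckStep) (l : List DyckStep) (i : ℕ) :
    height (a :: l) (i + 1) = (if a = DyckStep.U then 1 else -1) + height l i := by
  cases a <;> simp [height, List.take_succ_cons] <;> ring

theorem height_add {l : List DyckStep} {s : ℕ} (hs : s ≤ l.length) (i : ℕ) :
    height l (s + i) = height l s + height (l.drop s) i := by
  have h1 := height_append_add (l.take s) (l.drop s) i
  have h2 := height_append_of_le (l := l.take s) (l' := l.drop s) (i := s) (by simp [hs])
  rw [List.take_append_drop] at h1 h2
  rw [List.length_take, min_eq_left hs] at h1
  rw [h1, h2]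

theorem height_take {l : List DyckStep} {m i : ℕ} (hi : i ≤ m) :
    height (l.take m) i = height l i := by
  rw [height, height, List.take_take, min_eq_left hi]

theorem height_succ {l : List DyckStep} {i : ℕ} (hi : i < l.length) :
    height l (i + 1) = height l i + (if l[i] = DyckStep.U then 1 else -1) := by
  rw [height_add hi.le 1, List.drop_eq_getElem_cons hi, height_cons_succ, height_zero, add_zero]

theorem height_succ_or {l : List DyckStep} {i : ℕ} (hi : i < l.length) :
    height l (i + 1) = height l i + 1 ∨ height l (i + 1) = height l i - 1 := by
  rw [height_succ hi]; split_ifs <;> omega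

theorem eq_of_height {l l' : List DyckStep} (hl : l.length = l'.length)
    (h : ∀ i ≤ l.length, height l i = height l' i) : l = l' := by
  apply List.ext_getElem hl
  intro i h1 h2
  have e1 := height_succ h1
  have e2 := height_succ h2
  rw [h _ h1, h _ h1.le] at e1
  rcases ha : l[i] <;> rcases hb : l'[i] <;> simp [ha, hb] at e1 e2 ⊢ <;> omega

theorem even_height_sub {l : List DyckStep} {i : ℕ} (hi : i ≤ l.length) :
    Even (height l i - i) := by
  induction i with
  | zero => simp [height_zero]
  | succ i ih =>
    obtain ⟨r, hr⟩ := ih (by omega)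
    rcases height_succ_or (show i < l.length by omega) with e | e
    · exact ⟨r, by push_cast; omega⟩
    · exact ⟨r - 1, by push_cast; omega⟩

theorem exists_height_eq (g : ℕ → ℤ) (N : ℕ) (h0 : g 0 = 0)
    (h : ∀ i < N, g (i + 1) = g i + 1 ∨ g (i + 1) = g i - 1) :
    ∃ l : List DyckStep, l.length = N ∧ ∀ i ≤ N, height l i = g i := by
  induction N generalizing g with
  | zero =>
    refine ⟨[], rfl, fun i hi => ?_⟩
    rw [Nat.le_zero.1 hi, h0, height_zero]
  | succ N ih =>
    obtain ⟨l, h1, h2⟩ := ih g h0 (fun i hi => h i (by omega))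
    have key : ∀ a : DyckStep, g (N + 1) = g N + (if a = DyckStep.U then 1 else -1) →
        ∃ l : List DyckStep, l.length = N + 1 ∧ ∀ i ≤ N + 1, height l i = g i := by
      intro a ha
      refine ⟨l ++ [a], by simp [h1], fun i hi => ?_⟩
      rcases hi.lt_or_eq with hlt | rfl
      · rw [height_append_of_le (by omega), h2 i (by omega)]
      · rw [← h1, height_append_add, height_cons_succ, height_zero, h1, h2 N le_rfl, ha, add_zero]
    rcases h N (by omega) with e | e
    · exact key .U (by simpa using e)
    · exact key .D (by simpa [sub_eq_add_neg] using e)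

theorem height_add_two_mul_count {l : List DyckStep} :
    height l l.length = (l.count .U : ℤ) - l.count .D ∧
      l.count DyckStep.U + l.count DyckStep.D = l.length := by
  refine ⟨by rw [height, List.take_length], ?_⟩
  induction l with
  | nil => rfl
  | cons a l ih => cases a <;> simp [← ih] <;> omega

theorem mem_words {n : ℕ} {l : List DyckStep} : l ∈ words n ↔ l.length = n := by
  rw [words, mem_image]
  constructor
  · rintro ⟨f, -, rfl⟩; simp
  · rintro rfl
    exact ⟨l.get, mem_univ _, List.ofFn_get l⟩

/-! ### Tiles in a layer -/

namespace Tile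

theorem ext' {t t' : Tile} (h : t.start = t'.start) (h' : t.path = t'.path) : t = t' := by
  cases t; cases t'; simp_all

/-- The abscissa of the rightmost box. -/
def last (t : Tile) : ℕ := t.start.1 + t.path.length

/-- The layer above the path `lam` containing the leftmost box. -/
def layer (lam : List DyckStep) (t : Tile) : ℕ :=
  ((t.start.2 - height lam t.start.1 + 1) / 2).toNat

theorem mem_boxes {t : Tile} {b : ℕ × ℤ} : b ∈ t.boxes ↔ t.start.1 ≤ b.1 ∧ b.1 ≤ t.last ∧
    b.2 = t.start.2 + height t.path (b.1 - t.start.1) := by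
  rw [boxes, mem_image, last]
  constructor
  · rintro ⟨i, hi, rfl⟩
    rw [mem_range] at hi
    simp only [Nat.add_sub_cancel_left, and_true]
    omega
  · rintro ⟨h1, h2, h3⟩
    refine ⟨b.1 - t.start.1, mem_range.2 (by omega), ?_⟩
    rw [← h3]
    ext1
    · simp only; omega
    · rfl

theorem length_eq_of_isBallotPath {t : Tile} (ht : IsBallotPath t.path) :
    t.path.length = 2 * t.n + t.n' ∧ (t.n' : ℤ) = height t.path t.path.length := by
  have h1 := ht _ le_rfl
  obtain ⟨h2, h3⟩ := height_add_two_mul_count (l := t.path)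
  rw [n, n']
  omega

theorem two_mul_art {t : Tile} (ht : IsBallotPath t.path) (h : t.n' = 0 ∨ Odd t.n') :
    2 * t.art = t.path.length + 1 + if t.n' = 0 then 1 else 0 := by
  have h1 := length_eq_of_isBallotPath ht
  rw [art, area, tiles]
  split_ifs with h0
  · omega
  · obtain ⟨r, hr⟩ := h.resolve_left h0
    omega

end Tile

/-- The tile in the `k`-th layer above `lam` occupying the columns `s, …, e`. -/
def layerTile (lam : List DyckStep) (s e k : ℕ) : Tile :=
  ⟨(s, height lam s + 2 * k - 1), (lam.drop s).take (e - s)⟩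

section LayerTile

variable {lam : List DyckStep} {s e k : ℕ}

theorem layerTile_start : (layerTile lam s e k).start.1 = s := rfl

theorem length_layerTile (he : e ≤ lam.length) : (layerTile lam s e k).path.length = e - s := by
  simp [layerTile]; omega

theorem layerTile_last (hs : s ≤ e) (he : e ≤ lam.length) : (layerTile lam s e k).last = e := by
  rw [Tile.last, length_layerTile he, layerTile_start]; omega

theorem layer_layerTile : (layerTile lam s e k).layer lam = k := by
  simp only [Tile.layer, layerTile]; omega

theorem height_layerTile (hs : s ≤ e) (he : e ≤ lam.length) {i : ℕ} (hi : i ≤ e - s) :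
    height (layerTile lam s e k).path i = height lam (s + i) - height lam s := by
  rw [layerTile, height_take hi, height_add (by omega)]; ring

theorem mem_boxes_layerTile (hs : s ≤ e) (he : e ≤ lam.length) {b : ℕ × ℤ} :
    b ∈ (layerTile lam s e k).boxes ↔ s ≤ b.1 ∧ b.1 ≤ e ∧
      b.2 = height lam b.1 + 2 * k - 1 := by
  rw [Tile.mem_boxes, layerTile_last hs he, layerTile_start]
  refine and_congr_right fun h1 => and_congr_right fun h2 => ?_
  rw [height_layerTile hs he (by omega), show s + (b.1 - s) = b.1 by omega]
  simp only [layerTile]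
  constructor <;> intro h <;> omega

theorem isBallotPath_layerTile (hs : s ≤ e) (he : e ≤ lam.length) :
    IsBallotPath (layerTile lam s e k).path ↔ ∀ i, s ≤ i → i ≤ e → height lam s ≤ height lam i := by
  rw [IsBallotPath, length_layerTile he]
  constructor
  · intro h i h1 h2
    have := h (i - s) (by omega)
    rw [height_layerTile hs he (by omega), show s + (i - s) = i by omega] at this
    omega
  · intro h i hi
    rw [height_layerTile hs he hi]
    have := h (s + i) (by omega) (by omega)
    omega

theorem n'_layerTile (hs : s ≤ e) (he : e ≤ lam.length)
    (h : IsBallotPath (layerTile lam s e k).path) :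
    ((layerTile lam s e k).n' : ℤ) = height lam e - height lam s := by
  rw [(Tile.length_eq_of_isBallotPath h).2, length_layerTile he, height_layerTile hs he le_rfl,
    show s + (e - s) = e by omega]

theorem eq_layerTile {t : Tile} (h : t.last ≤ lam.length)
    (hb : ∀ b ∈ t.boxes, b.2 = height lam b.1 + 2 * k - 1) :
    t = layerTile lam t.start.1 t.last k := by
  have h0 := hb t.start (Tile.mem_boxes.2 ⟨le_rfl, by simp [Tile.last], by simp [height_zero]⟩)
  have hle : t.start.1 ≤ t.last := by simp [Tile.last]
  have hpath : t.path = (layerTile lam t.start.1 t.last k).path := by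
    apply eq_of_height
    · rw [length_layerTile h, Tile.last]; omega
    · intro i hi
      rw [height_layerTile hle h (by rw [Tile.last]; omega)]
      have := hb (t.start.1 + i, t.start.2 + height t.path i)
        (Tile.mem_boxes.2 ⟨by simp, by simp [Tile.last, hi], by simp⟩)
      simp only at this
      omega
  have hstart : t.start = (layerTile lam t.start.1 t.last k).start := Prod.ext rfl h0
  exact Tile.ext' hstart hpath

end LayerTile

theorem mem_skewShape {lam mu : List DyckStep} {x : ℕ} {y : ℤ} :
    (x, y) ∈ skewShape lam mu ↔ (1 ≤ x ∧ x ≤ lam.length) ∧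
      (height lam x < y ∧ y < height mu x) ∧ Odd ((x : ℤ) + y) := by
  simp only [skewShape, mem_biUnion, mem_image, mem_filter, mem_Ioo, mem_Icc, Prod.mk.injEq]
  constructor
  · rintro ⟨x', hx, y', hy, rfl, rfl⟩; exact ⟨hx, hy⟩
  · rintro ⟨hx, hy⟩; exact ⟨x, hx, y, hy, rfl, rfl⟩

theorem mem_skewShape_iff {lam mu : List DyckStep} {c : ℕ → ℕ}
    (hc : ∀ x ≤ lam.length, height mu x = height lam x + 2 * c x) {x : ℕ} {y : ℤ} :
    (x, y) ∈ skewShape lam mu ↔ (1 ≤ x ∧ x ≤ lam.length) ∧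
      ∃ k : ℕ, 1 ≤ k ∧ k ≤ c x ∧ y = height lam x + 2 * k - 1 := by
  rw [mem_skewShape]
  refine and_congr_right fun hx => ?_
  rw [hc x hx.2]
  obtain ⟨r, hr⟩ := even_height_sub hx.2
  constructor
  · rintro ⟨⟨h1, h2⟩, ⟨r', hr'⟩⟩
    exact ⟨((y - height lam x + 1) / 2).toNat, by omega, by omega, by omega⟩
  · rintro ⟨k, h1, h2, rfl⟩
    exact ⟨⟨by omega, by omega⟩, ⟨x + r + k - 1, by omega⟩⟩

end BallotTiling

namespace BallotTiling

open Finset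

/-! ### Tilings by tiles contained in layers -/

/-- The number of tiles with a box in column `x`. -/
def cover (T : Finset Tile) (x : ℕ) : ℕ := #{t ∈ T | t.start.1 ≤ x ∧ x ≤ t.last}

/-- The number of tiles with boxes in the columns `x - 1` and `x`. -/
def link (T : Finset Tile) (x : ℕ) : ℕ := #{t ∈ T | t.start.1 < x ∧ x ≤ t.last}

/-- In each layer above `lam` there is at most one tile with a box in a given column. -/
def InLayers (lam : List DyckStep) (T : Finset Tile) : Prop :=
  ∀ t ∈ T, ∀ t' ∈ T, t.layer lam = t'.layer lam → ∀ x, t.start.1 ≤ x → x ≤ t.last →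
    t'.start.1 ≤ x → x ≤ t'.last → t = t'

/-- The selected tiles all meet column x, so they are distinguished by their layers, and these are
1, …, m. -/
theorem InLayers.card_eq {lam : List DyckStep} {T : Finset Tile} (hT : InLayers lam T) {x m : ℕ}
    {P : Tile → Prop} [DecidablePred P] (hP : ∀ t ∈ T, P t → t.start.1 ≤ x ∧ x ≤ t.last)
    (h : ∀ k, (∃ t ∈ T, P t ∧ t.layer lam = k) ↔ 1 ≤ k ∧ k ≤ m) : #{t ∈ T | P t} = m := by
  have himg : ({t ∈ T | P t}).image (Tile.layer lam) = Icc 1 m := by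
    ext k
    rw [mem_image, mem_Icc, ← h]
    simp only [mem_filter, and_assoc]
  have hinj : Set.InjOn (Tile.layer lam) ({t ∈ T | P t} : Finset Tile) := by
    intro t ht t' ht' hk
    rw [mem_coe, mem_filter] at ht ht'
    have h1 := hP t ht.1 ht.2
    have h2 := hP t' ht'.1 ht'.2
    exact hT t ht.1 t' ht'.1 hk x h1.1 h1.2 h2.1 h2.2
  rw [← card_image_of_injOn hinj, himg, Nat.card_Icc, Nat.add_sub_cancel]

/-- The tiles of a layered configuration. -/
def tilingOf (lam : List DyckStep) (c L : ℕ → ℕ) : Finset Tile :=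
  ((range (lam.length + 1) ×ˢ range (lam.length + 1) ×ˢ
    range ((range (lam.length + 1)).sup c + 1)).filter fun p => IsRun c L p.1 p.2.1 p.2.2).image
      fun p => layerTile lam p.1 p.2.1 p.2.2

/-! ### From layered configurations to tilings. -/

section TilingOf

variable {lam : List DyckStep} {c L : ℕ → ℕ}

theorem mem_tilingOf (hl : Layered (height lam) lam.length c L) {t : Tile} :
    t ∈ tilingOf lam c L ↔ ∃ s e k, IsRun c L s e k ∧ t = layerTile lam s e k := by
  simp only [tilingOf, mem_image, mem_filter, mem_product, mem_range, Prod.exists]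
  constructor
  · rintro ⟨s, e, k, ⟨-, h⟩, rfl⟩
    exact ⟨s, e, k, h, rfl⟩
  · rintro ⟨s, e, k, h, rfl⟩
    have h1 := hl.run_end_le h
    have h2 := h.1
    have h3 : c s ≤ (range (lam.length + 1)).sup c := le_sup (mem_range.2 (by omega))
    have h4 := h.2.1
    exact ⟨s, e, k, ⟨⟨by omega, by omega, by omega⟩, h⟩, rfl⟩

theorem layerTile_mem_tilingOf (hl : Layered (height lam) lam.length c L) {s e k : ℕ}
    (hs : s ≤ e) (he : e ≤ lam.length) :
    layerTile lam s e k ∈ tilingOf lam c L ↔ IsRun c L s e k := by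
  rw [mem_tilingOf hl]
  constructor
  · rintro ⟨s', e', k', h, heq⟩
    have h1 := hl.run_end_le h
    have e1 : s = s' := congrArg (fun t => t.start.1) heq
    have e2 : e = e' := by
      rw [← layerTile_last hs he, heq, layerTile_last h.1 h1.2.1]
    have e3 : k = k' := by
      rw [← layer_layerTile (lam := lam) (s := s) (e := e) (k := k), heq, layer_layerTile]
    rwa [e1, e2, e3]
  · exact fun h => ⟨s, e, k, h, rfl⟩

theorem inLayers_tilingOf (hl : Layered (height lam) lam.length c L) :
    InLayers lam (tilingOf lam c L) := by
  intro t ht t' ht' hk x h1 h2 h1' h2'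
  obtain ⟨s, e, k, h, rfl⟩ := (mem_tilingOf hl).1 ht
  obtain ⟨s', e', k', h', rfl⟩ := (mem_tilingOf hl).1 ht'
  rw [layer_layerTile, layer_layerTile] at hk
  subst hk
  rw [layerTile_last h.1 (hl.run_end_le h).2.1] at h2
  rw [layerTile_last h'.1 (hl.run_end_le h').2.1] at h2'
  obtain ⟨rfl, rfl⟩ := h.unique h' h1 h2 h1' h2'
  rfl

theorem cover_tilingOf (hl : Layered (height lam) lam.length c L) (x : ℕ) :
    cover (tilingOf lam c L) x = c x := by
  refine (inLayers_tilingOf hl).card_eq (x := x) (fun t _ h => h) fun k => ⟨?_, ?_⟩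
  · rintro ⟨t, ht, ⟨h1, h2⟩, rfl⟩
    obtain ⟨s, e, k, h, rfl⟩ := (mem_tilingOf hl).1 ht
    rw [layerTile_last h.1 (hl.run_end_le h).2.1] at h2
    rw [layer_layerTile]
    refine ⟨(hl.run_end_le h).2.2, ?_⟩
    rcases h1.lt_or_eq with h1 | rfl
    · exact (h.2.2.2.1 x (mem_Ioc.2 ⟨h1, h2⟩)).trans (hl.le x)
    · exact h.2.1
  · rintro ⟨h1, h2⟩
    obtain ⟨s, e, h, h3, h4⟩ := hl.exists_run h1 h2
    refine ⟨layerTile lam s e k, (mem_tilingOf hl).2 ⟨s, e, k, h, rfl⟩, ⟨h3, ?_⟩, layer_layerTile⟩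
    rwa [layerTile_last h.1 (hl.run_end_le h).2.1]

theorem link_tilingOf (hl : Layered (height lam) lam.length c L) (x : ℕ) :
    link (tilingOf lam c L) x = L x := by
  refine (inLayers_tilingOf hl).card_eq (x := x) (fun t _ h => ⟨h.1.le, h.2⟩) fun k => ⟨?_, ?_⟩
  · rintro ⟨t, ht, ⟨h1, h2⟩, rfl⟩
    obtain ⟨s, e, k, h, rfl⟩ := (mem_tilingOf hl).1 ht
    rw [layerTile_last h.1 (hl.run_end_le h).2.1] at h2
    rw [layer_layerTile]
    exact ⟨(hl.run_end_le h).2.2, h.2.2.2.1 x (mem_Ioc.2 ⟨h1, h2⟩)⟩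
  · rintro ⟨h1, h2⟩
    rcases x with _ | x
    · rw [hl.L_zero] at h2; omega
    obtain ⟨s, e, h, h3, h4⟩ := hl.exists_run_of_le h1 h2
    refine ⟨layerTile lam s e k, (mem_tilingOf hl).2 ⟨s, e, k, h, rfl⟩,
      ⟨Nat.lt_succ_of_le h3, ?_⟩, layer_layerTile⟩
    rw [layerTile_last h.1 (hl.run_end_le h).2.1]
    exact h4

/-- The tiles having the same length as a given tile of positive height. -/
theorem card_filter_tilingOf (hl : Layered (height lam) lam.length c L)
    (hb : ∀ t ∈ tilingOf lam c L, IsBallotPath t.path)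
    (ha : IsAnchored lam (tilingOf lam c L)) {s k : ℕ} (hr : IsRun c L s lam.length k)
    (hn : 1 ≤ (layerTile lam s lam.length k).n') :
    #{t ∈ tilingOf lam c L | t.n = (layerTile lam s lam.length k).n ∧
      t.n' = (layerTile lam s lam.length k).n'} =
        #{k' ∈ Icc 1 (c s) | IsRun c L s lam.length k'} := by
  rw [← card_image_of_injOn (s := {k' ∈ Icc 1 (c s) | IsRun c L s lam.length k'})
    (f := fun k' => layerTile lam s lam.length k')]
  · congr 1
    ext t
    rw [mem_filter, mem_image]
    have hl0 := (Tile.length_eq_of_isBallotPath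
      (hb _ ((layerTile_mem_tilingOf hl hr.1 le_rfl).2 hr))).1
    rw [length_layerTile le_rfl] at hl0
    constructor
    · rintro ⟨ht, h1, h2⟩
      obtain ⟨s', e', k', h, rfl⟩ := (mem_tilingOf hl).1 ht
      -- A tile of positive height is anchored, so equal length forces equal first column.
      have he := ha _ ht (by omega)
      have hre := hl.run_end_le h
      have hl1 := (Tile.length_eq_of_isBallotPath (hb _ ht)).1
      rw [h1, h2, ← hl0] at hl1
      have h3 := h.1
      have h4 := hr.1
      change (layerTile lam s' e' k').last = _ at he
      rw [layerTile_last h.1 hre.2.1] at he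
      rw [length_layerTile hre.2.1] at hl1
      obtain rfl : s' = s := by omega
      subst he
      exact ⟨k', mem_filter.2 ⟨mem_Icc.2 ⟨hre.2.2, h.2.1⟩, h⟩, rfl⟩
    · rintro ⟨k', hk', rfl⟩
      rw [mem_filter] at hk'
      exact ⟨(layerTile_mem_tilingOf hl hr.1 le_rfl).2 hk'.2, rfl, rfl⟩
  · intro k₁ _ k₂ _ e
    simp only at e
    rw [← layer_layerTile (lam := lam) (s := s) (e := lam.length) (k := k₁), e, layer_layerTile]

/-- The tiles of a layered configuration form a tiling of type BI. -/
theorem tilingOf_mem_tilingsBI {mu : List DyckStep}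
    (hl : Layered (height lam) lam.length c L) (hb : HasBallotRuns (height lam) lam.length c L)
    (hc : ∀ x ≤ lam.length, height mu x = height lam x + 2 * c x) :
    tilingOf lam c L ∈ tilingsBI lam mu := by
  have hballot : ∀ t ∈ tilingOf lam c L, IsBallotPath t.path := by
    intro t ht
    obtain ⟨s, e, k, h, rfl⟩ := (mem_tilingOf hl).1 ht
    exact (isBallotPath_layerTile h.1 (hl.run_end_le h).2.1).2 (hb.le s e k h)
  have hpos : ∀ s e k, IsRun c L s e k → 1 ≤ (layerTile lam s e k).n' →
      height lam s < height lam e := by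
    intro s e k h hn
    have := n'_layerTile h.1 (hl.run_end_le h).2.1
      (hballot _ ((mem_tilingOf hl).2 ⟨s, e, k, h, rfl⟩))
    omega
  have hanch : IsAnchored lam (tilingOf lam c L) := by
    intro t ht hn
    obtain ⟨s, e, k, h, rfl⟩ := (mem_tilingOf hl).1 ht
    change (layerTile lam s e k).last = _
    rw [layerTile_last h.1 (hl.run_end_le h).2.1]
    exact (hb.anchored s e k h (hpos s e k h hn)).1
  have hboxes : ∀ t ∈ tilingOf lam c L, ∀ b ∈ t.boxes, b ∈ skewShape lam mu := by
    intro t ht b hbt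
    obtain ⟨s, e, k, h, rfl⟩ := (mem_tilingOf hl).1 ht
    have hre := hl.run_end_le h
    obtain ⟨h1, h2, h3⟩ := (mem_boxes_layerTile h.1 hre.2.1).1 hbt
    rw [show b = (b.1, b.2) from rfl, mem_skewShape_iff hc]
    refine ⟨⟨by omega, by omega⟩, k, hre.2.2, ?_, h3⟩
    rcases h1.lt_or_eq with h1 | h1
    · exact (h.2.2.2.1 _ (mem_Ioc.2 ⟨h1, h2⟩)).trans (hl.le _)
    · rw [← h1]; exact h.2.1
  rw [tilingsBI, mem_filter, mem_powerset]
  refine ⟨?_, ⟨hballot, ?_, ?_⟩, ?_, hanch, ?_⟩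
  · intro t ht
    rw [candidateTiles, mem_image]
    obtain ⟨s, e, k, h, rfl⟩ := (mem_tilingOf hl).1 ht
    have hre := hl.run_end_le h
    refine ⟨((layerTile lam s e k).start, (layerTile lam s e k).path), mem_product.2 ⟨?_, ?_⟩, rfl⟩
    · exact hboxes _ ht _ ((mem_boxes_layerTile h.1 hre.2.1).2 ⟨le_rfl, h.1, rfl⟩)
    · rw [mem_biUnion]
      have := h.1
      exact ⟨e - s, mem_range.2 (by omega), mem_words.2 (length_layerTile (k := k) hre.2.1)⟩
  · intro t ht t' ht' hne
    rw [disjoint_left]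
    intro b hb1 hb2
    apply hne
    have h1 := (Tile.mem_boxes.1 hb1)
    have h2 := (Tile.mem_boxes.1 hb2)
    refine inLayers_tilingOf hl t ht t' ht' ?_ b.1 h1.1 h1.2.1 h2.1 h2.2.1
    obtain ⟨s, e, k, h, rfl⟩ := (mem_tilingOf hl).1 ht
    obtain ⟨s', e', k', h', rfl⟩ := (mem_tilingOf hl).1 ht'
    have e1 := ((mem_boxes_layerTile h.1 (hl.run_end_le h).2.1).1 hb1).2.2
    have e2 := ((mem_boxes_layerTile h'.1 (hl.run_end_le h').2.1).1 hb2).2.2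
    rw [layer_layerTile, layer_layerTile]
    omega
  · apply subset_antisymm
    · intro b hb1
      rw [mem_biUnion] at hb1
      obtain ⟨t, ht, hbt⟩ := hb1
      exact hboxes t ht b hbt
    · rintro ⟨x, y⟩ hb1
      rw [mem_skewShape_iff hc] at hb1
      obtain ⟨hx, k, hk1, hk2, rfl⟩ := hb1
      obtain ⟨s, e, h, h3, h4⟩ := hl.exists_run hk1 hk2
      rw [mem_biUnion]
      exact ⟨_, (mem_tilingOf hl).2 ⟨s, e, k, h, rfl⟩,
        (mem_boxes_layerTile h.1 (hl.run_end_le h).2.1).2 ⟨h3, h4, rfl⟩⟩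
  · intro t ht
    obtain ⟨s, e, k, h, rfl⟩ := (mem_tilingOf hl).1 ht
    have hre := hl.run_end_le h
    rcases hre.2.2.lt_or_eq with hk | rfl
    · right
      obtain ⟨k, rfl⟩ := Nat.exists_eq_add_of_lt hk
      have h5 := h.2.1
      -- Joins persist in lower layers, so the tile one layer down through column s reaches at least
      -- as far to the right.
      obtain ⟨s', e', h', h3, h4⟩ := hl.exists_run (x := s) (k := 1 + k) (by omega) (by omega)
      have hee : e ≤ e' := by
        by_contra hlt
        have := h.2.2.2.1 (e' + 1) (mem_Ioc.2 ⟨by omega, by omega⟩)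
        have := h'.2.2.2.2
        omega
      refine ⟨layerTile lam s' e' (1 + k), (mem_tilingOf hl).2 ⟨s', e', _, h', rfl⟩, ?_, ?_⟩
      · intro heq
        have := congrArg (Tile.layer lam) heq
        rw [layer_layerTile, layer_layerTile] at this
        omega
      · intro b hbt
        obtain ⟨h6, h7, h8⟩ := (mem_boxes_layerTile h.1 hre.2.1).1 hbt
        rw [mem_boxes_layerTile h'.1 (hl.run_end_le h').2.1]
        refine ⟨by simp only; omega, by simp only; omega, ?_⟩
        simp only [h8]; push_cast; ring
    · left
      intro b hbt
      obtain ⟨h6, h7, h8⟩ := (mem_boxes_layerTile h.1 hre.2.1).1 hbt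
      rw [h8]; push_cast; omega
  · intro t ht hn
    obtain ⟨s, e, k, h, rfl⟩ := (mem_tilingOf hl).1 ht
    obtain ⟨rfl, hodd, hev⟩ := hb.anchored s e k h (hpos s e k h hn)
    refine ⟨?_, ?_⟩
    · rw [← n'_layerTile h.1 le_rfl (hballot _ ht)] at hodd
      exact_mod_cast hodd
    · rwa [card_filter_tilingOf hl hballot hanch h hn]

end TilingOf

end BallotTiling

namespace BallotTiling

open Finset

theorem eq_Icc_of_pred_mem {S : Finset ℕ} (h0 : 0 ∉ S)
    (h : ∀ k, 1 ≤ k → k + 1 ∈ S → k ∈ S) : S = Icc 1 #S := by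
  have hdown : ∀ d k, 1 ≤ k → k + d ∈ S → k ∈ S := by
    intro d
    induction d with
    | zero => exact fun k _ hk => hk
    | succ d ih => exact fun k hk hd => ih k hk (h (k + d) (by omega) hd)
  apply eq_of_subset_of_card_le
  · intro k hk
    have hk0 : 1 ≤ k := Nat.one_le_iff_ne_zero.2 (by rintro rfl; exact h0 hk)
    rw [mem_Icc]
    refine ⟨hk0, ?_⟩
    have hsub : Icc 1 k ⊆ S := by
      intro j hj
      rw [mem_Icc] at hj
      exact hdown (k - j) j hj.1 (by rwa [Nat.add_sub_cancel' hj.2])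
    have := card_le_card hsub
    rwa [Nat.card_Icc, Nat.add_sub_cancel] at this
  · rw [Nat.card_Icc, Nat.add_sub_cancel]

/-! ### From cover-inclusive tilings to layered configurations. -/

section OfTiling

variable {lam mu : List DyckStep} {T : Finset Tile}

/-- Each tile of a cover-inclusive tiling lies in a single layer. -/
theorem exists_layer (hlam : IsBallotPath lam) (hT : IsBallotTiling lam mu T)
    (hci : IsCoverInclusive lam T) {t : Tile} (ht : t ∈ T) :
    1 ≤ t.start.1 ∧ t.last ≤ lam.length ∧
      ∃ k, 1 ≤ k ∧ t = layerTile lam t.start.1 t.last k := by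
  have hbox : ∀ t ∈ T, ∀ b ∈ t.boxes, (1 ≤ b.1 ∧ b.1 ≤ lam.length) ∧
      (height lam b.1 < b.2 ∧ b.2 < height mu b.1) ∧ Odd ((b.1 : ℤ) + b.2) := by
    intro t ht b hb
    rw [← mem_skewShape, ← hT.2.2, mem_biUnion]
    exact ⟨t, ht, hb⟩
  have hend : ∀ t ∈ T, 1 ≤ t.start.1 ∧ t.last ≤ lam.length := by
    intro t ht
    have h1 := hbox t ht t.start
      (Tile.mem_boxes.2 ⟨le_rfl, by simp [Tile.last], by simp [height_zero]⟩)
    have h2 := hbox t ht (t.last, t.start.2 + height t.path (t.last - t.start.1))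
      (Tile.mem_boxes.2 ⟨by simp [Tile.last], le_rfl, rfl⟩)
    exact ⟨h1.1.1, h2.1.2⟩
  refine ⟨(hend t ht).1, (hend t ht).2, ?_⟩
  -- Induction on a bound for the height of the leftmost box. If the translate of t lies in a tile
  -- s, the leftmost box of s is not above the translate of that of t, because s is a ballot tile;
  -- so s comes earlier. If the translate lies below the path, parity puts t in the first layer.
  obtain ⟨m, hm⟩ : ∃ m : ℕ, t.start.2 < m := ⟨t.start.2.toNat + 1, by omega⟩
  induction m generalizing t with
  | zero =>
    have h1 := hbox t ht t.start
      (Tile.mem_boxes.2 ⟨le_rfl, by simp [Tile.last], by simp [height_zero]⟩)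
    have h2 := hlam _ h1.1.2
    push_cast at hm
    omega
  | succ m ih =>
    rcases hci t ht with h | ⟨s, hs, -, h⟩
    · refine ⟨1, le_rfl, eq_layerTile (hend t ht).2 fun b hb => ?_⟩
      have h1 := h b hb
      obtain ⟨h2, ⟨h3, -⟩, ⟨r, hr⟩⟩ := hbox t ht b hb
      obtain ⟨r', hr'⟩ := even_height_sub h2.2
      push_cast
      omega
    · have h0 := h t.start (Tile.mem_boxes.2 ⟨le_rfl, by simp [Tile.last], by simp [height_zero]⟩)
      have hsb := (Tile.mem_boxes.1 h0)
      simp only at hsb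
      have hbal := hT.1 s hs (t.start.1 - s.start.1) (by have := hsb.2.1; rw [Tile.last] at this; omega)
      obtain ⟨k, hk, hsk⟩ := ih hs (by push_cast at hm; omega)
      refine ⟨k + 1, by omega, eq_layerTile (hend t ht).2 fun b hb => ?_⟩
      have h1 := h b hb
      rw [hsk, mem_boxes_layerTile (by simp [Tile.last]) (hend s hs).2] at h1
      have := h1.2.2
      simp only at this
      push_cast
      omega

theorem inLayers_of_tiling (hlam : IsBallotPath lam) (hT : IsBallotTiling lam mu T)
    (hci : IsCoverInclusive lam T) : InLayers lam T := by
  intro t ht t' ht' hk x h1 h2 h3 h4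
  by_contra hne
  obtain ⟨-, h5, k, -, h6⟩ := exists_layer hlam hT hci ht
  obtain ⟨-, h5', k', -, h6'⟩ := exists_layer hlam hT hci ht'
  rw [h6, h6', layer_layerTile, layer_layerTile] at hk
  subst hk
  have hb : (x, height lam x + 2 * k - 1) ∈ t.boxes := by
    rw [h6, mem_boxes_layerTile (by simp [Tile.last]) h5]
    exact ⟨h1, h2, rfl⟩
  have hb' : (x, height lam x + 2 * k - 1) ∈ t'.boxes := by
    rw [h6', mem_boxes_layerTile (by simp [Tile.last]) h5']
    exact ⟨h3, h4, rfl⟩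
  exact disjoint_left.1 (hT.2.1 t ht t' ht' hne) hb hb'

theorem exists_mem_layer_iff (hlam : IsBallotPath lam) (hT : IsBallotTiling lam mu T)
    (hci : IsCoverInclusive lam T) {c : ℕ → ℕ}
    (hc : ∀ x ≤ lam.length, height mu x = height lam x + 2 * c x)
    {x : ℕ} (hx : 1 ≤ x) (hx' : x ≤ lam.length) (k : ℕ) :
    (∃ t ∈ T, (t.start.1 ≤ x ∧ x ≤ t.last) ∧ t.layer lam = k) ↔ 1 ≤ k ∧ k ≤ c x := by
  have hbox : ∀ t ∈ T, ∀ j, t = layerTile lam t.start.1 t.last j → t.last ≤ lam.length →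
      ((t.start.1 ≤ x ∧ x ≤ t.last) ↔ (x, height lam x + 2 * j - 1) ∈ t.boxes) := by
    intro t ht j hj hl
    rw [hj, mem_boxes_layerTile (by simp [Tile.last]) hl, ← hj]
    simp
  constructor
  · rintro ⟨t, ht, hc1, rfl⟩
    obtain ⟨-, h2, k, h3, h4⟩ := exists_layer hlam hT hci ht
    have hmem := (hbox t ht k h4 h2).1 hc1
    have : (x, height lam x + 2 * k - 1) ∈ skewShape lam mu := by
      rw [← hT.2.2, mem_biUnion]; exact ⟨t, ht, hmem⟩
    obtain ⟨-, k', hk1, hk2, hk3⟩ := (mem_skewShape_iff hc).1 this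
    rw [h4, layer_layerTile]
    obtain rfl : k = k' := by omega
    exact ⟨hk1, hk2⟩
  · rintro ⟨hk1, hk2⟩
    have : (x, height lam x + 2 * k - 1) ∈ skewShape lam mu :=
      (mem_skewShape_iff hc).2 ⟨⟨hx, hx'⟩, k, hk1, hk2, rfl⟩
    rw [← hT.2.2, mem_biUnion] at this
    obtain ⟨t, ht, hbt⟩ := this
    obtain ⟨-, h2, j, h3, h4⟩ := exists_layer hlam hT hci ht
    have hb := hbt
    rw [h4, mem_boxes_layerTile (by simp [Tile.last]) h2] at hb
    have hjk := hb.2.2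
    simp only at hjk
    obtain rfl : k = j := by omega
    refine ⟨t, ht, (hbox t ht k h4 h2).2 hbt, ?_⟩
    rw [h4, layer_layerTile]

theorem exists_mem_cover_iff (hlam : IsBallotPath lam) (hT : IsBallotTiling lam mu T)
    (hci : IsCoverInclusive lam T) (habove : IsAbove mu lam) (x k : ℕ) :
    (∃ t ∈ T, (t.start.1 ≤ x ∧ x ≤ t.last) ∧ t.layer lam = k) ↔ 1 ≤ k ∧ k ≤ cover T x := by
  have hil := inLayers_of_tiling hlam hT hci
  have hc : ∀ x ≤ lam.length, height mu x = height lam x +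
      2 * (((height mu x - height lam x) / 2).toNat : ℕ) := by
    intro x hx
    have h1 := habove.2 x hx
    obtain ⟨r, hr⟩ := even_height_sub hx
    obtain ⟨r', hr'⟩ := even_height_sub (l := mu) (i := x) (by rw [habove.1]; exact hx)
    omega
  by_cases hx : 1 ≤ x ∧ x ≤ lam.length
  · have h1 := exists_mem_layer_iff hlam hT hci hc hx.1 hx.2
    have h2 : cover T x = _ := hil.card_eq (x := x) (fun t _ h => h) h1
    rw [h2]; exact h1 k
  · have h1 : ∀ k, (∃ t ∈ T, (t.start.1 ≤ x ∧ x ≤ t.last) ∧ t.layer lam = k) ↔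
        1 ≤ k ∧ k ≤ 0 := by
      intro k
      constructor
      · rintro ⟨t, ht, h1, -⟩
        obtain ⟨h2, h3, -⟩ := exists_layer hlam hT hci ht
        omega
      · omega
    have h2 : cover T x = 0 := hil.card_eq (x := x) (fun t _ h => h) h1
    rw [h2]; exact h1 k

theorem height_eq_cover (hlam : IsBallotPath lam) (hT : IsBallotTiling lam mu T)
    (hci : IsCoverInclusive lam T) (habove : IsAbove mu lam) {x : ℕ} (hx : x ≤ lam.length) :
    height mu x = height lam x + 2 * cover T x := by
  have hc : ∀ x ≤ lam.length, height mu x = height lam x +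
      2 * (((height mu x - height lam x) / 2).toNat : ℕ) := by
    intro x hx
    have h1 := habove.2 x hx
    obtain ⟨r, hr⟩ := even_height_sub hx
    obtain ⟨r', hr'⟩ := even_height_sub (l := mu) (i := x) (by rw [habove.1]; exact hx)
    omega
  rcases Nat.eq_zero_or_pos x with rfl | hx0
  · have : cover T 0 = 0 := by
      rw [cover, card_eq_zero, filter_eq_empty_iff]
      intro t ht h
      have := (exists_layer hlam hT hci ht).1
      omega
    rw [this, height_zero, height_zero]; rfl
  · have h1 := exists_mem_layer_iff hlam hT hci hc hx0 hx
    have h2 : cover T x = _ :=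
      (inLayers_of_tiling hlam hT hci).card_eq (x := x) (fun t _ h => h) h1
    rw [h2]; exact hc x hx

/-- If a tile of layer k + 1 joins the columns x - 1 and x, the tile that contains its translate
joins them in layer k. Hence the joined layers form an initial segment, and their number determines
them. -/
theorem exists_mem_link_iff (hlam : IsBallotPath lam) (hT : IsBallotTiling lam mu T)
    (hci : IsCoverInclusive lam T) (x k : ℕ) :
    (∃ t ∈ T, (t.start.1 < x ∧ x ≤ t.last) ∧ t.layer lam = k) ↔ 1 ≤ k ∧ k ≤ link T x := by
  have hil := inLayers_of_tiling hlam hT hci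
  set S := ({t ∈ T | t.start.1 < x ∧ x ≤ t.last}).image (Tile.layer lam) with hS
  have hmem : ∀ k, (∃ t ∈ T, (t.start.1 < x ∧ x ≤ t.last) ∧ t.layer lam = k) ↔ k ∈ S := by
    intro k
    rw [hS, mem_image]
    simp only [mem_filter, and_assoc]
  have hpos : ∀ t ∈ T, 1 ≤ t.layer lam := by
    intro t ht
    obtain ⟨-, -, j, h3, h4⟩ := exists_layer hlam hT hci ht
    rwa [h4, layer_layerTile]
  have hIcc : S = Icc 1 #S := by
    apply eq_Icc_of_pred_mem
    · intro h0
      obtain ⟨t, ht, -, h⟩ := (hmem 0).2 h0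
      have := hpos t ht
      omega
    · intro k hk hk1
      obtain ⟨t, ht, h1, h2⟩ := (hmem _).2 hk1
      rw [← hmem]
      obtain ⟨a1, a2, j, h3, h4⟩ := exists_layer hlam hT hci ht
      have hj : j = k + 1 := by rw [← h2, h4, layer_layerTile]
      subst hj
      have hb : ∀ y, t.start.1 ≤ y → y ≤ t.last → (y, height lam y + 2 * ((k + 1 : ℕ) : ℤ) - 1)
          ∈ t.boxes := by
        intro y y1 y2
        rw [h4, mem_boxes_layerTile (by simp [Tile.last]) a2]
        exact ⟨y1, y2, rfl⟩
      rcases hci t ht with h | ⟨s, hs, -, h⟩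
      · have := h _ (hb x h1.1.le h1.2)
        simp only at this
        push_cast at this
        omega
      · obtain ⟨b1, b2, i, h5, h6⟩ := exists_layer hlam hT hci hs
        have c1 := h _ (hb x h1.1.le h1.2)
        have c2 := h _ (hb (x - 1) (by omega) (by omega))
        rw [h6, mem_boxes_layerTile (by simp [Tile.last]) b2] at c1 c2
        simp only at c1 c2
        refine ⟨s, hs, ⟨by omega, by omega⟩, ?_⟩
        rw [h6, layer_layerTile]
        push_cast at c1
        omega
  have h1 : ∀ k, (∃ t ∈ T, (t.start.1 < x ∧ x ≤ t.last) ∧ t.layer lam = k) ↔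
      1 ≤ k ∧ k ≤ #S := by
    intro k
    rw [hmem, ← mem_Icc, ← hIcc]
  have h2 : link T x = _ := hil.card_eq (x := x) (fun t _ h => ⟨h.1.le, h.2⟩) h1
  rw [h2]; exact h1 k

theorem layered_of_tiling (hlam : IsBallotPath lam) (hT : IsBallotTiling lam mu T)
    (hci : IsCoverInclusive lam T) (habove : IsAbove mu lam) :
    Layered (height lam) lam.length (cover T) (link T) := by
  have hzero : ∀ x, (x = 0 ∨ lam.length < x) → cover T x = 0 := by
    intro x hx
    rw [cover, card_eq_zero, filter_eq_empty_iff]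
    intro t ht h
    obtain ⟨h1, h2, -⟩ := exists_layer hlam hT hci ht
    omega
  have hstep : ∀ x < lam.length, height mu (x + 1) = height mu x + 1 ∨
      height mu (x + 1) = height mu x - 1 := fun x hx =>
    height_succ_or (by rw [habove.1]; exact hx)
  refine ⟨hzero 0 (Or.inl rfl), fun x hx => hzero x (Or.inr hx), fun x => ?_, fun x => ?_,
    fun x hx h => ?_, fun x hx h => ?_⟩
  · refine card_le_card fun t ht => ?_
    rw [mem_filter] at ht ⊢
    exact ⟨ht.1, ht.2.1.le, ht.2.2⟩
  · refine card_le_card fun t ht => ?_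
    rw [mem_filter] at ht ⊢
    exact ⟨ht.1, by omega, by omega⟩
  · have h1 := height_eq_cover hlam hT hci habove hx.le
    have h2 := height_eq_cover hlam hT hci habove (Nat.succ_le_of_lt hx)
    have := hstep x hx
    rw [Nat.succ_eq_add_one] at h2
    omega
  · have h1 := height_eq_cover hlam hT hci habove hx.le
    have h2 := height_eq_cover hlam hT hci habove (Nat.succ_le_of_lt hx)
    have := hstep x hx
    rw [Nat.succ_eq_add_one] at h2
    omega

/-- The tiles of a layer are the maximal chains of joined columns, so the tiling is recovered from
its two counting functions. -/
theorem eq_tilingOf (hlam : IsBallotPath lam) (hT : IsBallotTiling lam mu T)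
    (hci : IsCoverInclusive lam T) (habove : IsAbove mu lam) :
    T = tilingOf lam (cover T) (link T) := by
  have hl := layered_of_tiling hlam hT hci habove
  have hil := inLayers_of_tiling hlam hT hci
  ext t
  rw [mem_tilingOf hl]
  constructor
  · intro ht
    obtain ⟨h1, h2, k, h3, h4⟩ := exists_layer hlam hT hci ht
    have hk : t.layer lam = k := by rw [h4, layer_layerTile]
    have hle : t.start.1 ≤ t.last := by simp [Tile.last]
    refine ⟨_, _, k, ⟨hle, ?_, ?_, fun i hi => ?_, ?_⟩, h4⟩
    · exact ((exists_mem_cover_iff hlam hT hci habove _ k).1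
        ⟨t, ht, ⟨le_rfl, hle⟩, hk⟩).2
    · by_contra hlt
      obtain ⟨t', ht', h5, h6⟩ := (exists_mem_link_iff hlam hT hci _ k).2 ⟨h3, not_lt.1 hlt⟩
      have := hil t ht t' ht' (by rw [hk, h6]) _ le_rfl hle h5.1.le h5.2
      rw [← this] at h5
      omega
    · rw [mem_Ioc] at hi
      exact ((exists_mem_link_iff hlam hT hci _ k).1 ⟨t, ht, hi, hk⟩).2
    · by_contra hlt
      obtain ⟨t', ht', h5, h6⟩ := (exists_mem_link_iff hlam hT hci _ k).2 ⟨h3, not_lt.1 hlt⟩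
      have := hil t ht t' ht' (by rw [hk, h6]) t.last hle le_rfl (by omega) (by omega)
      rw [← this] at h5
      omega
  · rintro ⟨s, e, k, h, rfl⟩
    have hre := hl.run_end_le h
    obtain ⟨t, ht, h1, h2⟩ := (exists_mem_cover_iff hlam hT hci habove s k).2 ⟨hre.2.2, h.2.1⟩
    obtain ⟨-, -, j, -, h4⟩ := exists_layer hlam hT hci ht
    obtain rfl : k = j := by rw [← h2, h4, layer_layerTile]
    have e1 : t.start.1 = s := by
      refine le_antisymm h1.1 ?_
      by_contra hlt
      have := ((exists_mem_link_iff hlam hT hci s k).1 ⟨t, ht, ⟨by omega, h1.2⟩, h2⟩).2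
      have := h.2.2.1
      omega
    have e2 : t.last = e := by
      rcases lt_trichotomy t.last e with hlt | he | hlt
      · have h5 := h.2.2.2.1 (t.last + 1) (mem_Ioc.2 ⟨by omega, by omega⟩)
        obtain ⟨t', ht', h6, h7⟩ := (exists_mem_link_iff hlam hT hci _ k).2 ⟨hre.2.2, h5⟩
        have := hil t ht t' ht' (by rw [h2, h7]) t.last (by omega) le_rfl (by omega)
          (by omega)
        rw [← this] at h6
        omega
      · exact he
      · have h8 := h.1
        have := ((exists_mem_link_iff hlam hT hci (e + 1) k).1
          ⟨t, ht, ⟨by omega, by omega⟩, h2⟩).2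
        have := h.2.2.2.2
        omega
    rwa [← e1, ← e2, ← h4]

theorem hasBallotRuns_of_tiling (hlam : IsBallotPath lam) (hT : T ∈ tilingsBI lam mu)
    (habove : IsAbove mu lam) :
    HasBallotRuns (height lam) lam.length (cover T) (link T) := by
  rw [tilingsBI, mem_filter] at hT
  obtain ⟨-, hbt, hci, han, hBI⟩ := hT
  have hl := layered_of_tiling hlam hbt hci habove
  have heq := eq_tilingOf hlam hbt hci habove
  have hmem : ∀ s e k, IsRun (cover T) (link T) s e k → layerTile lam s e k ∈ T := by
    intro s e k h
    rw [heq, mem_tilingOf hl]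
    exact ⟨s, e, k, h, rfl⟩
  refine ⟨fun s e k h => ?_, fun s e k h hlt => ?_⟩
  · exact (isBallotPath_layerTile h.1 (hl.run_end_le h).2.1).1 (hbt.1 _ (hmem s e k h))
  · have ht := hmem s e k h
    have hre := hl.run_end_le h
    have hn' := n'_layerTile h.1 hre.2.1 (hbt.1 _ ht)
    have hn : 1 ≤ (layerTile lam s e k).n' := by omega
    have he := han _ ht hn
    change (layerTile lam s e k).last = _ at he
    rw [layerTile_last h.1 hre.2.1] at he
    subst he
    obtain ⟨h1, h2⟩ := hBI _ ht hn
    refine ⟨rfl, ?_, ?_⟩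
    · rw [← hn']; exact_mod_cast h1
    · rw [← card_filter_tilingOf hl (by rw [← heq]; exact hbt.1) (by rw [← heq]; exact han) h hn,
        ← heq]
      exact h2

end OfTiling

/-! ### The statistic of a tiling -/

section Art

variable {lam : List DyckStep} {c L : ℕ → ℕ}

theorem sum_card_filter_Ioc {N : ℕ} (T : Finset Tile) (a b : Tile → ℕ)
    (hb : ∀ t ∈ T, b t ≤ N) :
    ∑ t ∈ T, (b t - a t) = ∑ x ∈ Ioc 0 N, #{t ∈ T | a t < x ∧ x ≤ b t} := by
  simp only [card_filter]
  rw [sum_comm]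
  refine sum_congr rfl fun t ht => ?_
  rw [← card_filter, ← Nat.card_Ioc]
  congr 1
  ext x
  have := hb t ht
  simp only [mem_filter, mem_Ioc]
  omega

/-- Counting by columns, the tiles have Σc boxes and ΣL joins in total, and the tiles of positive
height number Σ(L(s+1) - L(s)) over the ballot starts. These three totals determine the statistic
through `IsValuation.two_mul_weight`. -/
theorem sum_art_tilingOf (hl : Layered (height lam) lam.length c L) {T : PlaneTree EdgeMark}
    (hT : IsSpined T) {o : ℕ} (hh : FollowsWord (height lam) T o) (hv : IsValuation c L T o 0)
    (hN : o + 2 * T.numEdges = lam.length) (hco : ∀ x ≤ o, c x = 0) :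
    ∑ t ∈ tilingOf lam c L, t.art = valuationWeight c L T o := by
  have hcases := fun s e k (h : IsRun c L s e k) =>
    hv.run_cases hl hT hh hN (fun x hx _ => hco x hx) h
  have hballot : ∀ t ∈ tilingOf lam c L, IsBallotPath t.path := by
    intro t ht
    obtain ⟨s, e, k, h, rfl⟩ := (mem_tilingOf hl).1 ht
    exact (isBallotPath_layerTile h.1 (hl.run_end_le h).2.1).2 (hcases s e k h).1
  have hn' : ∀ s e k, IsRun c L s e k →
      if s ∈ ballotStarts T o ∧ k ≤ L (s + 1) then
        e = lam.length ∧ Odd (layerTile lam s e k).n' else (layerTile lam s e k).n' = 0 := by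
    intro s e k h
    have h1 := n'_layerTile h.1 (hl.run_end_le h).2.1
      (hballot _ ((mem_tilingOf hl).2 ⟨s, e, k, h, rfl⟩))
    have h2 := (hcases s e k h).2
    split_ifs at h2 ⊢
    · refine ⟨h2.1, ?_⟩
      rw [← h1] at h2
      exact_mod_cast h2.2.2
    · omega
  have hlast : ∀ t ∈ tilingOf lam c L, 1 ≤ t.start.1 ∧ t.last ≤ lam.length := by
    intro t ht
    obtain ⟨s, e, k, h, rfl⟩ := (mem_tilingOf hl).1 ht
    have hre := hl.run_end_le h
    rw [layerTile_last h.1 hre.2.1]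
    exact ⟨hre.1, hre.2.1⟩
  have h1 : ∑ t ∈ tilingOf lam c L, (t.path.length + 1) = ∑ x ∈ Ioc 0 lam.length, c x := by
    rw [sum_congr rfl fun x _ => (cover_tilingOf hl x).symm]
    rw [sum_congr rfl (g := fun t : Tile => t.last - (t.start.1 - 1))
      fun t ht => by have := hlast t ht; simp only [Tile.last] at *; omega,
      sum_card_filter_Ioc _ _ _ fun t ht => (hlast t ht).2]
    refine sum_congr rfl fun x hx => congrArg card (filter_congr fun t ht => ?_)
    have := hlast t ht
    rw [mem_Ioc] at hx
    omega
  have h2 : ∑ t ∈ tilingOf lam c L, t.path.length = ∑ x ∈ Ioc 0 lam.length, L x := by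
    rw [sum_congr rfl fun x _ => (link_tilingOf hl x).symm]
    rw [sum_congr rfl (g := fun t : Tile => t.last - t.start.1)
      fun t ht => by simp only [Tile.last]; omega,
      sum_card_filter_Ioc _ _ _ fun t ht => (hlast t ht).2]
    rfl
  have h3 : #{t ∈ tilingOf lam c L | ¬ t.n' = 0} = ∑ s ∈ ballotStarts T o, (L (s + 1) - L s) := by
    rw [← sum_congr rfl fun s _ => Nat.card_Ioc (L s) (L (s + 1)), ← card_sigma]
    symm
    refine card_bij (fun p _ => layerTile lam p.1 lam.length p.2) ?_ ?_ ?_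
    · rintro ⟨s, k⟩ hp
      rw [mem_sigma, mem_Ioc] at hp
      dsimp only at hp ⊢
      obtain ⟨b1, -, -, -, -, -⟩ := hv.of_mem_ballotStarts hT hh hN hp.1
      have hs := le_of_mem_ballotStarts hT hp.1
      have hr : IsRun c L s lam.length k := by
        refine ⟨by omega, hp.2.2.trans (hl.le_pred s), hp.2.1, fun i hi => ?_, ?_⟩
        · rw [mem_Ioc] at hi
          exact hp.2.2.trans (b1 i hi.1 hi.2)
        · rw [hl.L_top (Nat.lt_succ_self _)]; have := hp.2.1; omega
      have := hn' _ _ _ hr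
      rw [if_pos ⟨hp.1, hp.2.2⟩] at this
      refine mem_filter.2 ⟨(mem_tilingOf hl).2 ⟨s, _, k, hr, rfl⟩, ?_⟩
      exact this.2.pos.ne'
    · rintro ⟨s, k⟩ _ ⟨s', k'⟩ _ heq
      have e1 : s = s' := congrArg (fun t => t.start.1) heq
      subst e1
      have e2 := congrArg (Tile.layer lam) heq
      rw [layer_layerTile, layer_layerTile] at e2
      simp only at e2
      rw [e2]
    · intro t ht
      rw [mem_filter] at ht
      obtain ⟨s, e, k, h, rfl⟩ := (mem_tilingOf hl).1 ht.1
      have := hn' _ _ _ h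
      split_ifs at this with hst
      · refine ⟨⟨s, k⟩, mem_sigma.2 ⟨hst.1, mem_Ioc.2 ⟨h.2.2.1, hst.2⟩⟩, ?_⟩
        rw [this.1]
      · exact absurd this ht.2
  have h4 : ∑ t ∈ tilingOf lam c L, 2 * t.art =
      ∑ t ∈ tilingOf lam c L, (t.path.length + 1 + if t.n' = 0 then 1 else 0) := by
    refine sum_congr rfl fun t ht => Tile.two_mul_art (hballot t ht) ?_
    obtain ⟨s, e, k, h, rfl⟩ := (mem_tilingOf hl).1 ht
    have := hn' _ _ _ h
    split_ifs at this
    · exact Or.inr this.2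
    · exact Or.inl this
  rw [← mul_sum, sum_add_distrib, ← card_filter, h1] at h4
  rw [sum_add_distrib, h2] at h1
  have h5 := card_filter_add_card_filter_not (s := tilingOf lam c L) (fun t => t.n' = 0)
  rw [h3] at h5
  have h6 := hv.two_mul_weight hT
  have h7 : ∀ f : ℕ → ℕ, (∀ x ≤ o, f x = 0) →
      ∑ x ∈ Ioc o (o + 2 * T.numEdges), f x = ∑ x ∈ Ioc 0 lam.length, f x := by
    intro f hf
    rw [← hN, ← sum_Ioc_consecutive f (Nat.zero_le o) (by omega), sum_eq_zero (s := Ioc 0 o),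
      zero_add]
    intro x hx
    exact hf x (mem_Ioc.1 hx).2
  rw [h7 c hco, h7 L fun x hx => by have := hl.le x; have := hco x hx; omega] at h6
  simp only [sum_const, smul_eq_mul, mul_one] at h1
  omega

end Art

end BallotTiling

namespace BallotTiling

open Finset

/-! ### Sequences of column data -/

/-- The steps of a path without arrows: matched up and down steps, and unmatched up steps whose
number, counted from the right, is even or odd. -/
inductive StepKind
  | opening
  | closing
  | even
  | odd

/-- The kinds of the steps of the word of a tree. -/
def stepKinds : PlaneTree EdgeMark → List StepKind
  | .nil => []
  | .cons a F R =>
      if a.dot then .even :: .odd :: stepKinds F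
      else .opening :: (stepKinds F ++ .closing :: stepKinds R)

/-- The values that may follow the value `a` at an up step. -/
def downSteps (a : ℕ) : Finset ℕ := if a = 0 then {a} else {a, a - 1}

theorem mem_downSteps {a x : ℕ} : x ∈ downSteps a ↔ x = a ∨ x + 1 = a := by
  rw [downSteps]
  split_ifs with h
  · rw [mem_singleton]; omega
  · rw [mem_insert, mem_singleton]; omega

namespace StepKind

/-- The possible numbers of boxes in the next column. -/
def firsts : StepKind → ℕ → Finset ℕ
  | closing, a => {a, a + 1}
  | _, a => downSteps a

/-- The possible numbers of links to the next column. -/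
def seconds : StepKind → ℕ → ℕ → ℕ → Finset ℕ
  | opening, _, b, a' => Icc b a'
  | closing, a, b, _ => {l ∈ Icc b a | l = b}
  | even, _, b, a' => {l ∈ Icc b a' | l = b}
  | odd, _, b, a' => {l ∈ Icc b a' | Even (l - b)}

/-- The lower bounds after the step. -/
def next : StepKind → ℕ → List ℕ → List ℕ
  | opening, l, st => l :: st
  | closing, _, st => st.tail
  | even, _, st => st
  | odd, l, st => l :: st

/-- The contribution of the step to the weight. -/
def weight : StepKind → ℕ × ℕ → ℕ
  | opening, p => p.1 - p.2
  | closing, p => p.1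
  | even, p => p.1
  | odd, p => p.1 - p.2

end StepKind

/-- The sequences of column data along steps of the given kinds. -/
def columnData : List StepKind → ℕ → List ℕ → Finset (List (ℕ × ℕ))
  | [], _, _ => {[]}
  | k :: ks, a, st =>
      (k.firsts a).biUnion fun a' => (k.seconds a (st.headD 0) a').biUnion fun l =>
        (columnData ks a' (k.next l st)).image (List.cons (a', l))

/-- The weight of a sequence of column data. -/
def dataWeight : List StepKind → List (ℕ × ℕ) → ℕ
  | k :: ks, p :: w => k.weight p + dataWeight ks w
  | _, _ => 0

theorem nil_mem_columnData {a : ℕ} {st : List ℕ} {w : List (ℕ × ℕ)} :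
    w ∈ columnData [] a st ↔ w = [] := by
  rw [columnData, mem_singleton]

theorem cons_mem_columnData {k : StepKind} {ks : List StepKind} {a : ℕ} {st : List ℕ}
    {p : ℕ × ℕ} {w : List (ℕ × ℕ)} : p :: w ∈ columnData (k :: ks) a st ↔
      p.1 ∈ k.firsts a ∧ p.2 ∈ k.seconds a (st.headD 0) p.1 ∧
        w ∈ columnData ks p.1 (k.next p.2 st) := by
  simp only [columnData, mem_biUnion, mem_image, List.cons_eq_cons]
  constructor
  · rintro ⟨a', h1, l, h2, w', h3, rfl, rfl⟩; exact ⟨h1, h2, h3⟩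
  · rintro ⟨h1, h2, h3⟩; exact ⟨p.1, h1, p.2, h2, w, h3, rfl, rfl⟩

theorem length_of_mem_columnData {ks : List StepKind} {a : ℕ} {st : List ℕ}
    {w : List (ℕ × ℕ)} (hw : w ∈ columnData ks a st) : w.length = ks.length := by
  induction ks generalizing a st w with
  | nil => rw [nil_mem_columnData.1 hw]; rfl
  | cons k ks ih =>
    simp only [columnData, mem_biUnion, mem_image] at hw
    obtain ⟨a', -, l, -, w', h, rfl⟩ := hw
    rw [List.length_cons, List.length_cons, ih h]

/-! ### The transfer recursion and its evaluation by `peakOp`. -/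

section Sum

variable {A : Type*} [CommRing A] (q : A)

/-- The generating function of sequences of column data. -/
def dataSum (ks : List StepKind) (a : ℕ) (st : List ℕ) : A :=
  ∑ w ∈ columnData ks a st, q ^ dataWeight ks w

theorem dataSum_nil (a : ℕ) (st : List ℕ) : dataSum q [] a st = 1 := by
  simp [dataSum, columnData, dataWeight]

theorem dataSum_cons (k : StepKind) (ks : List StepKind) (a : ℕ) (st : List ℕ) :
    dataSum q (k :: ks) a st = ∑ a' ∈ k.firsts a, ∑ l ∈ k.seconds a (st.headD 0) a',
      q ^ k.weight (a', l) * dataSum q ks a' (k.next l st) := by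
  rw [dataSum, columnData, sum_biUnion]
  · refine sum_congr rfl fun a' _ => ?_
    rw [sum_biUnion]
    · refine sum_congr rfl fun l _ => ?_
      rw [sum_image (fun _ _ _ _ h => List.tail_eq_of_cons_eq h), dataSum, mul_sum]
      exact sum_congr rfl fun w _ => by rw [dataWeight, pow_add]
    · intro l _ l' _ hne
      rw [Function.onFun, disjoint_left]
      intro w h1 h2
      rw [mem_image] at h1 h2
      obtain ⟨w1, -, rfl⟩ := h1
      obtain ⟨w2, -, h⟩ := h2
      rw [List.cons_eq_cons, Prod.mk.injEq] at h
      exact hne h.1.2.symm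
  · intro a' _ a'' _ hne
    rw [Function.onFun, disjoint_left]
    intro w h1 h2
    simp only [mem_biUnion, mem_image] at h1 h2
    obtain ⟨l1, -, w1, -, rfl⟩ := h1
    obtain ⟨l2, -, w2, -, h⟩ := h2
    rw [List.cons_eq_cons, Prod.mk.injEq] at h
    exact hne h.1.1.symm

theorem dataSum_cons_cons (k : StepKind) (ks : List StepKind) (a b : ℕ) (st : List ℕ) :
    dataSum q (k :: ks) a (b :: st) = ∑ a' ∈ k.firsts a, ∑ l ∈ k.seconds a b a',
      q ^ k.weight (a', l) * dataSum q ks a' (k.next l (b :: st)) :=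
  dataSum_cons q k ks a (b :: st)

/-- In terms of the excess x over the joined layers. The vanishing of g below b disposes of the step
that would leave fewer than b boxes in the column. -/
theorem sum_downSteps_add (g : ℕ → A) (b x : ℕ) (hg : ∀ y < b, g y = 0) :
    ∑ y ∈ downSteps (x + b), g y = g (x + b) + if x = 0 then 0 else g (x - 1 + b) := by
  rw [downSteps]
  split_ifs with h1 h2 h2
  · rw [sum_singleton, add_zero]
  · omega
  · rw [sum_pair (by omega), hg (x + b - 1) (by omega)]
  · rw [sum_pair (by omega), show x + b - 1 = x - 1 + b by omega]

theorem sum_Icc_add (g : ℕ → A) (b x : ℕ) :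
    ∑ l ∈ Icc b (x + b), g l = ∑ l ∈ range (x + 1), g (l + b) := by
  rw [range_eq_Ico, sum_Ico_add' g 0 (x + 1) b, zero_add,
    show x + 1 + b = (x + b) + 1 by ring, Ico_add_one_right_eq_Icc]

/-- Removing the b layers joined throughout reduces to b = 0 at the cost of q^b per chord: an
opening step weighs only the boxes above its joins, a closing step weighs all boxes. With l layers
joined under the chord, `F` acts by a power of `peakOp` with l as new base. Summing over l is
`chordOp`, and the hook factor [|F| + 1] makes it one more power of `peakOp`. -/
theorem dataSum_chord [IsDomain A] (hq : q ≠ 1) {F : PlaneTree EdgeMark}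
    (hF : ∀ (ks : List StepKind) (a b : ℕ) (st : List ℕ), b ≤ a →
      hookProd q F * dataSum q (stepKinds F ++ ks) a (b :: st) =
        q ^ (b * F.numEdges) *
          (peakOp q)^[F.numEdges] (fun x => dataSum q ks (x + b) (b :: st)) (a - b))
    {ks : List StepKind} {b r : ℕ} {st : List ℕ} {φ : ℕ → A} {H : A}
    (hks : ∀ y, b ≤ y → H * dataSum q ks y (b :: st) = q ^ (b * r) * φ (y - b)) {a : ℕ}
    (hab : b ≤ a) :
    qInt q (F.numEdges + 1) * (hookProd q F * H) *
        dataSum q (.opening :: (stepKinds F ++ .closing :: ks)) a (b :: st) =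
      q ^ (b * (F.numEdges + 1 + r)) * (peakOp q)^[F.numEdges + 1] φ (a - b) := by
  obtain ⟨x, rfl⟩ := Nat.exists_eq_add_of_le' hab
  set n := F.numEdges with hn
  have hin : ∀ a' l, b ≤ l → l ≤ a' →
      hookProd q F * H * (q ^ (a' - l) * dataSum q (stepKinds F ++ .closing :: ks) a'
        (l :: b :: st)) = q ^ (b * (n + 1 + r)) * (q ^ (a' - b - (l - b) + (l - b) * n) *
          (peakOp q)^[n] (fun y => q ^ (y + (l - b)) * φ (y + (l - b)) +
            q ^ (y + (l - b) + 1) * φ (y + (l - b) + 1)) (a' - b - (l - b))) := by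
    intro a' l h1 h2
    obtain ⟨m, rfl⟩ := Nat.exists_eq_add_of_le' h1
    -- The closing step keeps the number of boxes or adds one, and drops the base m + b back to b.
    have e1 : (fun y => H * dataSum q (.closing :: ks) (y + (m + b)) ((m + b) :: b :: st)) =
        (fun y => q ^ (b * (r + 1)) * (q ^ (y + m) * φ (y + m) +
            q ^ (y + m + 1) * φ (y + m + 1))) := by
      funext y
      rw [dataSum_cons_cons]
      simp only [StepKind.firsts, StepKind.seconds, StepKind.next, StepKind.weight,
        List.tail_cons]
      have e3 : ({l ∈ Icc (m + b) (y + (m + b)) | l = m + b} : Finset ℕ) = {m + b} := by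
        ext z
        rw [mem_filter, mem_Icc, mem_singleton]
        omega
      rw [e3, sum_pair (by omega), sum_singleton, sum_singleton, mul_add, mul_left_comm,
        hks _ (by omega), mul_left_comm H, hks _ (by omega),
        show y + (m + b) - b = y + m by omega, show y + (m + b) + 1 - b = y + m + 1 by omega]
      ring
    have e2 := hF (.closing :: ks) a' (m + b) (b :: st) h2
    rw [show hookProd q F * H * (q ^ (a' - (m + b)) *
        dataSum q (stepKinds F ++ .closing :: ks) a' ((m + b) :: b :: st)) =
      H * q ^ (a' - (m + b)) * (hookProd q F *
        dataSum q (stepKinds F ++ .closing :: ks) a' ((m + b) :: b :: st)) by ring, e2]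
    have e4 := congrFun (iterate_peakOp_smul q H n
      (fun y => dataSum q (.closing :: ks) (y + (m + b)) ((m + b) :: b :: st))) (a' - (m + b))
    rw [e1, iterate_peakOp_smul] at e4
    simp only at e4
    rw [Nat.add_sub_cancel, show a' - b - m = a' - (m + b) by omega,
      show H * q ^ (a' - (m + b)) * (q ^ ((m + b) * n) * (peakOp q)^[n] (fun y =>
        dataSum q (.closing :: ks) (y + (m + b)) ((m + b) :: b :: st)) (a' - (m + b))) =
      q ^ (a' - (m + b)) * q ^ ((m + b) * n) * (H * (peakOp q)^[n] (fun y =>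
        dataSum q (.closing :: ks) (y + (m + b)) ((m + b) :: b :: st)) (a' - (m + b))) by ring,
      ← e4]
    ring
  rw [← chordOp_iterate_peakOp q hq n φ, Nat.add_sub_cancel, mul_assoc (qInt q (n + 1)),
    mul_left_comm (q ^ _)]
  congr 1
  rw [dataSum_cons_cons]
  simp only [StepKind.firsts, StepKind.seconds, StepKind.next, StepKind.weight]
  have hcore : ∀ z, hookProd q F * H * ∑ l ∈ Icc b (z + b), q ^ (z + b - l) *
      dataSum q (stepKinds F ++ .closing :: ks) (z + b) (l :: b :: st) =
        q ^ (b * (n + 1 + r)) * chordCore q n (peakOp q)^[n] φ z := by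
    intro z
    rw [sum_Icc_add, chordCore, mul_sum, mul_sum]
    refine sum_congr rfl fun l hl => ?_
    rw [mem_range] at hl
    rw [hin _ _ (by omega) (by omega)]
    simp only [Nat.add_sub_cancel]
  rw [sum_downSteps_add]
  · rw [chordOp, mul_add, mul_add, hcore]
    split_ifs
    · simp
    · rw [hcore]
  · intro y hy
    rw [Icc_eq_empty (by omega), sum_empty]

/-- Up to its hook product, a Dyck word acts through its number of chords only; this is why the
final product does not see the shape of the tree. -/
theorem hookProd_mul_dataSum_of_undotted [IsDomain A] (hq : q ≠ 1) {T : PlaneTree EdgeMark}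
    (hT : IsUndotted T) (ks : List StepKind) (a b : ℕ) (st : List ℕ) (hab : b ≤ a) :
    hookProd q T * dataSum q (stepKinds T ++ ks) a (b :: st) =
      q ^ (b * T.numEdges) *
        (peakOp q)^[T.numEdges] (fun x => dataSum q ks (x + b) (b :: st)) (a - b) := by
  induction T generalizing ks a b st with
  | nil => simp [hookProd, stepKinds, PlaneTree.numEdges, Nat.sub_add_cancel hab]
  | cons e F R ih1 ih2 =>
    obtain ⟨he, hF, hR⟩ := hT
    simp only [hookProd, stepKinds, PlaneTree.numEdges, he, Bool.false_eq_true, if_false,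
      List.cons_append, List.append_assoc]
    rw [dataSum_chord q hq (fun ks a b st => ih1 hF ks a b st)
      (fun y hy => ih2 hR ks y b st hy) hab, ← Function.iterate_add_apply]

/-- As in the undotted case for chords; the two steps of a dotted edge compose to `doubleUpOp`,
whose hook factor is [2(|F| + 1)]. -/
theorem hookProd_mul_dataSum [IsDomain A] (hq : q ≠ 1) {T : PlaneTree EdgeMark}
    (hT : IsSpined T) (a b : ℕ) (st : List ℕ) (hab : b ≤ a) :
    hookProd q T * dataSum q (stepKinds T) a (b :: st) =
      q ^ (b * T.numEdges) * (peakOp q)^[T.numEdges] (fun _ => 1) (a - b) := by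
  induction T generalizing a b st with
  | nil => simp [hookProd, stepKinds, PlaneTree.numEdges, dataSum_nil]
  | cons e F R ih1 ih2 =>
    rcases hT with ⟨he, rfl, hF⟩ | ⟨he, hF, hR⟩
    · obtain ⟨x, rfl⟩ := Nat.exists_eq_add_of_le' hab
      simp only [hookProd, stepKinds, PlaneTree.numEdges, he, if_true, add_zero, mul_one]
      set n := F.numEdges with hn
      rw [Nat.add_sub_cancel, ← doubleUpOp_iterate_peakOp q hq n, mul_left_comm (q ^ _), mul_assoc]
      congr 1
      have hmid : ∀ z st', hookProd q F * dataSum q (.odd :: stepKinds F) (z + b) (b :: st') =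
          q ^ (b * n) * ((∑ l ∈ range (z + 1) with Even l,
            q ^ (z - l + l * n) * (peakOp q)^[n] (fun _ => 1) (z - l)) +
              if z = 0 then 0 else ∑ l ∈ range (z - 1 + 1) with Even l,
                q ^ (z - 1 - l + l * n) * (peakOp q)^[n] (fun _ => 1) (z - 1 - l)) := by
        intro z st'
        have hcore : ∀ z, hookProd q F * ∑ l ∈ Icc b (z + b) with Even (l - b),
            q ^ (z + b - l) * dataSum q (stepKinds F) (z + b) (l :: b :: st') =
              q ^ (b * n) * ∑ l ∈ range (z + 1) with Even l,
                q ^ (z - l + l * n) * (peakOp q)^[n] (fun _ => 1) (z - l) := by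
          intro z
          rw [sum_filter, sum_filter, sum_Icc_add, mul_sum, mul_sum]
          refine sum_congr rfl fun l hl => ?_
          rw [mem_range] at hl
          rw [Nat.add_sub_cancel]
          split_ifs
          · rw [mul_left_comm, ih1 hF _ _ _ (by omega), show z + b - (l + b) = z - l by omega]
            ring
          · simp
        rw [dataSum_cons_cons]
        simp only [StepKind.firsts, StepKind.seconds, StepKind.next, StepKind.weight]
        rw [sum_downSteps_add]
        · rw [mul_add, mul_add, hcore]
          split_ifs
          · simp
          · rw [hcore]
        · intro y hy
          rw [Icc_eq_empty (by omega), filter_empty, sum_empty]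
      rw [dataSum_cons_cons]
      simp only [StepKind.firsts, StepKind.seconds, StepKind.next, StepKind.weight]
      have hin : ∀ z, ({l ∈ Icc b (z + b) | l = b} : Finset ℕ) = {b} := by
        intro z
        ext l
        rw [mem_filter, mem_Icc, mem_singleton]
        omega
      rw [sum_downSteps_add]
      · rw [hin, hin, sum_singleton, sum_singleton, mul_add, mul_left_comm, hmid, doubleUpOp,
          mul_add (q ^ (b * (n + 1)))]
        congr 1
        · ring
        · split_ifs with hx
          · simp
          · rw [mul_left_comm, hmid]; ring
      · intro y hy
        rw [Icc_eq_empty (by omega), filter_empty, sum_empty]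
    · simp only [hookProd, stepKinds, PlaneTree.numEdges, he, Bool.false_eq_true, if_false]
      rw [dataSum_chord q hq
        (fun ks a b st => hookProd_mul_dataSum_of_undotted q hq hF ks a b st)
        (fun y hy => ih2 hR y b st hy) hab, ← Function.iterate_add_apply]

end Sum

end BallotTiling

namespace BallotTiling

open Finset

/-! ### Column data and valuations -/

/-- The first entries of a sequence of column data. -/
def boxCount (W : List (ℕ × ℕ)) (x : ℕ) : ℕ := (W.getD x (0, 0)).1

/-- The second entries of a sequence of column data. -/
def linkCount (W : List (ℕ × ℕ)) (x : ℕ) : ℕ := (W.getD x (0, 0)).2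

theorem drop_eq_cons {W : List (ℕ × ℕ)} {o : ℕ} (h : o < W.length) :
    W.drop o = (boxCount W o, linkCount W o) :: W.drop (o + 1) := by
  rw [List.drop_eq_getElem_cons h, boxCount, linkCount, List.getD_eq_getElem _ _ h]

theorem StepKind.mem_seconds_closing {a b a' l : ℕ} :
    l ∈ closing.seconds a b a' ↔ l = b ∧ b ≤ a := by
  rw [seconds, mem_filter, mem_Icc]; omega

theorem StepKind.mem_seconds_even {a b a' l : ℕ} :
    l ∈ even.seconds a b a' ↔ l = b ∧ b ≤ a' := by
  rw [seconds, mem_filter, mem_Icc]; omega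

theorem StepKind.mem_seconds_odd {a b a' l : ℕ} :
    l ∈ odd.seconds a b a' ↔ b ≤ l ∧ l ≤ a' ∧ Even (l - b) := by
  rw [seconds, mem_filter, mem_Icc, and_assoc]

theorem StepKind.mem_seconds_opening {a b a' l : ℕ} :
    l ∈ opening.seconds a b a' ↔ b ≤ l ∧ l ≤ a' := by
  rw [seconds, mem_Icc]

theorem length_stepKinds {T : PlaneTree EdgeMark} (hT : IsSpined T) :
    (stepKinds T).length = 2 * T.numEdges := by
  induction T with
  | nil => rfl
  | cons e F R ih1 ih2 =>
    rcases hT with ⟨he, rfl, hF⟩ | ⟨he, hF, hR⟩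
    · simp only [stepKinds, he, if_true, List.length_cons, PlaneTree.numEdges, ih1 hF]; ring
    · simp only [stepKinds, he, Bool.false_eq_true, if_false, List.length_cons,
        List.length_append, PlaneTree.numEdges, ih1 hF.isSpined, ih2 hR]; ring

theorem mem_columnData_chord {W : List (ℕ × ℕ)} {F : PlaneTree EdgeMark}
    (hF : ∀ (ks : List StepKind) (o b : ℕ) (st : List ℕ),
      W.length = o + 1 + 2 * F.numEdges + ks.length →
      (W.drop (o + 1) ∈ columnData (stepKinds F ++ ks) (boxCount W o) (b :: st) ↔
        IsValuation (boxCount W) (linkCount W) F o b ∧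
          W.drop (o + 2 * F.numEdges + 1) ∈
            columnData ks (boxCount W (o + 2 * F.numEdges)) (b :: st)))
    {ks : List StepKind} {o b : ℕ} {st : List ℕ}
    (hW : W.length = o + 1 + (2 * F.numEdges + 2) + ks.length) :
    W.drop (o + 1) ∈ columnData (.opening :: (stepKinds F ++ .closing :: ks)) (boxCount W o)
      (b :: st) ↔
    (b ≤ linkCount W (o + 1) ∧ linkCount W (o + 1) ≤ boxCount W (o + 1) ∧
      (boxCount W (o + 1) = boxCount W o ∨ boxCount W (o + 1) + 1 = boxCount W o)) ∧
    IsValuation (boxCount W) (linkCount W) F (o + 1) (linkCount W (o + 1)) ∧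
    (linkCount W (o + 1 + 2 * F.numEdges + 1) = linkCount W (o + 1) ∧
      linkCount W (o + 1) ≤ boxCount W (o + 1 + 2 * F.numEdges) ∧
      (boxCount W (o + 1 + 2 * F.numEdges + 1) = boxCount W (o + 1 + 2 * F.numEdges) ∨
        boxCount W (o + 1 + 2 * F.numEdges + 1) = boxCount W (o + 1 + 2 * F.numEdges) + 1)) ∧
    W.drop (o + 1 + 2 * F.numEdges + 1 + 1) ∈
      columnData ks (boxCount W (o + 1 + 2 * F.numEdges + 1)) (b :: st) := by
  rw [drop_eq_cons (by omega), cons_mem_columnData, List.headD_cons]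
  simp only [StepKind.firsts, StepKind.mem_seconds_opening, StepKind.next]
  rw [hF _ _ _ _ (by simp only [List.length_cons]; omega), drop_eq_cons (by omega),
    cons_mem_columnData, List.headD_cons]
  simp only [StepKind.firsts, StepKind.mem_seconds_closing, StepKind.next, List.tail_cons,
    mem_downSteps, mem_insert, mem_singleton]
  rw [show o + 1 + 2 * F.numEdges + 1 + 1 = o + 1 + 2 * F.numEdges + 2 by ring]
  tauto

theorem mem_columnData_of_undotted {W : List (ℕ × ℕ)} {T : PlaneTree EdgeMark}
    (hT : IsUndotted T) (ks : List StepKind) (o b : ℕ) (st : List ℕ)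
    (hW : W.length = o + 1 + 2 * T.numEdges + ks.length) :
    W.drop (o + 1) ∈ columnData (stepKinds T ++ ks) (boxCount W o) (b :: st) ↔
      IsValuation (boxCount W) (linkCount W) T o b ∧
        W.drop (o + 2 * T.numEdges + 1) ∈
          columnData ks (boxCount W (o + 2 * T.numEdges)) (b :: st) := by
  induction T generalizing ks o b st with
  | nil => simp [stepKinds, IsValuation, PlaneTree.numEdges]
  | cons e F R ih1 ih2 =>
    obtain ⟨he, hF, hR⟩ := hT
    simp only [PlaneTree.numEdges] at hW
    simp only [stepKinds, he, Bool.false_eq_true, if_false, List.cons_append, List.append_assoc,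
      IsValuation, PlaneTree.numEdges]
    rw [mem_columnData_chord (fun ks o b st => ih1 hF ks o b st)
      (by simp only [List.length_append]; rw [length_stepKinds hR.isSpined]; omega),
      ih2 hR _ _ _ _ (by omega)]
    rw [show o + 1 + 2 * F.numEdges + 1 + 2 * R.numEdges =
      o + 2 * (F.numEdges + 1 + R.numEdges) by ring]
    tauto

theorem mem_columnData_iff {W : List (ℕ × ℕ)} {T : PlaneTree EdgeMark}
    (hT : IsSpined T) (o b : ℕ) (st : List ℕ) (hW : W.length = o + 1 + 2 * T.numEdges) :
    W.drop (o + 1) ∈ columnData (stepKinds T) (boxCount W o) (b :: st) ↔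
      IsValuation (boxCount W) (linkCount W) T o b := by
  induction T generalizing o b st with
  | nil =>
    simp only [PlaneTree.numEdges] at hW
    simp [stepKinds, IsValuation, nil_mem_columnData]
    omega
  | cons e F R ih1 ih2 =>
    rcases hT with ⟨he, rfl, hF⟩ | ⟨he, hF, hR⟩
    · simp only [PlaneTree.numEdges] at hW
      simp only [stepKinds, he, if_true, IsValuation]
      rw [drop_eq_cons (by omega), cons_mem_columnData, List.headD_cons]
      simp only [StepKind.firsts, StepKind.mem_seconds_even, StepKind.next]
      rw [drop_eq_cons (by omega), cons_mem_columnData, List.headD_cons]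
      simp only [StepKind.firsts, StepKind.mem_seconds_odd, StepKind.next]
      rw [show o + 1 + 1 = o + 2 by ring, ih1 hF _ _ _ (by omega)]
      simp only [mem_downSteps]
      tauto
    · simp only [PlaneTree.numEdges] at hW
      simp only [stepKinds, he, Bool.false_eq_true, if_false, IsValuation]
      rw [mem_columnData_chord (fun ks o b st => mem_columnData_of_undotted hF ks o b st)
        (by rw [length_stepKinds hR]; omega), ih2 hR _ _ _ (by omega)]

theorem dataWeight_append {W : List (ℕ × ℕ)} {T : PlaneTree EdgeMark}
    (hT : IsSpined T) (ks : List StepKind) (o : ℕ)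
    (hW : W.length = o + 1 + 2 * T.numEdges + ks.length) :
    dataWeight (stepKinds T ++ ks) (W.drop (o + 1)) =
      valuationWeight (boxCount W) (linkCount W) T o +
        dataWeight ks (W.drop (o + 2 * T.numEdges + 1)) := by
  induction T generalizing ks o with
  | nil => simp [stepKinds, valuationWeight, PlaneTree.numEdges]
  | cons e F R ih1 ih2 =>
    rcases hT with ⟨he, rfl, hF⟩ | ⟨he, hF, hR⟩
    · simp only [PlaneTree.numEdges] at hW
      simp only [stepKinds, he, if_true, valuationWeight, List.cons_append, PlaneTree.numEdges]
      rw [drop_eq_cons (by omega), dataWeight, drop_eq_cons (by omega), dataWeight,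
        show o + 1 + 1 = o + 2 by ring, ih1 hF _ _ (by omega)]
      simp only [StepKind.weight]
      rw [show o + 2 + 2 * F.numEdges + 1 = o + 2 * (F.numEdges + 1 + 0) + 1 by ring]
      ring
    · simp only [PlaneTree.numEdges] at hW
      simp only [stepKinds, he, Bool.false_eq_true, if_false, valuationWeight, List.cons_append,
        List.append_assoc, PlaneTree.numEdges]
      rw [drop_eq_cons (by omega), dataWeight, ih1 hF.isSpined _ _ (by
          simp only [List.length_append, List.length_cons]; rw [length_stepKinds hR]; omega),
        drop_eq_cons (by omega), dataWeight, ih2 hR _ _ (by omega)]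
      simp only [StepKind.weight]
      rw [show o + 1 + 2 * F.numEdges + 1 + 2 * R.numEdges + 1 =
        o + 2 * (F.numEdges + 1 + R.numEdges) + 1 by ring]
      ring

theorem IsValuation.step {h : ℕ → ℤ} {c L : ℕ → ℕ} {T : PlaneTree EdgeMark} (hT : IsSpined T)
    {o b : ℕ} (hh : FollowsWord h T o) (hv : IsValuation c L T o b) {x : ℕ} (hx : o ≤ x)
    (hx' : x < o + 2 * T.numEdges) : L (x + 1) ≤ c (x + 1) ∧ L (x + 1) ≤ c x ∧
      (h (x + 1) = h x + 1 → c (x + 1) = c x ∨ c (x + 1) + 1 = c x) ∧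
      (h (x + 1) = h x - 1 → c (x + 1) = c x ∨ c (x + 1) = c x + 1) := by
  induction T generalizing o b with
  | nil => simp only [PlaneTree.numEdges] at hx'; omega
  | cons a F R ih1 ih2 =>
    rcases hT with ⟨ha, rfl, hF⟩ | ⟨ha, hF, hR⟩
    · simp only [IsValuation, ha, if_true] at hv
      simp only [FollowsWord, ha, if_true] at hh
      simp only [PlaneTree.numEdges] at hx'
      obtain ⟨h1, h2, h3⟩ := hh
      obtain ⟨⟨v1, v1', v1''⟩, ⟨v2, v2', -, v2''⟩, v3⟩ := hv
      rcases Nat.lt_or_ge x (o + 2) with hlt | hge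
      · obtain rfl | rfl : x = o ∨ x = o + 1 := by omega
        · exact ⟨by omega, by omega, fun _ => v1'', fun _ => by omega⟩
        · rw [show o + 1 + 1 = o + 2 by ring]
          exact ⟨by omega, by omega, fun _ => v2'', fun _ => by omega⟩
      · exact ih1 hF h3 v3 hge (by omega)
    · simp only [IsValuation, ha, Bool.false_eq_true, if_false] at hv
      simp only [FollowsWord, ha, Bool.false_eq_true, if_false] at hh
      simp only [PlaneTree.numEdges] at hx'
      obtain ⟨h1, h2, h3, h4⟩ := hh
      obtain ⟨⟨v1, v1', v1''⟩, v2, ⟨v3, v3', v3''⟩, v4⟩ := hv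
      rcases Nat.lt_or_ge x (o + 1 + 2 * F.numEdges + 1) with hlt | hge
      · rcases Nat.lt_or_ge x (o + 1) with hlt' | hge'
        · obtain rfl : x = o := by omega
          exact ⟨by omega, by omega, fun _ => v1'', fun _ => by omega⟩
        · rcases Nat.lt_or_ge x (o + 1 + 2 * F.numEdges) with hlt'' | hge''
          · exact ih1 hF.isSpined h2 v2 hge' hlt''
          · obtain rfl : x = o + 1 + 2 * F.numEdges := by omega
            exact ⟨by omega, by omega, fun _ => by omega, fun _ => v3''⟩
      · exact ih2 hR h4 v4 hge (by omega)

/-- The sequence of column data with given entries in the columns `0, …, N`. -/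
def columns (c L : ℕ → ℕ) (N : ℕ) : List (ℕ × ℕ) := (List.range (N + 1)).map fun x => (c x, L x)

theorem length_columns (c L : ℕ → ℕ) (N : ℕ) : (columns c L N).length = N + 1 := by
  simp [columns]

theorem boxCount_columns {c L : ℕ → ℕ} {N : ℕ} (h : ∀ x, N < x → c x = 0) :
    boxCount (columns c L N) = c := by
  funext x
  rcases Nat.lt_or_ge x (N + 1) with hx | hx
  · rw [boxCount, List.getD_eq_getElem _ _ (by rwa [length_columns])]
    simp [columns]
  · rw [boxCount, List.getD_eq_default _ _ (by rwa [length_columns]), h x hx]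

theorem linkCount_columns {c L : ℕ → ℕ} {N : ℕ} (h : ∀ x, N < x → L x = 0) :
    linkCount (columns c L N) = L := by
  funext x
  rcases Nat.lt_or_ge x (N + 1) with hx | hx
  · rw [linkCount, List.getD_eq_getElem _ _ (by rwa [length_columns])]
    simp [columns]
  · rw [linkCount, List.getD_eq_default _ _ (by rwa [length_columns]), h x hx]

theorem columns_eq {W : List (ℕ × ℕ)} {N : ℕ} (h : W.length = N + 1) :
    columns (boxCount W) (linkCount W) N = W := by
  apply List.ext_getElem
  · rw [length_columns, h]
  · intro i h1 h2
    simp only [columns, List.getElem_map, List.getElem_range, boxCount, linkCount]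
    rw [List.getD_eq_getElem _ _ h2]

theorem columns_injective {c L c' L' : ℕ → ℕ} {N o : ℕ} (hc : ∀ x ≤ o, c x = c' x)
    (hL : ∀ x ≤ o, L x = L' x) (h : (columns c L N).drop (o + 1) = (columns c' L' N).drop (o + 1))
    {x : ℕ} (hx : x ≤ N) : c x = c' x ∧ L x = L' x := by
  rcases Nat.lt_or_ge o x with hlt | hge
  · obtain ⟨d, rfl⟩ := Nat.exists_eq_add_of_lt hlt
    have := congrArg (fun l => l[d]?) h
    simp only [List.getElem?_drop, columns, List.getElem?_map,
      show o + 1 + d = o + d + 1 by ring,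
      List.getElem?_range (show o + d + 1 < N + 1 by omega), Option.map_some,
      Option.some.injEq, Prod.mk.injEq] at this
    exact this
  · exact ⟨hc x hge, hL x hge⟩

/-! ### The generating function of the tilings -/

-- A pair of upper path and tiling is sent to its column counts after abscissa `o`. If `o = 1`, the
-- word begins with an extra up step, and column 1 is empty because `c` starts at 0 and cannot grow
-- along an up step.
open Polynomial in
theorem genFunBILower_eq_dataSum {lam : List DyckStep} (hlam : IsBallotPath lam)
    {T : PlaneTree EdgeMark} (hT : IsSpined T) {o : ℕ} (hh : FollowsWord (height lam) T o)
    (hN : o + 2 * T.numEdges = lam.length) (ho : o = 0 ∨ o = 1 ∧ height lam 1 = 1) :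
    genFunBILower lam = dataSum (X : ℤ[X]) (stepKinds T) 0 [0] := by
  have hzero : ∀ c L, Layered (height lam) lam.length c L → ∀ x ≤ o, c x = 0 := by
    intro c L hl x hx
    rcases Nat.eq_zero_or_pos x with rfl | hx0
    · exact hl.c_zero
    · rcases ho with rfl | ⟨rfl, h1⟩
      · omega
      · have h2 := hl.up 0 (by omega) (by rw [height_zero]; simpa using h1)
        have h3 := hl.c_zero
        rw [zero_add] at h2
        rw [show x = 1 by omega]
        omega
  have htil : ∀ mu Til, mu ∈ (words lam.length).filter (fun mu => IsAbove mu lam) →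
      Til ∈ tilingsBI lam mu → IsAbove mu lam ∧
        Layered (height lam) lam.length (cover Til) (link Til) ∧
        Til = tilingOf lam (cover Til) (link Til) ∧
        IsValuation (cover Til) (link Til) T o 0 ∧
        ∀ x ≤ lam.length, height mu x = height lam x + 2 * cover Til x := by
    intro mu Til hmu hTil
    rw [mem_filter] at hmu
    have hb := hasBallotRuns_of_tiling hlam hTil hmu.2
    rw [tilingsBI, mem_filter] at hTil
    have hl := layered_of_tiling hlam hTil.2.1 hTil.2.2.1 hmu.2
    have hLo : link Til o = 0 := by
      have := hl.le o; have := hzero _ _ hl o le_rfl; omega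
    refine ⟨hmu.2, hl, eq_tilingOf hlam hTil.2.1 hTil.2.2.1 hmu.2, ?_,
      fun x hx => height_eq_cover hlam hTil.2.1 hTil.2.2.1 hmu.2 hx⟩
    have := hb.isValuation hl hT hh hN le_rfl rfl
      (fun i i1 i2 => by rw [le_antisymm i1 i2]) (fun i _ _ => by rw [hLo]; exact Nat.zero_le _)
    rwa [hLo] at this
  rw [genFunBILower, dataSum]
  simp only [genFunBI]
  rw [sum_sigma']
  have hlen : ∀ c L, (columns c L lam.length).length = o + 1 + 2 * T.numEdges := by
    intro c L; rw [length_columns]; omega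
  refine sum_bij (fun p _ => (columns (cover p.2) (link p.2) lam.length).drop (o + 1)) ?_ ?_ ?_ ?_
  · rintro ⟨mu, Til⟩ hp
    rw [mem_sigma] at hp
    obtain ⟨-, hl, -, hv, -⟩ := htil mu Til hp.1 hp.2
    have hc := boxCount_columns (L := link Til) hl.c_top
    have hL := linkCount_columns (c := cover Til) fun x hx => hl.L_top hx
    have := mem_columnData_iff (W := columns (cover Til) (link Til) lam.length) hT o 0 []
      (hlen _ _)
    rw [hc, hL, hzero _ _ hl o le_rfl] at this
    exact this.2 hv
  · rintro ⟨mu, Til⟩ hp ⟨mu', Til'⟩ hp' heq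
    rw [mem_sigma] at hp hp'
    dsimp only at hp hp' heq
    obtain ⟨ha, hl, he, -, hmu⟩ := htil mu Til hp.1 hp.2
    obtain ⟨ha', hl', he', -, hmu'⟩ := htil mu' Til' hp'.1 hp'.2
    have hc0 : ∀ x ≤ o, cover Til x = cover Til' x := fun x hx => by
      rw [hzero _ _ hl x hx, hzero _ _ hl' x hx]
    have hL0 : ∀ x ≤ o, link Til x = link Til' x := fun x hx => by
      have := hl.le x; have := hl'.le x
      have := hzero _ _ hl x hx; have := hzero _ _ hl' x hx
      omega
    have key := fun x (hx : x ≤ lam.length) => columns_injective hc0 hL0 heq hx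
    have hc : cover Til = cover Til' := by
      funext x
      rcases Nat.lt_or_ge lam.length x with hx | hx
      · rw [hl.c_top x hx, hl'.c_top x hx]
      · exact (key x hx).1
    have hL : link Til = link Til' := by
      funext x
      rcases Nat.lt_or_ge lam.length x with hx | hx
      · rw [hl.L_top hx, hl'.L_top hx]
      · exact (key x hx).2
    have e1 : mu = mu' := by
      apply eq_of_height (ha.1.trans ha'.1.symm)
      intro i hi
      rw [ha.1] at hi
      rw [hmu i hi, hmu' i hi, hc]
    have e2 : Til = Til' := by rw [he, he', hc, hL]
    subst e1 e2
    rfl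
  · intro w hw
    have hwl : w.length = 2 * T.numEdges := by
      rw [length_of_mem_columnData hw, length_stepKinds hT]
    -- The columns 0, …, o contain no boxes; padding with zeros makes list positions agree with
    -- abscissae.
    set W := List.replicate (o + 1) ((0, 0) : ℕ × ℕ) ++ w with hWdef
    have hWl : W.length = lam.length + 1 := by
      rw [hWdef, List.length_append, List.length_replicate]; omega
    have hdrop : W.drop (o + 1) = w := by
      rw [hWdef, List.drop_left' (by simp)]
    have hW0 : ∀ x ≤ o, W.getD x (0, 0) = (0, 0) := by
      intro x hx
      rw [hWdef, List.getD_append _ _ _ _ (by simp; omega), List.getD_replicate _ (by omega)]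
    have hc0 : ∀ x ≤ o, boxCount W x = 0 := fun x hx => by rw [boxCount, hW0 x hx]
    have hL0 : ∀ x ≤ o, linkCount W x = 0 := fun x hx => by rw [linkCount, hW0 x hx]
    have hctop : ∀ x, lam.length < x → boxCount W x = 0 := fun x hx => by
      rw [boxCount, List.getD_eq_default _ _ (by omega)]
    have hLtop : ∀ x, lam.length < x → linkCount W x = 0 := fun x hx => by
      rw [linkCount, List.getD_eq_default _ _ (by omega)]
    have hv : IsValuation (boxCount W) (linkCount W) T o 0 := by
      rw [← mem_columnData_iff hT o 0 [] (by omega), hdrop, hc0 o le_rfl]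
      exact hw
    have hstep := fun x (h1 : o ≤ x) (h2 : x < o + 2 * T.numEdges) => hv.step hT hh h1 h2
    have hl : Layered (height lam) lam.length (boxCount W) (linkCount W) := by
      refine ⟨hc0 0 (Nat.zero_le _), hctop, fun x => ?_, fun x => ?_, fun x hx hu => ?_,
        fun x hx hd => ?_⟩
      · rcases Nat.lt_or_ge o x with h1 | h1
        · rcases Nat.lt_or_ge lam.length x with h2 | h2
          · rw [hLtop x h2]; omega
          · obtain ⟨y, rfl⟩ := Nat.exists_eq_add_of_lt h1
            exact (hstep (o + y) (by omega) (by omega)).1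
        · rw [hL0 x h1]; omega
      · rcases Nat.lt_or_ge x o with h1 | h1
        · rw [hL0 _ h1]; omega
        · rcases Nat.lt_or_ge x lam.length with h2 | h2
          · exact (hstep x h1 (by omega)).2.1
          · rw [hLtop _ (by omega)]; omega
      · rcases Nat.lt_or_ge x o with h1 | h1
        · rw [hc0 _ h1, hc0 _ h1.le]; omega
        · exact (hstep x h1 (by omega)).2.2.1 hu
      · rcases Nat.lt_or_ge x o with h1 | h1
        · rw [hc0 _ h1, hc0 _ h1.le]; omega
        · exact (hstep x h1 (by omega)).2.2.2 hd
    have hb := hv.hasBallotRuns hl hT hh hN (fun x hx _ => hc0 x hx)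
    obtain ⟨mu, hmul, hmu⟩ := exists_height_eq (fun x => height lam x + 2 * boxCount W x)
      lam.length (by simp [height_zero, hc0 0 (Nat.zero_le _)]) (fun x hx => by
        rcases height_succ_or hx with h1 | h1
        · have := hl.up x hx h1; omega
        · have := hl.down x hx h1; omega)
    refine ⟨⟨mu, tilingOf lam (boxCount W) (linkCount W)⟩, ?_, ?_⟩
    · rw [mem_sigma, mem_filter, mem_words]
      refine ⟨⟨hmul, hmul, fun i hi => ?_⟩, tilingOf_mem_tilingsBI hl hb hmu⟩
      rw [hmu i hi]; omega
    · have e1 : cover (tilingOf lam (boxCount W) (linkCount W)) = boxCount W :=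
        funext fun x => cover_tilingOf hl x
      have e2 : link (tilingOf lam (boxCount W) (linkCount W)) = linkCount W :=
        funext fun x => link_tilingOf hl x
      dsimp only
      rw [e1, e2, columns_eq hWl, hdrop]
  · rintro ⟨mu, Til⟩ hp
    rw [mem_sigma] at hp
    dsimp only at hp ⊢
    obtain ⟨-, hl, he, hv, -⟩ := htil mu Til hp.1 hp.2
    have hw := dataWeight_append (W := columns (cover Til) (link Til) lam.length) hT [] o
      (by rw [hlen]; rfl)
    rw [List.append_nil, boxCount_columns hl.c_top, linkCount_columns fun x hx => hl.L_top hx,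
      dataWeight.eq_def [], add_zero, ← sum_art_tilingOf hl hT hh hv hN (hzero _ _ hl), ← he] at hw
    rw [hw]

end BallotTiling

namespace BallotTiling

open Finset

/-! ### Ballot paths without arrows -/

/-- The path belonging to a tree whose dotted edges stand for pairs of unmatched up steps. -/
def treeWord : PlaneTree EdgeMark → List DyckStep
  | .nil => []
  | .cons a F R =>
      if a.dot then .U :: .U :: treeWord F
      else .U :: (treeWord F ++ .D :: treeWord R)

theorem length_treeWord {T : PlaneTree EdgeMark} (hT : IsSpined T) :
    (treeWord T).length = 2 * T.numEdges := by
  induction T with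
  | nil => rfl
  | cons e F R ih1 ih2 =>
    rcases hT with ⟨he, rfl, hF⟩ | ⟨he, hF, hR⟩
    · simp only [treeWord, he, if_true, List.length_cons, PlaneTree.numEdges, ih1 hF]; ring
    · simp only [treeWord, he, Bool.false_eq_true, if_false, List.length_cons,
        List.length_append, PlaneTree.numEdges, ih1 hF.isSpined, ih2 hR]; ring

theorem height_succ_of_drop {l l' : List DyckStep} {a : DyckStep} {o : ℕ} (h : l.drop o = a :: l') :
    height l (o + 1) = height l o + (if a = DyckStep.U then 1 else -1) ∧ l.drop (o + 1) = l' := by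
  have ho : o < l.length := by
    by_contra hlt
    rw [List.drop_eq_nil_of_le (not_lt.1 hlt)] at h
    exact List.cons_ne_nil _ _ h.symm
  have h' := h
  rw [List.drop_eq_getElem_cons ho, List.cons_eq_cons] at h'
  exact ⟨by rw [height_succ ho, h'.1], h'.2⟩

theorem followsWord_of_drop {lam : List DyckStep} {T : PlaneTree EdgeMark} (hT : IsSpined T)
    {o : ℕ} {rest : List DyckStep} (h : lam.drop o = treeWord T ++ rest) :
    FollowsWord (height lam) T o := by
  induction T generalizing o rest with
  | nil => trivial
  | cons e F R ih1 ih2 =>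
    rcases hT with ⟨he, rfl, hF⟩ | ⟨he, hF, hR⟩
    · simp only [treeWord, he, if_true, List.cons_append] at h
      simp only [FollowsWord, he, if_true]
      obtain ⟨h1, h2⟩ := height_succ_of_drop h
      obtain ⟨h3, h4⟩ := height_succ_of_drop h2
      exact ⟨by simpa using h1, by simpa using h3, ih1 hF h4⟩
    · simp only [treeWord, he, Bool.false_eq_true, if_false, List.cons_append,
        List.append_assoc] at h
      simp only [FollowsWord, he, Bool.false_eq_true, if_false]
      obtain ⟨h1, h2⟩ := height_succ_of_drop h
      have h3 : lam.drop (o + 1 + 2 * F.numEdges) = .D :: (treeWord R ++ rest) := by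
        rw [← List.drop_drop, h2, ← length_treeWord hF.isSpined, List.drop_left]
      obtain ⟨h4, h5⟩ := height_succ_of_drop h3
      exact ⟨by simpa using h1, ih1 hF.isSpined h2, by simpa [sub_eq_add_neg] using h4, ih2 hR h5⟩

/-- The structure of the outermost level of a suffix with `m` unmatched up steps and tree `T`. -/
def IsOuter (m : ℕ) (T : PlaneTree EdgeMark) (l : List DyckStep) : Prop :=
  (Even m ∧ IsSpined T ∧ l = treeWord T) ∨
    (Odd m ∧ ∃ T', IsSpined T' ∧ T = .cons ⟨true, false⟩ T' .nil ∧ l = .U :: treeWord T')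

/-- The structure of a suffix with trees `cur` (innermost level), `pend` (outer levels). -/
def IsParsed (m : ℕ) : PlaneTree EdgeMark → List (PlaneTree EdgeMark) → List DyckStep → Prop
  | cur, [], l => IsOuter m cur l
  | cur, T :: pend, l =>
      IsUndotted cur ∧ ∃ l', l = treeWord cur ++ .D :: l' ∧ IsParsed m T pend l'

/-- An arrow marks an outermost chord with an odd number of unmatched up steps to its right. Without
arrows the unmatched steps numbered 2r and 2r - 1 from the right are adjacent, so dotted edges stand
for factors UU; when the count is odd, the leftmost unmatched step has no partner. -/
theorem isParsed_parse (l : List DyckStep) (h : NoArrows (parse l).current)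
    (h' : ∀ T ∈ (parse l).pending, NoArrows T) :
    IsParsed (parse l).unmatched (parse l).current (parse l).pending l := by
  induction l with
  | nil => exact Or.inl ⟨Even.zero, trivial, rfl⟩
  | cons a l ih =>
    cases a with
    | D =>
      simp only [parse] at h h' ⊢
      rw [List.forall_mem_cons] at h'
      exact ⟨trivial, l, rfl, ih h'.1 h'.2⟩
    | U =>
      rcases hp : (parse l).pending with _ | ⟨R, outer⟩
      · rw [hp] at ih
        by_cases hm : Even (parse l).unmatched
        · simp only [parse, hp, hm, if_true] at h h' ⊢
          have hcur : NoArrows (parse l).current := fun e he =>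
            h e (by simp [PlaneTree.preOrder, he])
          rcases ih hcur (by simp) with ⟨-, h2, h3⟩ | ⟨hodd, -⟩
          · exact Or.inr ⟨hm.add_one, _, h2, rfl, by rw [← h3]⟩
          · exact absurd hm (Nat.not_even_iff_odd.2 hodd)
        · simp only [parse, hp, hm, if_false] at h h' ⊢
          rcases ih h (by simp) with ⟨heven, -⟩ | ⟨hodd, T', h2, h3, h4⟩
          · exact absurd heven hm
          · refine Or.inl ⟨hodd.add_one, ?_, ?_⟩
            · rw [h3]; exact Or.inl ⟨rfl, rfl, h2⟩
            · rw [h3, h4]; simp [treeWord]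
      · rw [hp] at ih
        simp only [parse, hp] at h h' ⊢
        have hcur : NoArrows (parse l).current := fun e he =>
          h e (by simp [PlaneTree.preOrder, he])
        have hR : NoArrows R := fun e he => h e (by simp [PlaneTree.preOrder, he])
        have harrow := h _ (by rw [PlaneTree.preOrder]; exact List.mem_cons_self)
        obtain ⟨h1, l', h2, h3⟩ := ih hcur (by rw [List.forall_mem_cons]; exact ⟨hR, h'⟩)
        rcases outer with _ | ⟨S, outer⟩
        · rcases h3 with ⟨heven, h4, h5⟩ | ⟨hodd, -⟩
          · refine Or.inl ⟨heven, Or.inr ⟨rfl, h1, h4⟩, ?_⟩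
            have e : l = treeWord (parse l).current ++ .D :: treeWord R := by rwa [h5] at h2
            conv_lhs => rw [e]
            simp [treeWord]
          -- The new chord would carry an arrow here.
          · simp [hodd] at harrow
        · obtain ⟨h4, l'', h5, h6⟩ := h3
          refine ⟨⟨rfl, h1, h4⟩, l'', ?_, h6⟩
          have e : l = treeWord (parse l).current ++ .D :: (treeWord R ++ .D :: l'') := by
            rwa [h5] at h2
          conv_lhs => rw [e]
          simp [treeWord]

/-- Each D still lacking its U takes the suffix one unit below its starting level; a ballot path
therefore leaves none pending. -/
theorem exists_height_eq_neg_pending (l : List DyckStep) :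
    ∃ i ≤ l.length, height l i = -((parse l).pending.length : ℤ) := by
  induction l with
  | nil => exact ⟨0, le_rfl, by simp [height_zero, parse]⟩
  | cons a l ih =>
    obtain ⟨i, hi, h⟩ := ih
    cases a with
    | D =>
      refine ⟨i + 1, by simpa using hi, ?_⟩
      rw [height_cons_succ, h]
      simp [parse]
    | U =>
      rcases hp : (parse l).pending with _ | ⟨R, outer⟩
      · refine ⟨0, Nat.zero_le _, ?_⟩
        rw [height_zero]
        simp only [parse, hp]
        split_ifs <;> simp
      · refine ⟨i + 1, by simpa using hi, ?_⟩
        rw [height_cons_succ, h, hp]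
        simp [parse, hp]

theorem exists_tree_of_noArrows {lam : List DyckStep} (hlam : IsBallotPath lam)
    (harrow : NoArrows (ballotTree lam)) :
    ∃ (T : PlaneTree EdgeMark) (o : ℕ), IsSpined T ∧ FollowsWord (height lam) T o ∧
      o + 2 * T.numEdges = lam.length ∧
        ((o = 0 ∧ ballotTree lam = T) ∨
          (o = 1 ∧ height lam 1 = 1 ∧ ballotTree lam = .cons ⟨true, false⟩ T .nil)) := by
  have hpend : (parse lam).pending = [] := by
    obtain ⟨i, hi, h⟩ := exists_height_eq_neg_pending lam
    have := hlam i hi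
    rw [← List.length_eq_zero_iff]
    omega
  have hparsed := isParsed_parse lam harrow (by rw [hpend]; simp)
  rw [hpend] at hparsed
  rcases hparsed with ⟨-, h1, h2⟩ | ⟨-, T', h1, h2, h3⟩
  · refine ⟨_, 0, h1, followsWord_of_drop h1 (rest := []) ?_, ?_, Or.inl ⟨rfl, rfl⟩⟩
    · rw [List.drop_zero, List.append_nil]; exact h2
    · conv_rhs => rw [h2, length_treeWord h1]
      rw [zero_add]
  · refine ⟨T', 1, h1, followsWord_of_drop h1 (rest := []) ?_, ?_, Or.inr ⟨rfl, ?_, h2⟩⟩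
    · rw [h3, List.append_nil]; rfl
    · conv_rhs => rw [h3, List.length_cons, length_treeWord h1]
      ring
    · rw [h3, height_cons_succ, height_zero]; rfl

/-! ### Comparison of the two product formulas. -/

theorem qInt_X_isRegular (n : ℕ) : IsRegular (qInt (Polynomial.X : Polynomial ℤ) (n + 1)) := by
  rw [isRegular_iff_ne_zero]
  intro h
  have := congrArg (Polynomial.eval 1) h
  simp [qInt, Polynomial.eval_finsetSum] at this
  omega

theorem X_ne_one_int : (Polynomial.X : Polynomial ℤ) ≠ 1 := by
  intro h
  have := congrArg (Polynomial.eval 0) h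
  simp at this

theorem hookProd_ne_zero (T : PlaneTree EdgeMark) :
    hookProd (Polynomial.X : Polynomial ℤ) T ≠ 0 := by
  induction T with
  | nil => exact one_ne_zero
  | cons a F R ih1 ih2 =>
    rw [hookProd]
    refine mul_ne_zero ?_ (mul_ne_zero ih1 ih2)
    split_ifs
    · exact (qInt_X_isRegular (2 * F.numEdges + 1)).ne_zero
    · exact (qInt_X_isRegular _).ne_zero

/-- If the number of unmatched up steps is odd, the tree of `lam` has an additional dotted edge
above `T`, but no box sits above the extra step. The generating function is that of `T`, and the
factor [2E] enters both the hook product and the right-hand side. -/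
theorem hookProd_mul_genFunBILower {lam : List DyckStep} (hlam : IsBallotPath lam)
    (harrow : NoArrows (ballotTree lam)) : IsSpined (ballotTree lam) ∧
      hookProd Polynomial.X (ballotTree lam) * genFunBILower lam =
        ∏ i ∈ range (ballotTree lam).numEdges, qInt Polynomial.X (2 * (i + 1)) := by
  obtain ⟨T, o, hT, hh, hN, ho⟩ := exists_tree_of_noArrows hlam harrow
  have h1 := genFunBILower_eq_dataSum hlam hT hh hN
    (ho.imp (fun h => h.1) fun h => ⟨h.1, h.2.1⟩)
  have h2 := hookProd_mul_dataSum (Polynomial.X : Polynomial ℤ) X_ne_one_int hT 0 0 [] le_rfl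
  rw [zero_mul, pow_zero, one_mul, iterate_peakOp_one_zero _ X_ne_one_int, ← h1] at h2
  rcases ho with ⟨-, he⟩ | ⟨-, -, he⟩
  · rw [he]
    exact ⟨hT, h2⟩
  · rw [he]
    refine ⟨Or.inl ⟨rfl, rfl, hT⟩, ?_⟩
    simp only [hookProd, PlaneTree.numEdges, if_true, add_zero, mul_one]
    rw [prod_range_succ, ← h2]
    ring

end BallotTiling

open Classical in
theorem mainTheorem10 (lam : List DyckStep) (hlam : BallotTiling.IsBallotPath lam)
    (harrow : BallotTiling.NoArrows (BallotTiling.ballotTree lam))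
    (L₀ : BallotTiling.PlaneTree (BallotTiling.EdgeMark × ℕ))
    (hL₀ : BallotTiling.IsNaturalLabelling (BallotTiling.ballotTree lam) L₀)
    (hpre : BallotTiling.preWord L₀ =
      List.range' 1 (BallotTiling.ballotTree lam).numEdges) :
    ∃ σ₀ : BallotTiling.SignedPerm (BallotTiling.ballotTree lam).numEdges,
      σ₀.oneLine = BallotTiling.postWord L₀ ∧
      (∀ σ, BallotTiling.SignedPerm.WeakLeftGE σ σ₀ → σ₀.inv ≤ σ.inv) ∧
      BallotTiling.genFunBILower lam =
        ∑ σ ∈ Finset.univ.filter (fun σ => BallotTiling.SignedPerm.WeakLeftGE σ σ₀),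
          (Polynomial.X : Polynomial ℤ) ^ (σ.inv - σ₀.inv) := by
  obtain ⟨hT, hgen⟩ := BallotTiling.hookProd_mul_genFunBILower hlam harrow
  have hL : L₀ = BallotTiling.numberFrom 1 (BallotTiling.ballotTree lam) := by
    have := BallotTiling.eq_numberFrom_of_preWord L₀ 1 (by rw [hL₀.1]; exact hpre)
    rwa [hL₀.1] at this
  obtain ⟨σ₀, h1, h2, h3⟩ := BallotTiling.exists_reference_perm (Polynomial.X : Polynomial ℤ)
    BallotTiling.qInt_X_isRegular (isRegular_iff_ne_zero.2 Polynomial.X_ne_zero) hT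
  refine ⟨σ₀, by rw [h1, hL], h2, ?_⟩
  exact mul_left_cancel₀ (BallotTiling.hookProd_ne_zero _) (hgen.trans h3.symm)
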